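/- Let $n\ge 1$. Let $\mathcal K(\mathbb R^n)$ be the space of nonempty compact convex subsets of $\mathbb R^n$ with the Hausdorff metric, $h_K(y)=\sup_{x\in K}\langle x,y\rangle$ the support function of $K$, and $\mathcal M(S^{n-1})$ the complex vector space of finite complex Borel measures on the Euclidean unit sphere, with the weak* topology given by integration of functions in $C(S^{n-1})$ (complex-valued continuous functions). Write $\Psi(K;\phi)=\int_{S^{n-1}}\phi\,d\Psi(K)$. Let $\mathrm{Area}(\mathbb R^n)$ be the complex vector space of all maps $\Psi:\mathcal K(\mathbb R^n)\to\mathcal M(S^{n-1})$ that are (i) continuous with respect to the weak* topology, (ii) locally determined: if $h_K|_U=h_L|_U$ for an open set $U\subset S^{n-1}$, then $\Psi(K)|_U=\Psi(L)|_U$, and (iii) translation invariant: $\Psi(K+x)=\Psi(K)$ for all $K$ and all $x\in\mathbb R^n$. For an integer $k\ge0$ let $\mathrm{Area}_k(\mathbb R^n)$ be the subspace of all $\Psi\in\mathrm{Area}(\mathbb R^n)$ with $\Psi(tK)=t^k\Psi(K)$ for all $t\ge 0$ and all $K$ (with $0^0=1$). For every $K\in\mathcal K(\mathbb R^n)$ there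 is exactly one finite nonnegative Borel measure $S_{n-1}(K)$ on $S^{n-1}$, the surface area measure of $K$, such that $$\frac{d}{dt}\Big|_{t=0^+}\mathrm{vol}(K+tL)=\int_{S^{n-1}}h_L\,dS_{n-1}(K)\qquad\text{for all } L\in\mathcal K(\mathbb R^n).$$ Moreover, there is a direct sum decomposition $$\mathrm{Area}(\mathbb R^n)=\bigoplus_{k=0}^{n-1}\mathrm{Area}_k(\mathbb R^n),$$ and the following holds. 1. The map $\Psi\mapsto\Psi(\{0\})$ is an isomorphism of complex vector spaces $\mathrm{Area}_0(\mathbb R^n)\cong\mathcal M(S^{n-1})$. 2. A map $\Psi:\mathcal K(\mathbb R^n)\to\mathcal M(S^{n-1})$ belongs to $\mathrm{Area}_{n-1}(\mathbb R^n)$ if and only if there exists $\psi\in C(S^{n-1})$ such that $$\Psi(K;\phi)=\int_{S^{n-1}}\phi\,\psi\,dS_{n-1}(K)\qquad\text{for all }K\in\mathcal K(\mathbb R^n),\ \phi\in C(S^{n-1}).$$ This function $\psi$ is uniquely determined by $\Psi$. -/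

import Mathlib

open MeasureTheory

noncomputable section

/-- Euclidean space `ℝⁿ`. -/
abbrev Eucl (n : ℕ) : Type := EuclideanSpace ℝ (Fin n)

/-- The Euclidean unit sphere `S^{n-1}` of `ℝⁿ`, with its subspace topology and Borel σ-algebra. -/
abbrev USphere (n : ℕ) : Type := Metric.sphere (0 : Eucl n) 1

/-- The space `𝓚(ℝⁿ)` of nonempty compact convex subsets, with the Hausdorff metric. -/
abbrev Bodies (n : ℕ) : Type := ConvexBody (Eucl n)

/-- The space `𝓜(S^{n-1})` of finite complex Borel measures on the sphere. -/
abbrev SphereMeasure (n : ℕ) : Type := ComplexMeasure (USphere n)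

/-- The support function `h_K(y) = sup_{x ∈ K} ⟨x, y⟩`. -/
def supportFun {n : ℕ} (K : Bodies n) (y : Eucl n) : ℝ :=
  sSup ((fun x : Eucl n => inner ℝ x y) '' (K : Set (Eucl n)))

/-- The one-point body `{x}`; thus `K + pointBody x` is the translate `K + x`. -/
def pointBody {n : ℕ} (x : Eucl n) : Bodies n :=
  ⟨{x}, convex_singleton x, isCompact_singleton, Set.singleton_nonempty x⟩

/-- The integral `∫ φ dμ` of a continuous function against a complex measure. -/
def pairing {n : ℕ} (μ : SphereMeasure n) (φ : C(USphere n, ℂ)) : ℂ :=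
  VectorMeasure.integral μ φ (ContinuousLinearMap.mul ℝ ℂ)

instance sphereMeasure_variation_finite {n : ℕ} (μ : SphereMeasure n) :
    IsFiniteMeasure μ.variation := by
  have h : μ.variation ≤
      (ComplexMeasure.re μ).totalVariation + (ComplexMeasure.im μ).totalVariation := by
    refine VectorMeasure.variation_le_of_forall_enorm_le fun E _ => ?_
    have h1 := (ComplexMeasure.re μ).enorm_le_totalVariation E
    have h2 := (ComplexMeasure.im μ).enorm_le_totalVariation E
    rw [Measure.add_apply]
    refine le_trans ?_ (add_le_add h1 h2)
    have e : μ E = ((ComplexMeasure.re μ E : ℝ) : ℂ) + ((ComplexMeasure.im μ E : ℝ) : ℂ) * Complex.I :=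
      (Complex.re_add_im (μ E)).symm
    rw [e]
    refine (enorm_add_le _ _).trans (add_le_add ?_ ?_)
    · simp [enorm, nnnorm]
    · simp [enorm, nnnorm]
  exact isFiniteMeasure_of_le _ h

theorem integrable_continuousMap {n : ℕ} (μ : SphereMeasure n) (φ : C(USphere n, ℂ)) :
    μ.Integrable φ := by
  have : Integrable φ μ.variation :=
    Integrable.of_bound φ.continuous.aestronglyMeasurable ‖φ‖
      (Filter.Eventually.of_forall fun x => φ.norm_coe_le_norm x)
  exact this

theorem pairing_add {n : ℕ} (μ ν : SphereMeasure n) (φ : C(USphere n, ℂ)) :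
    pairing (μ + ν) φ = pairing μ φ + pairing ν φ :=
  VectorMeasure.integral_add_vectorMeasure (integrable_continuousMap μ φ)
    (integrable_continuousMap ν φ)

theorem pairing_smul {n : ℕ} (c : ℂ) (μ : SphereMeasure n) (φ : C(USphere n, ℂ)) :
    pairing (c • μ) φ = c * pairing μ φ := by
  set B := ContinuousLinearMap.mul ℝ ℂ with hB
  have hT0 := dominatedFinMeasAdditive_cbmApplyMeasure μ B
  have hT1 := dominatedFinMeasAdditive_cbmApplyMeasure (c • μ) B
  have hv : (c • μ).variation = ‖c‖₊ • μ.variation := by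
    simp [VectorMeasure.variation_smul]
  have hT : DominatedFinMeasAdditive μ.variation ((c • μ).transpose B) (‖B‖ * ‖c‖) := by
    refine ⟨fun s t hs ht _ _ hd => cbmApplyMeasure_union (c • μ) B hs ht hd,
      fun s hs hsf => ?_⟩
    refine (norm_cbmApplyMeasure_le (c • μ) B s).trans ?_
    rw [smul_apply, norm_smul, ← mul_assoc]
    gcongr
    exact VectorMeasure.norm_measure_le_variation hsf.ne
  have key : ∀ f : USphere n → ℂ, Integrable f μ.variation →
      setToFun μ.variation ((c • μ).transpose B) hT f
        = c * setToFun μ.variation (μ.transpose B) hT0 f := by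
    intro f hf
    refine Integrable.induction (fun f => setToFun μ.variation ((c • μ).transpose B) hT f
        = c * setToFun μ.variation (μ.transpose B) hT0 f) ?_ ?_ ?_ ?_ hf
    · intro a s hs hsf
      rw [setToFun_indicator_const hT hs hsf.ne, setToFun_indicator_const hT0 hs hsf.ne]
      change a * (c * μ s) = c * (a * μ s)
      ring
    · intro f g _ hf hg h1 h2
      rw [setToFun_add hT hf hg, setToFun_add hT0 hf hg, h1, h2, mul_add]
    · exact isClosed_eq (continuous_setToFun hT) (continuous_const.mul (continuous_setToFun hT0))
    · intro f g hfg _ h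
      rwa [← setToFun_congr_ae hT hfg, ← setToFun_congr_ae hT0 hfg]
  have h1 : pairing (c • μ) φ = setToFun μ.variation ((c • μ).transpose B) hT φ := by
    have hT2 : DominatedFinMeasAdditive (‖c‖₊ • μ.variation) ((c • μ).transpose B) ‖B‖ := hv ▸ hT1
    rw [setToFun_congr_smul_measure' ‖c‖₊ hT hT2]
    rw [pairing, VectorMeasure.integral_eq_setToFun]
    congr 1
  rw [h1, key φ (integrable_continuousMap μ φ), pairing, VectorMeasure.integral_eq_setToFun]

/-- `Area(ℝⁿ)`: the complex vector space of all maps `Ψ : 𝓚(ℝⁿ) → 𝓜(S^{n-1})` that are continuous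
for the weak* topology, locally determined, and translation invariant. -/
def Area (n : ℕ) : Submodule ℂ (Bodies n → SphereMeasure n) where
  carrier := {Ψ |
    (∀ φ : C(USphere n, ℂ), Continuous fun K => pairing (Ψ K) φ) ∧
    (∀ (K L : Bodies n) (U : Set (USphere n)), IsOpen U →
      (∀ u ∈ U, supportFun K u = supportFun L u) → (Ψ K).restrict U = (Ψ L).restrict U) ∧
    (∀ (K : Bodies n) (x : Eucl n), Ψ (K + pointBody x) = Ψ K)}
  zero_mem' := by
    refine ⟨fun φ => ?_, fun _ _ _ _ _ => rfl, fun _ _ => rfl⟩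
    simp only [Pi.zero_apply]
    exact continuous_const
  add_mem' := by
    rintro Ψ Θ ⟨h1, h2, h3⟩ ⟨g1, g2, g3⟩
    refine ⟨fun φ => ?_, fun K L U hU h => ?_, fun K x => ?_⟩
    · simp only [Pi.add_apply, pairing_add]
      exact (h1 φ).add (g1 φ)
    · simp only [Pi.add_apply, VectorMeasure.restrict_add, h2 K L U hU h, g2 K L U hU h]
    · simp only [Pi.add_apply, h3, g3]
  smul_mem' := by
    rintro c Ψ ⟨h1, h2, h3⟩
    refine ⟨fun φ => ?_, fun K L U hU h => ?_, fun K x => ?_⟩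
    · simp only [Pi.smul_apply, pairing_smul]
      exact continuous_const.mul (h1 φ)
    · simp only [Pi.smul_apply, VectorMeasure.restrict_smul, h2 K L U hU h]
    · simp only [Pi.smul_apply, h3]

/-- `Area_k(ℝⁿ)`: the subspace of those `Ψ ∈ Area(ℝⁿ)` with `Ψ(tK) = t^k Ψ(K)` for all `t ≥ 0`. -/
def AreaHom (n k : ℕ) : Submodule ℂ (Bodies n → SphereMeasure n) where
  carrier := {Ψ | Ψ ∈ Area n ∧
    ∀ (t : ℝ) (K : Bodies n), 0 ≤ t → Ψ (t • K) = ((t : ℂ) ^ k) • Ψ K}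
  zero_mem' := ⟨(Area n).zero_mem, fun t K _ => by simp⟩
  add_mem' := by
    rintro Ψ Θ ⟨h1, h2⟩ ⟨g1, g2⟩
    exact ⟨(Area n).add_mem h1 g1, fun t K ht => by
      simp only [Pi.add_apply, h2 t K ht, g2 t K ht, smul_add]⟩
  smul_mem' := by
    rintro c Ψ ⟨h1, h2⟩
    exact ⟨(Area n).smul_mem c h1, fun t K ht => by
      simp only [Pi.smul_apply, h2 t K ht, smul_comm c]⟩

/-- `μ` is a surface area measure of `K`: for every convex body `L`, the (one-sided) derivative of
`t ↦ vol(K + tL)` at `t = 0⁺` exists and equals `∫ h_L dμ`. -/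
def IsSurfaceAreaMeasure {n : ℕ} (K : Bodies n) (μ : FiniteMeasure (USphere n)) : Prop :=
  ∀ L : Bodies n, HasDerivWithinAt
    (fun t : ℝ => (volume : Measure (Eucl n)).real ((K + t • L : Bodies n) : Set (Eucl n)))
    (∫ u, supportFun L u ∂(μ : Measure (USphere n))) (Set.Ici 0) 0

open Classical in
/-- The surface area measure `S_{n-1}(K)`: the measure with `IsSurfaceAreaMeasure K`. (There is
exactly one such measure when `n ≥ 1`.) -/
def surfaceArea {n : ℕ} (K : Bodies n) : FiniteMeasure (USphere n) :=
  if h : ∃ μ : FiniteMeasure (USphere n), IsSurfaceAreaMeasure K μ then h.choose else 0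

/-- `Ψ(K; φ) = ∫ φ ψ dS_{n-1}(K)` for all `K` and all continuous `φ`, i.e. `Ψ = ψ • S_{n-1}`. -/
def HasSurfaceDensity {n : ℕ} (Ψ : Bodies n → SphereMeasure n) (ψ : C(USphere n, ℂ)) : Prop :=
  ∀ (K : Bodies n) (φ : C(USphere n, ℂ)),
    pairing (Ψ K) φ = ∫ u, φ u * ψ u ∂(surfaceArea K : Measure (USphere n))

end

noncomputable section

namespace LocalArea

open Set Filter Topology
open scoped Pointwise NNReal ENNReal CompactlySupported

/-! ### Support functions -/

section Support

variable {n : ℕ} (K L : Bodies n)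

/-! Everything rests on locality combined with translation invariance. If the support function of
`L` is linear near a direction `u`, then adding `L` acts near `u` like a translation, so a local,
translation invariant functional tested near `u` does not see it. Polytopes in general position are
dense, and for `n` of them in dimension `n` at least one is linear near each direction
(`dense_transversal`). Hence all mixed differences of order `n` of an area functional vanish
(`IsAreaFunctional.mixedDiff_eq_zero`), so `t ↦ Ψ(tK; φ)` is a polynomial of degree less than `n`.
Its coefficients are fixed linear combinations of the values `Ψ(jK; φ)`, so they again define area
maps; this is the homogeneous decomposition.

The surface area measure comes from the same principle. A volume change caused by a perturbation of
the support function on a closed set depends only on the support function near that set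
(`vol_sub_vol_eq_of_supportFun_eq`). This makes volume a polynomial under Minkowski addition
(`mixedDiff_vol_add`). Its first coefficient is additive and monotone in the second body, hence
extends to a positive functional on continuous functions, and the Riesz theorem represents it.
Uniqueness holds because differences of support functions are dense (`dense_diffSpace`).

In degree `n - 1 = m`, the mixed difference of order `m` no longer depends on the base point and is
additive in each entry. Generic `m`-tuples of polytopes look, near each direction, either degenerate
or like `m` independent segments (`dense_segmentLike`), so these mixed differences are controlled by
segments. Along a basis `e` of `u^⊥` the segment difference is concentrated at `±u`
(`IsAreaFunctional.segDiff_apply`), and a change of basis multiplies it by the absolute determinant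
(`IsAreaFunctional.segDiff_matrix`). The ratio to the corresponding quantity for `S_{n-1}` is
therefore a well-defined continuous function of `u`, the density. After subtraction of `ψ • S_{n-1}`
all segment differences vanish, so the remainder has degree less than `m` and, being homogeneous of
degree `m`, is zero. -/

theorem isCompact_image_inner (y : Eucl n) :
    IsCompact ((fun x : Eucl n => inner ℝ x y) '' (K : Set (Eucl n))) :=
  K.isCompact.image (by fun_prop)

variable {K L}

theorem inner_le_supportFun {x : Eucl n} (hx : x ∈ K) (y : Eucl n) :
    inner ℝ x y ≤ supportFun K y :=
  le_csSup (isCompact_image_inner K y).bddAbove ⟨x, hx, rfl⟩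

variable (K L)

theorem exists_inner_eq_supportFun (y : Eucl n) : ∃ x ∈ K, inner ℝ x y = supportFun K y :=
  (isCompact_image_inner K y).sSup_mem (K.nonempty.image _)

variable {K L}

theorem supportFun_le {y : Eucl n} {c : ℝ} (h : ∀ x ∈ K, inner ℝ x y ≤ c) :
    supportFun K y ≤ c := by
  obtain ⟨x, hx, e⟩ := exists_inner_eq_supportFun K y
  exact e ▸ h x hx

theorem supportFun_mono (h : (K : Set (Eucl n)) ⊆ L) (y : Eucl n) :
    supportFun K y ≤ supportFun L y :=
  supportFun_le fun _ hx => inner_le_supportFun (h hx) y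

variable (K L)

theorem supportFun_add (y : Eucl n) :
    supportFun (K + L) y = supportFun K y + supportFun L y := by
  apply le_antisymm
  · refine supportFun_le ?_
    rintro _ ⟨a, ha, b, hb, rfl⟩
    simp only [inner_add_left]
    exact add_le_add (inner_le_supportFun ha y) (inner_le_supportFun hb y)
  · obtain ⟨a, ha, ea⟩ := exists_inner_eq_supportFun K y
    obtain ⟨b, hb, eb⟩ := exists_inner_eq_supportFun L y
    rw [← ea, ← eb, ← inner_add_left]
    exact inner_le_supportFun (Set.add_mem_add ha hb) y

theorem supportFun_smul {t : ℝ} (ht : 0 ≤ t) (y : Eucl n) :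
    supportFun (t • K) y = t * supportFun K y := by
  apply le_antisymm
  · refine supportFun_le ?_
    rintro _ ⟨a, ha, rfl⟩
    simp only [inner_smul_left, RCLike.conj_to_real]
    exact mul_le_mul_of_nonneg_left (inner_le_supportFun ha y) ht
  · obtain ⟨a, ha, ea⟩ := exists_inner_eq_supportFun K y
    have : inner ℝ (t • a) y = t * inner ℝ a y := by simp [inner_smul_left]
    rw [← ea, ← this]
    exact inner_le_supportFun (Set.smul_mem_smul_set ha) y

theorem supportFun_pointBody (x y : Eucl n) : supportFun (pointBody x) y = inner ℝ x y := by
  apply le_antisymm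
  · refine supportFun_le ?_
    rintro _ rfl
    exact le_rfl
  · exact inner_le_supportFun (K := pointBody x) rfl y

theorem supportFun_add_right_le (y z : Eucl n) :
    supportFun K (y + z) ≤ supportFun K y + supportFun K z := by
  refine supportFun_le fun x hx => ?_
  rw [inner_add_right]
  exact add_le_add (inner_le_supportFun hx y) (inner_le_supportFun hx z)

theorem supportFun_smul_right {t : ℝ} (ht : 0 ≤ t) (y : Eucl n) :
    supportFun K (t • y) = t * supportFun K y := by
  apply le_antisymm
  · refine supportFun_le fun x hx => ?_
    rw [inner_smul_right]
    exact mul_le_mul_of_nonneg_left (inner_le_supportFun hx y) ht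
  · obtain ⟨a, ha, ea⟩ := exists_inner_eq_supportFun K y
    rw [← ea, ← inner_smul_right]
    exact inner_le_supportFun ha _

theorem continuous_supportFun : Continuous (supportFun K) := by
  obtain ⟨R, hR⟩ := K.isCompact.isBounded.exists_norm_le
  have h : ∀ y z, supportFun K y ≤ supportFun K z + R * dist y z := fun y z => by
    refine supportFun_le fun x hx => ?_
    have e : inner ℝ x y = inner ℝ x z + inner ℝ x (y - z) := by rw [inner_sub_right]; ring
    rw [e, dist_eq_norm]
    refine add_le_add (inner_le_supportFun hx z) ((real_inner_le_norm _ _).trans ?_)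
    exact mul_le_mul_of_nonneg_right (hR x hx) (norm_nonneg _)
  exact (LipschitzWith.of_le_add_mul' R h).continuous

variable {K L}

theorem exists_supportFun_lt_of_notMem {x : Eucl n} (hx : x ∉ K) :
    ∃ u : USphere n, supportFun K u < inner ℝ x u := by
  obtain ⟨f, c, hK, hc⟩ := geometric_hahn_banach_closed_point K.convex K.isClosed hx
  set y := (InnerProductSpace.toDual ℝ (Eucl n)).symm f with hy
  have hf : ∀ z, f z = inner ℝ z y := fun z => by
    rw [hy, real_inner_comm, InnerProductSpace.toDual_symm_apply]
  have h1 : supportFun K y < inner ℝ x y := by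
    obtain ⟨a, ha, e⟩ := exists_inner_eq_supportFun K y
    rw [← e, ← hf, ← hf]
    exact (hK a ha).trans hc
  have hy0 : y ≠ 0 := by
    intro h0
    rw [h0] at h1
    have := supportFun_smul_right K le_rfl (0 : Eucl n)
    simp only [zero_smul, zero_mul] at this
    simp [this] at h1
  have hn : 0 < ‖y‖ := norm_pos_iff.2 hy0
  refine ⟨⟨‖y‖⁻¹ • y, by simp [norm_smul, hn.ne']⟩, ?_⟩
  simp only
  rw [supportFun_smul_right K (by positivity), inner_smul_right]
  exact mul_lt_mul_of_pos_left h1 (by positivity)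

theorem mem_iff_forall_inner_le {x : Eucl n} :
    x ∈ K ↔ ∀ u : USphere n, inner ℝ x (u : Eucl n) ≤ supportFun K u := by
  refine ⟨fun h u => inner_le_supportFun h u, fun h => ?_⟩
  by_contra hx
  obtain ⟨u, hu⟩ := exists_supportFun_lt_of_notMem hx
  exact absurd (h u) (not_le.2 hu)

variable (K) in
/-- The support function as a continuous function on the sphere. -/
def supportMap : C(USphere n, ℝ) := ⟨fun u => supportFun K u, (continuous_supportFun K).comp
  continuous_subtype_val⟩

@[simp]
theorem supportMap_apply (u : USphere n) : supportMap K u = supportFun K u := rfl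

theorem supportMap_injective : Function.Injective (supportMap (n := n)) := by
  intro K L h
  ext x
  have : ∀ u : USphere n, supportFun K u = supportFun L u := fun u => DFunLike.congr_fun h u
  change x ∈ K ↔ x ∈ L
  simp only [mem_iff_forall_inner_le, this]

theorem coe_subset_iff : (K : Set (Eucl n)) ⊆ L ↔ supportMap K ≤ supportMap L := by
  refine ⟨fun h u => supportFun_mono h u, fun h x hx => ?_⟩
  exact mem_iff_forall_inner_le.2 fun u => (inner_le_supportFun hx _).trans (h u)

@[simp]
theorem supportMap_add (K L : Bodies n) : supportMap (K + L) = supportMap K + supportMap L := by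
  ext u; exact supportFun_add K L u

theorem supportMap_smul {t : ℝ} (ht : 0 ≤ t) (K : Bodies n) :
    supportMap (t • K) = t • supportMap K := by
  ext u; exact supportFun_smul K ht u

theorem pointBody_zero : pointBody (0 : Eucl n) = 0 := rfl

@[simp]
theorem supportMap_zero : supportMap (0 : Bodies n) = 0 := by
  ext u
  rw [← pointBody_zero]
  simpa using supportFun_pointBody (0 : Eucl n) u

theorem supportMap_sum {ι : Type*} (s : Finset ι) (K : ι → Bodies n) :
    supportMap (∑ i ∈ s, K i) = ∑ i ∈ s, supportMap (K i) := by
  classical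
  induction s using Finset.induction_on with
  | empty => simp
  | insert a s ha ih => simp [Finset.sum_insert ha, ih]

theorem supportFun_sum {ι : Type*} (s : Finset ι) (K : ι → Bodies n) (u : USphere n) :
    supportFun (∑ i ∈ s, K i) u = ∑ i ∈ s, supportFun (K i) u := by
  have := DFunLike.congr_fun (supportMap_sum s K) u
  simpa using this

theorem zero_smul_body (K : Bodies n) : (0 : ℝ) • K = 0 :=
  supportMap_injective (by rw [supportMap_smul le_rfl, zero_smul, supportMap_zero])

theorem add_smul_body {s t : ℝ} (hs : 0 ≤ s) (ht : 0 ≤ t) (K : Bodies n) :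
    (s + t) • K = s • K + t • K :=
  supportMap_injective (by
    rw [supportMap_add, supportMap_smul hs, supportMap_smul ht, supportMap_smul (by positivity),
      add_smul])

/-- The closed unit ball. -/
def ballBody (n : ℕ) : Bodies n :=
  ⟨Metric.closedBall 0 1, convex_closedBall 0 1, isCompact_closedBall 0 1,
    ⟨0, by simp⟩⟩

@[simp]
theorem supportMap_ballBody : supportMap (ballBody n) = 1 := by
  ext u
  have hu : ‖(u : Eucl n)‖ = 1 := by simp
  refine le_antisymm (supportFun_le fun x hx => ?_) ?_
  · have hx : ‖x‖ ≤ 1 := by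
      have : x ∈ Metric.closedBall (0 : Eucl n) 1 := hx
      simpa using this
    refine (real_inner_le_norm _ _).trans ?_
    rw [hu]; simpa using hx
  · have : inner ℝ (u : Eucl n) u ≤ supportFun (ballBody n) u :=
      inner_le_supportFun (K := ballBody n) (x := u)
        (show (u : Eucl n) ∈ Metric.closedBall (0 : Eucl n) 1 by simp) u
    rwa [real_inner_self_eq_norm_sq, hu, one_pow] at this

theorem supportFun_ballBody (u : USphere n) : supportFun (ballBody n) u = 1 := by
  exact DFunLike.congr_fun (supportMap_ballBody (n := n)) u

theorem exists_mem_dist_le {r : ℝ} (hr : 0 ≤ r)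
    (h : ∀ u : USphere n, supportFun K u ≤ supportFun L u + r) {x : Eucl n} (hx : x ∈ K) :
    ∃ y ∈ L, dist x y ≤ r := by
  have hm : x ∈ L + r • ballBody n := mem_iff_forall_inner_le.2 fun u => by
    rw [supportFun_add, supportFun_smul _ hr, supportFun_ballBody, mul_one]
    exact (inner_le_supportFun hx _).trans (h u)
  obtain ⟨y, hy, _, ⟨b, hb, rfl⟩, rfl⟩ := hm
  refine ⟨y, hy, ?_⟩
  have hb : ‖b‖ ≤ 1 := by
    have : b ∈ Metric.closedBall (0 : Eucl n) 1 := hb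
    simpa using this
  simp only [dist_eq_norm, add_sub_cancel_left, norm_smul, Real.norm_eq_abs, abs_of_nonneg hr]
  nlinarith

theorem supportFun_le_add_dist (u : USphere n) :
    supportFun K u ≤ supportFun L u + dist K L := by
  refine supportFun_le fun x hx => ?_
  refine le_of_forall_pos_le_add fun ε hε => ?_
  obtain ⟨y, hy, hxy⟩ := Metric.exists_dist_lt_of_hausdorffDist_lt hx
    (show Metric.hausdorffDist (K : Set (Eucl n)) L < dist K L + ε from
      lt_add_of_pos_right _ hε) ConvexBody.hausdorffEDist_ne_top
  have e : inner ℝ x (u : Eucl n) = inner ℝ y (u : Eucl n) + inner ℝ (x - y) (u : Eucl n) := by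
    rw [inner_sub_left]; ring
  have h2 : inner ℝ (x - y) (u : Eucl n) ≤ dist x y := by
    refine (real_inner_le_norm _ _).trans ?_
    simp [dist_eq_norm]
  have h3 := inner_le_supportFun hy (u : Eucl n)
  linarith

/-- An inequality `h_K ≤ h_L + r` on the sphere means `K ⊆ L + rB`, so the Hausdorff distance is the
sup distance of support functions. Continuity on the space of bodies thereby becomes a question in a
normed space of functions. -/
theorem isometry_supportMap : Isometry (supportMap (n := n)) := by
  refine Isometry.of_dist_eq fun K L => le_antisymm ?_ ?_
  · rw [ContinuousMap.dist_le dist_nonneg]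
    intro u
    rw [Real.dist_eq, abs_le]
    have h1 := supportFun_le_add_dist (K := K) (L := L) u
    have h2 := supportFun_le_add_dist (K := L) (L := K) u
    rw [dist_comm] at h2
    constructor <;> simp only [supportMap_apply] <;> linarith
  · have key : ∀ u : USphere n, |supportFun K u - supportFun L u| ≤
        dist (supportMap K) (supportMap L) := fun u => by
      have := ContinuousMap.dist_apply_le_dist (f := supportMap K) (g := supportMap L) u
      rwa [Real.dist_eq] at this
    refine Metric.hausdorffDist_le_of_mem_dist dist_nonneg (fun x hx => ?_) fun x hx => ?_
    · exact exists_mem_dist_le dist_nonneg (fun u => by linarith [(abs_le.1 (key u)).2]) hx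
    · exact exists_mem_dist_le (K := L) dist_nonneg
        (fun u => by linarith [(abs_le.1 (key u)).1]) hx

theorem continuous_iff_supportMap {X : Type*} [TopologicalSpace X] {f : X → Bodies n} :
    Continuous f ↔ Continuous fun x => supportMap (f x) :=
  isometry_supportMap.isEmbedding.isInducing.continuous_iff

theorem continuous_supportMap : Continuous (supportMap (n := n)) := isometry_supportMap.continuous

instance : ContinuousAdd (Bodies n) :=
  ⟨continuous_iff_supportMap.2 (by
    simp only [supportMap_add]
    exact (continuous_supportMap.comp continuous_fst).add
      (continuous_supportMap.comp continuous_snd))⟩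

theorem continuousOn_smul_body (K : Bodies n) :
    ContinuousOn (fun t : ℝ => t • K) (Ici 0) := by
  rw [isometry_supportMap.isEmbedding.isInducing.continuousOn_iff]
  refine ContinuousOn.congr (f := fun t : ℝ => t • supportMap K)
    (by fun_prop) fun t ht => supportMap_smul ht K

theorem continuous_const_smul_body {t : ℝ} (ht : 0 ≤ t) :
    Continuous fun K : Bodies n => t • K :=
  continuous_iff_supportMap.2 (by
    simp only [supportMap_smul ht]
    exact continuous_supportMap.const_smul t)

theorem smul_add_pointBody (t : ℝ) (K : Bodies n) (x : Eucl n) :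
    t • (K + pointBody x) = t • K + pointBody (t • x) := by
  rw [smul_add]
  congr 1
  ext y
  simp [pointBody]

end Support

/-! ### Hulls, polytopes and segments -/

section Hull

variable {n : ℕ}

theorem isCompact_convexJoin {s t : Set (Eucl n)} (hs : IsCompact s) (ht : IsCompact t) :
    IsCompact (convexJoin ℝ s t) := by
  have : convexJoin ℝ s t =
      (fun p : (Eucl n × Eucl n) × ℝ => (1 - p.2) • p.1.1 + p.2 • p.1.2) ''
        ((s ×ˢ t) ×ˢ Icc (0 : ℝ) 1) := by
    ext x
    simp only [mem_convexJoin, segment_eq_image]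
    constructor
    · rintro ⟨a, ha, b, hb, θ, hθ, rfl⟩
      exact ⟨((a, b), θ), ⟨⟨ha, hb⟩, hθ⟩, rfl⟩
    · rintro ⟨⟨⟨a, b⟩, θ⟩, ⟨⟨ha, hb⟩, hθ⟩, rfl⟩
      exact ⟨a, ha, b, hb, θ, hθ, rfl⟩
  rw [this]
  exact ((hs.prod ht).prod isCompact_Icc).image (by fun_prop)

/-- The convex hull of the union of two bodies. -/
def hullBody (K L : Bodies n) : Bodies n :=
  ⟨convexHull ℝ (K ∪ L), convex_convexHull ℝ _, by
    rw [K.convex.convexHull_union L.convex K.nonempty L.nonempty]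
    exact isCompact_convexJoin K.isCompact L.isCompact,
    (K.nonempty.mono subset_union_left).convexHull⟩

theorem inner_le_of_mem_convexHull {s : Set (Eucl n)} {y : Eucl n} {c : ℝ}
    (h : ∀ x ∈ s, inner ℝ x y ≤ c) {x : Eucl n} (hx : x ∈ convexHull ℝ s) : inner ℝ x y ≤ c := by
  have hc : Convex ℝ {x : Eucl n | inner ℝ x y ≤ c} :=
    convex_halfSpace_le ⟨fun a b => inner_add_left a b y, fun a b => by
      simp [inner_smul_left]⟩ c
  exact convexHull_min (fun x hx => h x hx) hc hx

@[simp]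
theorem supportMap_hullBody (K L : Bodies n) :
    supportMap (hullBody K L) = supportMap K ⊔ supportMap L := by
  apply le_antisymm
  · intro u
    refine supportFun_le fun x hx => inner_le_of_mem_convexHull ?_ hx
    rintro x (hx | hx)
    · exact (inner_le_supportFun hx _).trans (le_sup_left (a := supportFun K u))
    · exact (inner_le_supportFun hx _).trans (le_sup_right (b := supportFun L u))
  · refine sup_le (fun u => ?_) fun u => ?_
    · exact supportFun_mono (L := hullBody K L) (subset_union_left.trans (subset_convexHull ℝ _)) _
    · exact supportFun_mono (L := hullBody K L) (subset_union_right.trans (subset_convexHull ℝ _)) _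

/-- The polytope spanned by a finite family of points. -/
def polytope {ι : Type*} [Finite ι] [Nonempty ι] (x : ι → Eucl n) : Bodies n :=
  ⟨convexHull ℝ (range x), convex_convexHull ℝ _, (finite_range x).isCompact_convexHull ℝ,
    (range_nonempty x).convexHull⟩

theorem inner_le_supportFun_polytope {ι : Type*} [Finite ι] [Nonempty ι] (x : ι → Eucl n)
    (i : ι) (y : Eucl n) : inner ℝ (x i) y ≤ supportFun (polytope x) y :=
  inner_le_supportFun (K := polytope x) (subset_convexHull ℝ _ (mem_range_self i)) y

theorem supportFun_polytope_le {ι : Type*} [Finite ι] [Nonempty ι] {x : ι → Eucl n}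
    {y : Eucl n} {c : ℝ} (h : ∀ i, inner ℝ (x i) y ≤ c) : supportFun (polytope x) y ≤ c :=
  supportFun_le fun _ hz => inner_le_of_mem_convexHull (by rintro _ ⟨i, rfl⟩; exact h i) hz

theorem exists_supportFun_polytope_eq {ι : Type*} [Finite ι] [Nonempty ι] (x : ι → Eucl n)
    (y : Eucl n) : ∃ i, supportFun (polytope x) y = inner ℝ (x i) y := by
  obtain ⟨i, hi⟩ := Finite.exists_max fun i => inner ℝ (x i) y
  exact ⟨i, le_antisymm (supportFun_polytope_le hi) (inner_le_supportFun_polytope x i y)⟩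

theorem continuous_polytope {ι : Type*} [Finite ι] [Nonempty ι] :
    Continuous (polytope : (ι → Eucl n) → Bodies n) := by
  have := Fintype.ofFinite ι
  have h : ∀ (x z : ι → Eucl n) (u : USphere n),
      supportFun (polytope x) u ≤ supportFun (polytope z) u + dist x z := fun x z u => by
    refine supportFun_polytope_le fun i => ?_
    have e : inner ℝ (x i) (u : Eucl n) =
      inner ℝ (z i) (u : Eucl n) + inner ℝ (x i - z i) (u : Eucl n) := by rw [inner_sub_left]; ring
    have h2 : inner ℝ (x i - z i) (u : Eucl n) ≤ dist x z := by
      refine (real_inner_le_norm _ _).trans ?_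
      simpa [dist_eq_norm] using dist_le_pi_dist x z i
    have h3 := inner_le_supportFun_polytope z i (u : Eucl n)
    linarith
  refine LipschitzWith.continuous (K := 1) (LipschitzWith.of_dist_le_mul fun x z => ?_)
  rw [NNReal.coe_one, one_mul, ← isometry_supportMap.dist_eq, ContinuousMap.dist_le dist_nonneg]
  intro u
  have h1 := h x z u
  have h2 := h z x u
  rw [dist_comm] at h2
  rw [Real.dist_eq, abs_le]
  constructor <;> simp only [supportMap_apply] <;> linarith

/-- The segment from the origin to `e`. -/
def segBody (e : Eucl n) : Bodies n := polytope ![0, e]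

theorem supportFun_segBody (e : Eucl n) (y : Eucl n) :
    supportFun (segBody e) y = max 0 (inner ℝ e y) := by
  apply le_antisymm
  · refine supportFun_polytope_le fun i => ?_
    fin_cases i <;> simp
  · refine max_le ?_ ?_
    · simpa [segBody] using inner_le_supportFun_polytope ![0, e] 0 y
    · simpa [segBody] using inner_le_supportFun_polytope ![0, e] 1 y

theorem continuous_segBody : Continuous (segBody : Eucl n → Bodies n) := by
  refine continuous_polytope.comp (continuous_pi fun i => ?_)
  fin_cases i
  · exact continuous_const
  · exact continuous_id

theorem segBody_smul {t : ℝ} (ht : 0 ≤ t) (e : Eucl n) : segBody (t • e) = t • segBody e :=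
  supportMap_injective (by
    ext u
    rw [supportMap_smul ht]
    simp [supportFun_segBody, inner_smul_left, mul_max_of_nonneg _ _ ht])

theorem segBody_neg (e : Eucl n) : segBody (-e) = segBody e + pointBody (-e) :=
  supportMap_injective (by
    ext u
    rw [supportMap_add]
    simp only [supportMap_apply, ContinuousMap.add_apply, supportFun_segBody, supportFun_pointBody,
      inner_neg_left]
    rw [max_comm, ← sub_eq_add_neg, ← max_sub_sub_right, zero_sub, sub_self])

end Hull

/-! ### Differences of support functions -/

section Differences

variable {n : ℕ}

/-- The space of differences of support functions on the sphere. -/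
def diffSpace (n : ℕ) : Submodule ℝ C(USphere n, ℝ) where
  carrier := {f | ∃ A B : Bodies n, f = supportMap A - supportMap B}
  zero_mem' := ⟨0, 0, by simp⟩
  add_mem' := by
    rintro _ _ ⟨A, B, rfl⟩ ⟨A', B', rfl⟩
    exact ⟨A + A', B + B', by simp; abel⟩
  smul_mem' := by
    rintro c _ ⟨A, B, rfl⟩
    rcases le_total 0 c with hc | hc
    · exact ⟨c • A, c • B, by simp [supportMap_smul hc, smul_sub]⟩
    · refine ⟨(-c) • B, (-c) • A, ?_⟩
      simp [supportMap_smul (neg_nonneg.2 hc), smul_sub]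
      abel

theorem supportMap_mem_diffSpace (K : Bodies n) : supportMap K ∈ diffSpace n := ⟨K, 0, by simp⟩

theorem one_mem_diffSpace : (1 : C(USphere n, ℝ)) ∈ diffSpace n := by
  simpa using supportMap_mem_diffSpace (ballBody n)

/-- Over the common subtrahend `h_B + h_{B'}` the maximum becomes that of two support functions,
which is the support function of a convex hull. The lattice structure permits truncations later on.
-/
theorem sup_mem_diffSpace {f g : C(USphere n, ℝ)} (hf : f ∈ diffSpace n) (hg : g ∈ diffSpace n) :
    f ⊔ g ∈ diffSpace n := by
  obtain ⟨A, B, rfl⟩ := hf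
  obtain ⟨A', B', rfl⟩ := hg
  refine ⟨hullBody (A + B') (A' + B), B + B', ?_⟩
  ext u
  simp only [supportMap_hullBody, supportMap_add, ContinuousMap.sup_apply, ContinuousMap.sub_apply,
    ContinuousMap.add_apply]
  rw [← max_sub_sub_right]
  congr 1 <;> ring

theorem inf_mem_diffSpace {f g : C(USphere n, ℝ)} (hf : f ∈ diffSpace n) (hg : g ∈ diffSpace n) :
    f ⊓ g ∈ diffSpace n := by
  have : f ⊓ g = -(-f ⊔ -g) := by
    ext u
    simp [max_neg_neg]
  rw [this]
  exact neg_mem (sup_mem_diffSpace (neg_mem hf) (neg_mem hg))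

/-- This is the lattice form of Stone–Weierstrass; it remains to interpolate arbitrary values at two
points. -/
theorem dense_diffSpace : Dense (diffSpace n : Set C(USphere n, ℝ)) := by
  rw [dense_iff_closure_eq]
  refine ContinuousMap.sublattice_closure_eq_top _ ⟨0, zero_mem _⟩
    (fun f hf g hg => inf_mem_diffSpace hf hg) (fun f hf g hg => sup_mem_diffSpace hf hg) ?_
  intro v x y
  by_cases hxy : x = y
  · subst hxy
    exact ⟨v x • 1, (diffSpace n).smul_mem _ one_mem_diffSpace, by simp, by simp⟩
  set c : ℝ := inner ℝ (x : Eucl n) y with hc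
  have hx : inner ℝ (x : Eucl n) x = (1 : ℝ) := by simp
  have hy : inner ℝ (y : Eucl n) y = (1 : ℝ) := by simp
  have hyx : inner ℝ (y : Eucl n) x = c := real_inner_comm _ _
  have hc1 : c < 1 := by
    exact (inner_lt_one_iff_real_of_norm_eq_one (by simp) (by simp)).2 fun h => hxy (Subtype.ext h)
  -- The linear function `⟪x - y, ·⟫` takes the values `1 - c` at `x` and `-(1 - c)` at `y`, so a
  -- constant equal to the mean and a multiple of it fit both values.
  set β := (v x - v y) / (2 * (1 - c))
  refine ⟨((v x + v y) / 2) • (1 : C(USphere n, ℝ)) +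
    β • supportMap (pointBody ((x : Eucl n) - (y : Eucl n))), ?_, ?_, ?_⟩
  · exact add_mem ((diffSpace n).smul_mem _ one_mem_diffSpace)
      ((diffSpace n).smul_mem _ (supportMap_mem_diffSpace _))
  all_goals
    have : 1 - c ≠ 0 := by linarith
    simp only [ContinuousMap.add_apply, ContinuousMap.smul_apply, supportMap_apply,
      ContinuousMap.one_apply, supportFun_pointBody, inner_sub_left, hx, hy, hyx, ← hc,
      smul_eq_mul, β]
    field_simp
    ring

end Differences

/-! ### The volume of convex bodies -/

section Volume

variable {n : ℕ}

/-- The volume of a convex body. -/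
def vol (K : Bodies n) : ℝ := (volume : Measure (Eucl n)).real (K : Set (Eucl n))

theorem vol_mono {K L : Bodies n} (h : (K : Set (Eucl n)) ⊆ L) : vol K ≤ vol L :=
  measureReal_mono h L.isCompact.measure_lt_top.ne

theorem vol_add_pointBody (K : Bodies n) (x : Eucl n) : vol (K + pointBody x) = vol K := by
  have : ((K + pointBody x : Bodies n) : Set (Eucl n)) = (fun y => y + x) '' K := by
    rw [ConvexBody.coe_add]
    exact Set.add_singleton
  simp only [vol, measureReal_def, this, image_add_right, measure_preimage_add_right]

theorem vol_smul {t : ℝ} (ht : 0 ≤ t) (K : Bodies n) : vol (t • K) = t ^ n * vol K := by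
  simp only [vol, measureReal_def, ConvexBody.coe_smul, Measure.addHaar_smul, finrank_euclideanSpace,
    Fintype.card_fin, ENNReal.toReal_mul]
  rw [ENNReal.toReal_ofReal (abs_nonneg _), abs_of_nonneg (pow_nonneg ht n)]

theorem eventually_mem_of_mem_interior {K : Bodies n} {x : Eucl n}
    (hx : x ∈ interior (K : Set (Eucl n))) : ∀ᶠ L in 𝓝 K, x ∈ L := by
  obtain ⟨δ, hδ, hb⟩ := Metric.isOpen_iff.1 isOpen_interior x hx
  filter_upwards [Metric.ball_mem_nhds K (half_pos hδ)] with L hL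
  refine mem_iff_forall_inner_le.2 fun u => ?_
  have h1 : x + (δ / 2) • (u : Eucl n) ∈ K := by
    refine interior_subset (hb ?_)
    simp [norm_smul, abs_of_pos hδ, hδ]
  have h2 := inner_le_supportFun h1 (u : Eucl n)
  have hu : inner ℝ (u : Eucl n) u = (1 : ℝ) := by simp
  rw [inner_add_left, inner_smul_left, hu] at h2
  have h3 := supportFun_le_add_dist (K := K) (L := L) u
  rw [Metric.mem_ball, dist_comm] at hL
  simp at h2
  linarith

theorem eventually_notMem {K : Bodies n} {x : Eucl n} (hx : x ∉ K) : ∀ᶠ L in 𝓝 K, x ∉ L := by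
  obtain ⟨u, hu⟩ := exists_supportFun_lt_of_notMem hx
  filter_upwards [Metric.ball_mem_nhds K (sub_pos.2 hu)] with L hL hxL
  have h1 := inner_le_supportFun hxL (u : Eucl n)
  have h2 := supportFun_le_add_dist (K := L) (L := K) u
  rw [Metric.mem_ball] at hL
  linarith

/-- Membership of a point off the boundary of `K` is stable under small changes of `K`, and the
boundary of a convex set is null. Dominated convergence inside `K + B` does the rest. -/
theorem continuous_vol : Continuous (vol : Bodies n → ℝ) := by
  rw [continuous_iff_continuousAt]
  intro K
  have h := tendsto_measure_of_ae_tendsto_indicator (μ := (volume : Measure (Eucl n))) (𝓝 K)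
    (A := (K : Set (Eucl n))) (As := fun L : Bodies n => (L : Set (Eucl n)))
    K.isClosed.measurableSet (fun L => L.isClosed.measurableSet)
    (B := ((K + ballBody n : Bodies n) : Set (Eucl n)))
    (K + ballBody n).isClosed.measurableSet (K + ballBody n).isCompact.measure_lt_top.ne ?_ ?_
  · exact (ENNReal.tendsto_toReal K.isCompact.measure_lt_top.ne).comp h
  · filter_upwards [Metric.ball_mem_nhds K one_pos] with L hL
    refine coe_subset_iff.2 fun u => ?_
    have h2 := supportFun_le_add_dist (K := L) (L := K) u
    rw [Metric.mem_ball] at hL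
    change supportFun L u ≤ supportFun (K + ballBody n) u
    rw [supportFun_add, supportFun_ballBody]
    linarith
  · have h0 : (volume : Measure (Eucl n)) (frontier (K : Set (Eucl n))) = 0 :=
      K.convex.addHaar_frontier _
    filter_upwards [measure_eq_zero_iff_ae_notMem.1 h0] with x hx
    by_cases hxK : x ∈ (K : Set (Eucl n))
    · have : x ∈ interior (K : Set (Eucl n)) := by
        by_contra hi
        exact hx ⟨subset_closure hxK, hi⟩
      filter_upwards [eventually_mem_of_mem_interior this] with L hL
      exact ⟨fun _ => hxK, fun _ => hL⟩
    · filter_upwards [eventually_notMem hxK] with L hL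
      exact ⟨fun h => absurd h hL, fun h => absurd h hxK⟩

/-- An arc from `C` to the complement of `U` along which `x` is separated from `N` passes through
`U \ C`. -/
theorem exists_mem_diff_of_lt {C U : Set (USphere n)} (hC : IsClosed C) (hU : IsOpen U)
    (hCU : C ⊆ U) {N : Bodies n} {x : Eucl n} {u v : USphere n} (hu : u ∈ C) (hv : v ∉ U)
    (hxu : supportFun N u < inner ℝ x (u : Eucl n))
    (hxv : supportFun N v < inner ℝ x (v : Eucl n)) :
    ∃ w ∈ U \ C, supportFun N w < inner ℝ x (w : Eucl n) := by
  let p : unitInterval → Eucl n := fun s => (1 - (s : ℝ)) • (u : Eucl n) + (s : ℝ) • (v : Eucl n)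
  have hp : ∀ s, supportFun N (p s) < inner ℝ x (p s) := fun s => by
    have h1 := supportFun_add_right_le N ((1 - (s : ℝ)) • (u : Eucl n)) ((s : ℝ) • (v : Eucl n))
    rw [supportFun_smul_right N (by linarith [s.2.2]), supportFun_smul_right N s.2.1] at h1
    refine h1.trans_lt ?_
    simp only [p, inner_add_right, inner_smul_right]
    have s0 := s.2.1
    have s1 := s.2.2
    rcases s0.eq_or_lt with h | h
    · rw [← h]; simpa using hxu
    · have := mul_lt_mul_of_pos_left hxv h
      have := mul_le_mul_of_nonneg_left hxu.le (sub_nonneg.2 s1)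
      linarith
  -- At the origin both sides of the strict inequality are zero, so the segment avoids it and can be
  -- projected to the sphere. In particular antipodal endpoints are excluded automatically.
  have hp0 : ∀ s, p s ≠ 0 := fun s h0 => by
    have h := hp s
    have := supportFun_smul_right N le_rfl (0 : Eucl n)
    simp only [zero_smul, zero_mul] at this
    simp [h0, this] at h
  have hpc : Continuous p := by fun_prop
  let q : unitInterval → USphere n := fun s =>
    ⟨‖p s‖⁻¹ • p s, by simp [norm_smul, norm_ne_zero_iff.2 (hp0 s)]⟩
  have hqc : Continuous q := Continuous.subtype_mk
    ((hpc.norm.inv₀ fun s => norm_ne_zero_iff.2 (hp0 s)).smul hpc) _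
  have hq : ∀ s, supportFun N (q s) < inner ℝ x (q s : Eucl n) := fun s => by
    have : 0 < ‖p s‖⁻¹ := inv_pos.2 (norm_pos_iff.2 (hp0 s))
    simp only [q]
    rw [supportFun_smul_right N this.le, inner_smul_right]
    exact mul_lt_mul_of_pos_left (hp s) this
  have hq0 : q 0 = u := Subtype.ext (by simp [q, p])
  have hq1 : q 1 = v := Subtype.ext (by simp [q, p])
  by_contra! hcon
  have hr : range q ⊆ C ∪ Uᶜ := by
    rintro _ ⟨s, rfl⟩
    by_contra h
    rw [mem_union, not_or, notMem_compl_iff] at h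
    exact absurd (hq s) (not_lt.2 (hcon (q s) ⟨h.2, h.1⟩))
  obtain ⟨w, -, hwC, hwU⟩ := isPreconnected_closed_iff.1 (isPreconnected_range hqc) C Uᶜ hC
    hU.isClosed_compl hr ⟨u, ⟨0, hq0⟩, hu⟩ ⟨v, ⟨1, hq1⟩, hv⟩
  exact hwU (hCU hwC)

/-- A point `x` of `M \ M'` is cut off from `M'` by a direction in `C`, where `M'` and `N'` agree,
so `x ∉ N'`. Were `x` also outside `N`, the separating direction would lie outside `U` and would
separate `x` from `N'` as well. An arc between the two directions would then meet `U \ C`, where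
`N'` has the same support function as `M`, contradicting `x ∈ M`. -/
theorem sdiff_subset_of_supportFun_eq {C U : Set (USphere n)} (hC : IsClosed C) (hU : IsOpen U)
    (hCU : C ⊆ U) {M M' N N' : Bodies n}
    (hM : ∀ u ∉ C, supportFun M u = supportFun M' u)
    (hN : ∀ u ∉ C, supportFun N u = supportFun N' u)
    (hMN : ∀ u ∈ U, supportFun M u = supportFun N u)
    (hMN' : ∀ u ∈ U, supportFun M' u = supportFun N' u) :
    (M : Set (Eucl n)) \ M' ⊆ (N : Set (Eucl n)) \ N' := by
  rintro x ⟨hxM, hxM'⟩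
  obtain ⟨u, hu⟩ := exists_supportFun_lt_of_notMem hxM'
  have huC : u ∈ C := by
    by_contra h
    rw [← hM u h] at hu
    exact absurd (inner_le_supportFun hxM _) (not_le.2 hu)
  have hu' : supportFun N' u < inner ℝ x (u : Eucl n) := hMN' u (hCU huC) ▸ hu
  refine ⟨?_, fun h => absurd (inner_le_supportFun h _) (not_le.2 hu')⟩
  by_contra hxN
  obtain ⟨v, hv⟩ := exists_supportFun_lt_of_notMem hxN
  have hvU : v ∉ U := fun h => by
    rw [← hMN v h] at hv
    exact absurd (inner_le_supportFun hxM _) (not_le.2 hv)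
  rw [hN v fun h => hvU (hCU h)] at hv
  obtain ⟨w, ⟨hwU, hwC⟩, hw⟩ := exists_mem_diff_of_lt hC hU hCU huC hvU hu' hv
  rw [← hMN' w hwU, ← hM w hwC] at hw
  exact absurd (inner_le_supportFun hxM _) (not_le.2 hw)

theorem vol_sub_vol (M N : Bodies n) :
    vol M - vol N = (volume : Measure (Eucl n)).real ((M : Set (Eucl n)) \ N) -
      (volume : Measure (Eucl n)).real ((N : Set (Eucl n)) \ M) := by
  have h1 := measureReal_inter_add_sdiff (μ := (volume : Measure (Eucl n))) (s := (M : Set (Eucl n)))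
    N.isClosed.measurableSet M.isCompact.measure_lt_top.ne
  have h2 := measureReal_inter_add_sdiff (μ := (volume : Measure (Eucl n))) (s := (N : Set (Eucl n)))
    M.isClosed.measurableSet N.isCompact.measure_lt_top.ne
  rw [inter_comm] at h2
  simp only [vol]
  linarith

/-- The volume change caused by a perturbation supported in `C` is determined by the support
function near `C`. -/
theorem vol_sub_vol_eq_of_supportFun_eq {C U : Set (USphere n)} (hC : IsClosed C) (hU : IsOpen U)
    (hCU : C ⊆ U) {A B : Bodies n} (hAB : ∀ u ∉ C, supportFun A u = supportFun B u)
    {K L : Bodies n} (hKL : ∀ u ∈ U, supportFun K u = supportFun L u) :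
    vol (K + A) - vol (K + B) = vol (L + A) - vol (L + B) := by
  have hK : ∀ u ∉ C, supportFun (K + A) u = supportFun (K + B) u := fun u hu => by
    rw [supportFun_add, supportFun_add, hAB u hu]
  have hL : ∀ u ∉ C, supportFun (L + A) u = supportFun (L + B) u := fun u hu => by
    rw [supportFun_add, supportFun_add, hAB u hu]
  have hA : ∀ u ∈ U, supportFun (K + A) u = supportFun (L + A) u := fun u hu => by
    rw [supportFun_add, supportFun_add, hKL u hu]
  have hB : ∀ u ∈ U, supportFun (K + B) u = supportFun (L + B) u := fun u hu => by
    rw [supportFun_add, supportFun_add, hKL u hu]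
  have sym {X Y : Bodies n} {s : Set (USphere n)}
    (h : ∀ u ∈ s, supportFun X u = supportFun Y u) : ∀ u ∈ s, supportFun Y u = supportFun X u :=
    fun u hu => (h u hu).symm
  have e1 := (sdiff_subset_of_supportFun_eq hC hU hCU hK hL hA hB).antisymm
    (sdiff_subset_of_supportFun_eq hC hU hCU hL hK (sym hA) (sym hB))
  have e2 := (sdiff_subset_of_supportFun_eq hC hU hCU (sym (s := Cᶜ) hK) (sym (s := Cᶜ) hL)
    hB hA).antisymm (sdiff_subset_of_supportFun_eq hC hU hCU (sym (s := Cᶜ) hL) (sym (s := Cᶜ) hK)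
    (sym hB) (sym hA))
  rw [vol_sub_vol, vol_sub_vol, e1, e2]

end Volume

/-! ### Polytopes in general position -/

section General

variable {n : ℕ}

/-- Moving the points `x (p l)` by multiples of basis vectors turns the differences into the images
of those basis vectors under `f - t`, where `f` encodes the original differences. These are
independent unless `t` is one of finitely many eigenvalues, so arbitrarily small good `t` exist. -/
theorem dense_linearIndependent_sub {J : Type*} [Finite J] {r : ℕ} (hr : r ≤ n) {p q : Fin r → J}
    (hp : Function.Injective p) (hq : ∀ l l', q l ≠ p l') :
    Dense {x : J → Eucl n | LinearIndependent ℝ fun l => x (p l) - x (q l)} := by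
  classical
  intro x
  let b := (EuclideanSpace.basisFun (Fin n) ℝ).toBasis
  -- The value off the range of `p` is zero, so the points `x (q l)` stay fixed during the
  -- perturbation.
  let y : J → Eucl n := fun j => if h : ∃ l, p l = j then b (Fin.castLE hr h.choose) else 0
  have hyp : ∀ l, y (p l) = b (Fin.castLE hr l) := fun l => by
    have h : ∃ l', p l' = p l := ⟨l, rfl⟩
    simp only [y, dif_pos h]
    rw [hp h.choose_spec]
  have hyq : ∀ l, y (q l) = 0 := fun l => by
    have h : ¬ ∃ l', p l' = q l := fun ⟨l', h⟩ => hq l l' h.symm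
    simp only [y, dif_neg h]
  let f : Module.End ℝ (Eucl n) := b.constr ℝ fun i =>
    if h : (i : ℕ) < r then x (p ⟨i, h⟩) - x (q ⟨i, h⟩) else 0
  have hf : ∀ l : Fin r, f (b (Fin.castLE hr l)) = x (p l) - x (q l) := fun l => by
    exact (b.constr_basis ℝ _ _).trans (by simp)
  have hgood : ∀ t : ℝ, t ∈ {t : ℝ | f.HasEigenvalue t}ᶜ →
      x - t • y ∈ {x : J → Eucl n | LinearIndependent ℝ fun l => x (p l) - x (q l)} := by
    intro t ht
    have hk : LinearMap.ker (f - t • (1 : Module.End ℝ (Eucl n))) = ⊥ := by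
      by_contra h
      exact ht (Module.End.hasEigenvalue_iff.2 (by
        rwa [Module.End.eigenspace_def]))
    have hli := (b.linearIndependent.comp (Fin.castLE hr) (Fin.castLE_injective hr)).map' _ hk
    have e : (fun l => (x - t • y) (p l) - (x - t • y) (q l)) =
        (f - t • (1 : Module.End ℝ (Eucl n))) ∘ b ∘ Fin.castLE hr := by
      ext1 l
      simp only [Pi.sub_apply, Pi.smul_apply, hyp, hyq, Function.comp_apply, LinearMap.sub_apply,
        hf, LinearMap.smul_apply, Module.End.one_apply, smul_zero, sub_zero]
      abel
    change LinearIndependent ℝ fun l => (x - t • y) (p l) - (x - t • y) (q l)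
    rw [e]
    exact hli
  have hd : Dense ({t : ℝ | f.HasEigenvalue t}ᶜ) := (Set.Finite.countable f.finite_hasEigenvalue).dense_compl ℝ
  have hc : Continuous fun t : ℝ => x - t • y := by fun_prop
  have := map_mem_closure hc (hd 0) hgood
  simpa using this

/-- Differences of the points along disjoint index families are linearly independent. -/
def GeneralPosition {J : Type*} (x : J → Eucl n) : Prop :=
  ∀ r ≤ n, ∀ p q : Fin r → J, Function.Injective p → (∀ l l', q l ≠ p l') →
    LinearIndependent ℝ fun l => x (p l) - x (q l)

theorem dense_generalPosition {J : Type*} [Finite J] :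
    Dense {x : J → Eucl n | GeneralPosition x} := by
  have := Fintype.ofFinite J
  let I := Σ r : Fin (n + 1), {a : (Fin r → J) × (Fin r → J) //
    Function.Injective a.1 ∧ ∀ l l', a.2 l ≠ a.1 l'}
  have h : Dense (⋂ i : I, {x : J → Eucl n | LinearIndependent ℝ fun l =>
      x (i.2.1.1 l) - x (i.2.1.2 l)}) := by
    refine dense_iInter_of_isOpen (fun i => ?_) fun i => ?_
    · exact isOpen_setOfPred_linearIndependent.preimage
        (f := fun (x : J → Eucl n) l => x (i.2.1.1 l) - x (i.2.1.2 l)) (by fun_prop)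
    · exact dense_linearIndependent_sub (Nat.lt_succ_iff.1 i.1.2) i.2.2.1 i.2.2.2
  refine h.mono fun x hx r hr p q hp hq => ?_
  exact mem_iInter.1 hx ⟨⟨r, Nat.lt_succ_iff.2 hr⟩, ⟨(p, q), hp, hq⟩⟩

theorem exists_polytope_dist_le (K : Bodies n) {ε : ℝ} (hε : 0 < ε) :
    ∃ (t : Finset (Eucl n)) (_ : Nonempty t), dist (polytope fun a : t => (a : Eucl n)) K ≤ ε := by
  obtain ⟨t, htK, htf, hcov⟩ := K.isCompact.finite_cover_balls hε
  lift t to Finset (Eucl n) using htf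
  have hne : Nonempty t := by
    obtain ⟨x, hx⟩ := K.nonempty
    obtain ⟨a, ha, -⟩ := mem_iUnion₂.1 (hcov hx)
    exact ⟨⟨a, ha⟩⟩
  refine ⟨t, hne, ?_⟩
  rw [← isometry_supportMap.dist_eq, ContinuousMap.dist_le hε.le]
  intro u
  have h1 : supportFun (polytope fun a : t => (a : Eucl n)) u ≤ supportFun K u :=
    supportFun_polytope_le fun a => inner_le_supportFun (htK a.2) _
  have h2 : supportFun K u ≤ supportFun (polytope fun a : t => (a : Eucl n)) u + ε := by
    refine supportFun_le fun x hx => ?_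
    obtain ⟨a, ha, hxa⟩ := mem_iUnion₂.1 (hcov hx)
    have e : inner ℝ x (u : Eucl n) = inner ℝ a (u : Eucl n) + inner ℝ (x - a) (u : Eucl n) := by
      rw [inner_sub_left]; ring
    have h3 : inner ℝ (x - a) (u : Eucl n) ≤ dist x a := by
      refine (real_inner_le_norm _ _).trans ?_
      simp [dist_eq_norm]
    have h4 := inner_le_supportFun_polytope (fun a : t => (a : Eucl n)) ⟨a, ha⟩ (u : Eucl n)
    have h5 : dist x a < ε := hxa
    simp only at h4
    linarith
  rw [Real.dist_eq, abs_le]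
  simp only [supportMap_apply]
  constructor <;> linarith

theorem continuous_polytope_family {ι : Type*} [Finite ι] (t : ι → Finset (Eucl n))
    [∀ i, Nonempty (t i)] : Continuous fun (x : (Σ i, t i) → Eucl n) (i : ι) =>
      polytope fun a : t i => x ⟨i, a⟩ :=
  continuous_pi fun i => (continuous_polytope (ι := t i)).comp
    (continuous_pi fun a => continuous_apply (⟨i, a⟩ : Σ i, t i))

theorem dense_polytope_generalPosition {ι : Type*} [Finite ι] (s : Set (ι → Bodies n))
    (hs : ∀ (t : ι → Finset (Eucl n)) (_ : ∀ i, Nonempty (t i)) (x : (Σ i, t i) → Eucl n),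
      GeneralPosition x → (fun i => polytope fun a : t i => x ⟨i, a⟩) ∈ s) : Dense s := by
  have := Fintype.ofFinite ι
  intro K
  rw [Metric.mem_closure_iff]
  intro ε hε
  choose t hne ht using fun i => exists_polytope_dist_le (K i) (half_pos hε)
  have h0 : dist (fun i => polytope fun a : t i => (a : Eucl n)) K < ε :=
    lt_of_le_of_lt ((dist_pi_le_iff (half_pos hε).le).2 ht) (half_lt_self hε)
  obtain ⟨x, hx, hxg⟩ := (dense_generalPosition (n := n) (J := Σ i, t i)).exists_mem_open
    ((Metric.isOpen_ball (x := K) (ε := ε)).preimage (continuous_polytope_family t))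
    ⟨fun j => (j.2 : Eucl n), h0⟩
  exact ⟨_, hs t hne x hx, (dist_comm _ _).trans_lt hxg⟩

/-- The support function of `L` is linear on `U`. -/
def IsFlatOn (L : Bodies n) (U : Set (USphere n)) : Prop :=
  ∃ x : Eucl n, ∀ u ∈ U, supportFun L u = inner ℝ x (u : Eucl n)

/-- Near every direction, one of the bodies has a linear support function. -/
def Transversal {ι : Type*} (L : ι → Bodies n) : Prop :=
  ∀ u : USphere n, ∃ i, ∃ U : Set (USphere n), IsOpen U ∧ u ∈ U ∧ IsFlatOn (L i) U

/-- A vertex that is not maximal in direction `u` stays strictly below the maximum nearby, so near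
`u` only the vertices of the face in direction `u` compete. -/
theorem eventually_supportFun_polytope {ι : Type*} [Finite ι] [Nonempty ι] (x : ι → Eucl n)
    (u : USphere n) : ∀ᶠ v : USphere n in 𝓝 u, ∃ i, inner ℝ (x i) (u : Eucl n) = supportFun (polytope x) u ∧
      supportFun (polytope x) v = inner ℝ (x i) (v : Eucl n) := by
  have h : ∀ᶠ v : USphere n in 𝓝 u, ∀ i, inner ℝ (x i) (u : Eucl n) < supportFun (polytope x) u →
      inner ℝ (x i) (v : Eucl n) < supportFun (polytope x) v := by
    rw [eventually_all]
    intro i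
    by_cases hi : inner ℝ (x i) (u : Eucl n) < supportFun (polytope x) u
    · have h1 : Continuous fun v : USphere n => inner ℝ (x i) (v : Eucl n) := by fun_prop
      have h2 : Continuous fun v : USphere n => supportFun (polytope x) (v : Eucl n) :=
        (supportMap (polytope x)).continuous
      filter_upwards [h1.continuousAt.eventually_lt h2.continuousAt hi] with v hv _ using hv
    · exact Eventually.of_forall fun v h => absurd h hi
  filter_upwards [h] with v hv
  obtain ⟨i, hi⟩ := exists_supportFun_polytope_eq x v
  refine ⟨i, le_antisymm (inner_le_supportFun_polytope x i _) ?_, hi⟩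
  by_contra hlt
  exact absurd (hv i (not_le.1 hlt)) (by rw [hi]; exact lt_irrefl _)

theorem isFlatOn_or_exists_ne {ι : Type*} [Finite ι] [Nonempty ι] (x : ι → Eucl n)
    (u : USphere n) :
    (∃ U : Set (USphere n), IsOpen U ∧ u ∈ U ∧ IsFlatOn (polytope x) U) ∨
    ∃ a b, a ≠ b ∧ inner ℝ (x a) (u : Eucl n) = supportFun (polytope x) u ∧
      inner ℝ (x b) (u : Eucl n) = supportFun (polytope x) u := by
  by_cases h : ∃ a b, a ≠ b ∧ inner ℝ (x a) (u : Eucl n) = supportFun (polytope x) u ∧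
      inner ℝ (x b) (u : Eucl n) = supportFun (polytope x) u
  · exact Or.inr h
  · left
    obtain ⟨U, hU, hUo, huU⟩ := eventually_nhds_iff.1 (eventually_supportFun_polytope x u)
    obtain ⟨a, ha, -⟩ := hU u huU
    refine ⟨U, hUo, huU, x a, fun v hv => ?_⟩
    obtain ⟨b, hb, e⟩ := hU v hv
    have : a = b := by
      by_contra hab
      exact h ⟨a, b, hab, ha, hb⟩
    rw [this, e]

theorem eq_zero_of_linearIndependent_of_inner_eq_zero {v : Fin n → Eucl n}
    (hv : LinearIndependent ℝ v) {u : Eucl n} (h : ∀ i, inner ℝ (v i) u = 0) : u = 0 := by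
  have hs : Submodule.span ℝ (range v) = ⊤ := hv.span_eq_top_of_card_eq_finrank' (by simp)
  have hu : u ∈ Submodule.span ℝ (range v) := hs ▸ Submodule.mem_top
  have : ∀ w ∈ Submodule.span ℝ (range v), inner ℝ w u = 0 := fun w hw => by
    induction hw using Submodule.span_induction with
    | mem w hw => obtain ⟨i, rfl⟩ := hw; exact h i
    | zero => simp
    | add a b _ _ ha hb => rw [inner_add_left, ha, hb, add_zero]
    | smul c a _ ha => rw [inner_smul_left, ha, mul_zero]
  exact inner_self_eq_zero.1 (this u hu)

theorem ne_zero_sphere (u : USphere n) : (u : Eucl n) ≠ 0 := by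
  intro h
  have : ‖(u : Eucl n)‖ = 1 := by simp
  simp [h] at this

/-- If no polytope were linear near `u`, each would have two vertices on its face in direction `u`.
General position would make the resulting `n` edge vectors independent, yet all are orthogonal to
`u`. -/
theorem dense_transversal : Dense {L : Fin n → Bodies n | Transversal L} := by
  refine dense_polytope_generalPosition _ fun t hne x hx u => ?_
  by_contra! hcon
  have hab : ∀ i, ∃ a b : t i, a ≠ b ∧
      inner ℝ (x ⟨i, a⟩) (u : Eucl n) = inner ℝ (x ⟨i, b⟩) (u : Eucl n) := fun i => by
    rcases isFlatOn_or_exists_ne (fun a : t i => x ⟨i, a⟩) u with ⟨U, hU, huU, hf⟩ | ⟨a, b, h, e, e'⟩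
    · exact absurd hf (hcon i U hU huU)
    · exact ⟨a, b, h, e.trans e'.symm⟩
  choose a b hne' hin using hab
  have hli := hx n le_rfl (fun i => ⟨i, a i⟩) (fun i => ⟨i, b i⟩)
    (fun i j h => congrArg Sigma.fst h) (fun i j h => by
      obtain rfl : i = j := congrArg Sigma.fst h
      exact hne' i (eq_of_heq (Sigma.mk.inj h).2).symm)
  refine ne_zero_sphere u (eq_zero_of_linearIndependent_of_inner_eq_zero hli fun i => ?_)
  rw [inner_sub_left, hin i, sub_self]

/-- Near every direction, either one of the bodies has a linear support function, or all of them
agree up to translation with linearly independent segments. -/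
def SegmentLike {m : ℕ} (L : Fin m → Bodies n) : Prop :=
  ∀ u : USphere n, ∃ U : Set (USphere n), IsOpen U ∧ u ∈ U ∧ ((∃ i, IsFlatOn (L i) U) ∨
    ∃ e x : Fin m → Eucl n, LinearIndependent ℝ e ∧
      ∀ i, ∀ v ∈ U, supportFun (L i) v = supportFun (segBody (e i) + pointBody (x i)) v)

/-- With one body fewer than the dimension, every polytope may have a face with two vertices in
direction `u`, but none can have a third. When nothing is flat, each polytope then looks near `u`
like the segment between its two maximal vertices. -/
theorem dense_segmentLike {m : ℕ} : Dense {L : Fin m → Bodies (m + 1) | SegmentLike L} := by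
  refine dense_polytope_generalPosition _ fun t hne x hx u => ?_
  by_cases hcon : ∃ i, ∃ U : Set (USphere (m + 1)), IsOpen U ∧ u ∈ U ∧
      IsFlatOn (polytope fun a : t i => x ⟨i, a⟩) U
  · obtain ⟨i, U, hU, huU, hf⟩ := hcon
    exact ⟨U, hU, huU, Or.inl ⟨i, hf⟩⟩
  have hab : ∀ i, ∃ a b : t i, a ≠ b ∧
      inner ℝ (x ⟨i, a⟩) (u : Eucl (m + 1)) = supportFun (polytope fun a : t i => x ⟨i, a⟩) u ∧
      inner ℝ (x ⟨i, b⟩) (u : Eucl (m + 1)) = supportFun (polytope fun a : t i => x ⟨i, a⟩) u :=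
    fun i => by
      rcases isFlatOn_or_exists_ne (fun a : t i => x ⟨i, a⟩) u with h | h
      · exact absurd ⟨i, h⟩ hcon
      · exact h
  choose a b hne' ha hb using hab
  have hp : Function.Injective fun i => (⟨i, a i⟩ : Σ i, t i) := fun i j h => congrArg Sigma.fst h
  have hq : ∀ i j, (⟨i, b i⟩ : Σ i, t i) ≠ ⟨j, a j⟩ := fun i j h => by
    obtain rfl : i = j := congrArg Sigma.fst h
    exact hne' i (eq_of_heq (Sigma.mk.inj h).2).symm
  have hli := hx m (Nat.le_succ m) _ _ hp hq
  have htwo : ∀ i (c : t i), inner ℝ (x ⟨i, c⟩) (u : Eucl (m + 1)) =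
      supportFun (polytope fun a : t i => x ⟨i, a⟩) u → c = a i ∨ c = b i := by
    intro i c hc
    by_contra! hcab
    -- A third maximal vertex `c` contributes the extra difference `c - b i`, giving `m + 1`
    -- independent vectors orthogonal to `u`. The base vertex `b i` may be used twice because
    -- general position only requires the second family to avoid the first.
    have hli' := hx (m + 1) le_rfl (Fin.cons (⟨i, c⟩ : Σ i, t i) fun j => ⟨j, a j⟩)
      (Fin.cons (⟨i, b i⟩ : Σ i, t i) fun j => ⟨j, b j⟩) ?_ ?_
    · refine ne_zero_sphere u (eq_zero_of_linearIndependent_of_inner_eq_zero hli' fun j => ?_)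
      refine Fin.cases ?_ (fun j => ?_) j
      · simp only [Fin.cons_zero]
        rw [inner_sub_left, hc, hb i, sub_self]
      · simp only [Fin.cons_succ]
        rw [inner_sub_left, ha j, hb j, sub_self]
    · rw [Fin.cons_injective_iff]
      refine ⟨?_, hp⟩
      rintro ⟨j, h⟩
      obtain rfl : j = i := congrArg Sigma.fst h
      exact hcab.1 (eq_of_heq (Sigma.mk.inj h).2).symm
    · intro l l'
      have hbc : ∀ j, (⟨j, b j⟩ : Σ i, t i) ≠ ⟨i, c⟩ := fun j h => by
        obtain rfl : j = i := congrArg Sigma.fst h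
        exact hcab.2 (eq_of_heq (Sigma.mk.inj h).2).symm
      refine Fin.cases ?_ (fun j => ?_) l <;> refine Fin.cases ?_ (fun j' => ?_) l' <;>
        simp only [Fin.cons_zero, Fin.cons_succ]
      · exact hbc i
      · exact hq i j'
      · exact hbc j
      · exact hq j j'
  have hev : ∀ᶠ v : USphere (m + 1) in 𝓝 u, ∀ i, ∃ c : t i,
      inner ℝ (x ⟨i, c⟩) (u : Eucl (m + 1)) = supportFun (polytope fun a : t i => x ⟨i, a⟩) u ∧
      supportFun (polytope fun a : t i => x ⟨i, a⟩) v = inner ℝ (x ⟨i, c⟩) (v : Eucl (m + 1)) :=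
    eventually_all.2 fun i => eventually_supportFun_polytope (fun a : t i => x ⟨i, a⟩) u
  obtain ⟨U, hU, hUo, huU⟩ := eventually_nhds_iff.1 hev
  refine ⟨U, hUo, huU, Or.inr ⟨fun i => x ⟨i, a i⟩ - x ⟨i, b i⟩, fun i => x ⟨i, b i⟩, hli, ?_⟩⟩
  intro i v hv
  rw [supportFun_add, supportFun_segBody, supportFun_pointBody, inner_sub_left]
  have h1 := inner_le_supportFun_polytope (fun a : t i => x ⟨i, a⟩) (a i) (v : Eucl (m + 1))
  have h2 := inner_le_supportFun_polytope (fun a : t i => x ⟨i, a⟩) (b i) (v : Eucl (m + 1))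
  obtain ⟨c, hc, e⟩ := hU v hv i
  rw [← max_add_add_right, zero_add, sub_add_cancel]
  refine le_antisymm ?_ (max_le h2 h1)
  rw [e]
  rcases htwo i c hc with rfl | rfl
  · exact le_max_right _ _
  · exact le_max_left _ _

end General

/-! ### Mixed differences -/

section MixedDifference

variable {n m : ℕ} {G : Type*} [AddCommGroup G]

/-- The mixed difference of `F` at `K` in the directions `L i`. -/
def mixedDiff (F : Bodies n → G) (L : Fin m → Bodies n) (K : Bodies n) : G :=
  ∑ s : Finset (Fin m), (-1 : ℤ) ^ s.card • F (K + ∑ i ∈ s, L i)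

/-- Pairing `s` with `insert i s` isolates the difference in the `i`-th direction. This is how
invariance in a single direction annihilates the whole mixed difference. -/
theorem mixedDiff_eq_sum_erase (F : Bodies n → G) (L : Fin m → Bodies n) (K : Bodies n)
    (i : Fin m) : mixedDiff F L K = ∑ s ∈ (Finset.univ.erase i).powerset,
      (-1 : ℤ) ^ s.card • (F (K + ∑ j ∈ s, L j) - F (K + L i + ∑ j ∈ s, L j)) := by
  have hu : (Finset.univ : Finset (Finset (Fin m))) =
      (insert i (Finset.univ.erase i)).powerset := by
    rw [Finset.insert_erase (Finset.mem_univ i), Finset.powerset_univ]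
  rw [mixedDiff, hu, Finset.sum_powerset_insert (Finset.notMem_erase i _), ← Finset.sum_add_distrib]
  refine Finset.sum_congr rfl fun s hs => ?_
  have hi : i ∉ s := fun h => Finset.notMem_erase i _ (Finset.mem_powerset.1 hs h)
  rw [Finset.card_insert_of_notMem hi, Finset.sum_insert hi, pow_succ, smul_sub, add_assoc]
  simp [sub_eq_add_neg]

theorem mixedDiff_eq_zero_of_invariant {F : Bodies n → G} {L : Fin m → Bodies n} (i : Fin m)
    (h : ∀ M, F (M + L i) = F M) (K : Bodies n) : mixedDiff F L K = 0 := by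
  rw [mixedDiff_eq_sum_erase F L K i]
  refine Finset.sum_eq_zero fun s _ => ?_
  rw [add_right_comm, h, sub_self, smul_zero]

theorem mixedDiff_update_add (F : Bodies n → G) (L : Fin m → Bodies n) (K : Bodies n)
    (i : Fin m) (A B : Bodies n) :
    mixedDiff F (Function.update L i (A + B)) K =
      mixedDiff F (Function.update L i A) K + mixedDiff F (Function.update L i B) (K + A) := by
  simp only [mixedDiff_eq_sum_erase _ _ _ i, ← Finset.sum_add_distrib]
  refine Finset.sum_congr rfl fun s hs => ?_
  have hs' : ∀ C, ∑ j ∈ s, Function.update L i C j = ∑ j ∈ s, L j := fun C =>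
    Finset.sum_congr rfl fun j hj => Function.update_of_ne (by
      rintro rfl
      exact Finset.notMem_erase j _ (Finset.mem_powerset.1 hs hj)) _ _
  simp only [hs', Function.update_self, ← smul_add, add_assoc]
  congr 1
  abel

theorem mixedDiff_cons (F : Bodies n → G) (L : Fin m → Bodies n) (A K : Bodies n) :
    mixedDiff F (Fin.cons A L : Fin (m + 1) → Bodies n) K =
      mixedDiff F L K - mixedDiff F L (K + A) := by
  rw [mixedDiff_eq_sum_erase _ _ _ 0, mixedDiff, mixedDiff, ← Finset.sum_sub_distrib]
  symm
  refine Finset.sum_nbij' (fun s => s.map (Fin.succEmb m))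
    (fun s => Finset.univ.filter fun j => j.succ ∈ s) ?_ ?_ ?_ ?_ ?_
  · intro s _
    rw [Finset.mem_powerset]
    intro j hj
    obtain ⟨k, -, rfl⟩ := Finset.mem_map.1 hj
    simp
  · intro s _
    exact Finset.mem_univ _
  · intro s _
    ext j
    simp
  · intro s hs
    ext j
    refine Fin.cases ?_ (fun k => ?_) j
    · have : (0 : Fin (m + 1)) ∉ s := fun h =>
        Finset.notMem_erase _ _ (Finset.mem_powerset.1 hs h)
      simp [this]
    · simp
  · intro s _
    simp [smul_sub]

theorem mixedDiff_sub (F F' : Bodies n → G) (L : Fin m → Bodies n) (K : Bodies n) :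
    mixedDiff (fun M => F M - F' M) L K = mixedDiff F L K - mixedDiff F' L K := by
  simp only [mixedDiff, ← Finset.sum_sub_distrib, smul_sub]

theorem mixedDiff_comp_add (F : Bodies n → G) (L : Fin m → Bodies n) (A K : Bodies n) :
    mixedDiff (fun M => F (M + A)) L K = mixedDiff F L (K + A) := by
  simp only [mixedDiff, add_right_comm K A]

theorem mixedDiff_const (F : Bodies n → G) (L K : Bodies n) :
    mixedDiff F (fun _ : Fin m => L) K =
      ∑ k ∈ Finset.range (m + 1), ((-1 : ℤ) ^ k * m.choose k) • F (K + k • L) := by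
  have := Finset.sum_powerset_apply_card (fun k => (-1 : ℤ) ^ k • F (K + k • L))
    (x := (Finset.univ : Finset (Fin m)))
  rw [Finset.powerset_univ, Finset.card_univ, Fintype.card_fin] at this
  simp only [mixedDiff, Finset.sum_const]
  rw [this]
  refine Finset.sum_congr rfl fun k _ => ?_
  rw [mul_comm, mul_smul, natCast_zsmul]

theorem map_mixedDiff {G' : Type*} [AddCommGroup G'] (f : G →+ G') (F : Bodies n → G)
    (L : Fin m → Bodies n) (K : Bodies n) :
    f (mixedDiff F L K) = mixedDiff (fun M => f (F M)) L K := by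
  simp [mixedDiff, map_sum, map_zsmul]

variable [TopologicalSpace G] [IsTopologicalAddGroup G] {F : Bodies n → G}

theorem continuous_mixedDiff_right (hF : Continuous F) (L : Fin m → Bodies n) :
    Continuous (mixedDiff F L) := by
  unfold mixedDiff
  exact continuous_finsetSum _ fun s _ => (hF.comp (continuous_id.add continuous_const)).zsmul _

theorem continuous_mixedDiff_left (hF : Continuous F) (K : Bodies n) :
    Continuous fun L : Fin m → Bodies n => mixedDiff F L K := by
  unfold mixedDiff
  refine continuous_finsetSum _ fun s _ => Continuous.zsmul (hF.comp ?_) _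
  exact continuous_const.add (continuous_finsetSum _ fun i _ => continuous_apply i)

end MixedDifference

/-! ### Mixed differences of the volume -/

section MixedVolume

variable {n : ℕ}

/-- The volume change `vol (M + A) - vol (M + B)` only depends on `M` near `C`, where adding `L i`
amounts to a translation. It is thus invariant under adding `L i`, and its mixed difference
vanishes. -/
theorem mixedDiff_vol_add_eq {m : ℕ} {L : Fin m → Bodies n} {C U : Set (USphere n)}
    (hC : IsClosed C) (hU : IsOpen U) (hCU : C ⊆ U) {i : Fin m} (hL : IsFlatOn (L i) U)
    {A B : Bodies n} (hAB : ∀ u ∉ C, supportFun A u = supportFun B u) (K : Bodies n) :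
    mixedDiff vol L (K + A) = mixedDiff vol L (K + B) := by
  rw [← sub_eq_zero, ← mixedDiff_comp_add, ← mixedDiff_comp_add, ← mixedDiff_sub]
  refine mixedDiff_eq_zero_of_invariant i (fun M => ?_) K
  obtain ⟨x, hx⟩ := hL
  rw [vol_sub_vol_eq_of_supportFun_eq hC hU hCU hAB (K := M + L i) (L := M + pointBody x)
    fun u hu => by rw [supportFun_add, supportFun_add, hx u hu, supportFun_pointBody],
    add_right_comm, vol_add_pointBody, add_right_comm, vol_add_pointBody]

/-- Moving along `f` does not change the mixed differences of the volume in the directions `L`,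
after adding a common body. -/
def VolInvariantAlong {m : ℕ} (L : Fin m → Bodies n) (f : C(USphere n, ℝ)) : Prop :=
  ∃ A B : Bodies n, f = supportMap A - supportMap B ∧
    ∀ r : ℝ, 0 ≤ r → ∀ K, mixedDiff vol L (K + r • A) = mixedDiff vol L (K + r • B)

/-- This is the step of a finite patching: invariance passes from `f` to `g` when they differ only
where some `L i` is linear. The auxiliary body `B` is carried along because `A' + B` and `B' + A`
are the bodies that agree off `C`. -/
theorem VolInvariantAlong.of_eq_off {m : ℕ} {L : Fin m → Bodies n} {f g : C(USphere n, ℝ)}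
    (hf : VolInvariantAlong L f) (hg : g ∈ diffSpace n) {C U : Set (USphere n)}
    (hC : IsClosed C) (hU : IsOpen U) (hCU : C ⊆ U) {i : Fin m} (hL : IsFlatOn (L i) U)
    (hfg : ∀ u ∉ C, f u = g u) : VolInvariantAlong L g := by
  obtain ⟨A, B, rfl, h⟩ := hf
  obtain ⟨A', B', rfl⟩ := hg
  refine ⟨A' + B, B' + B, by simp, fun r hr K => ?_⟩
  have h1 : mixedDiff vol L (K + r • (A' + B)) = mixedDiff vol L (K + r • (B' + A)) := by
    refine mixedDiff_vol_add_eq hC hU hCU hL (fun u hu => ?_) K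
    have := hfg u hu
    simp only [ContinuousMap.sub_apply, supportMap_apply] at this
    simp only [supportFun_smul _ hr, supportFun_add]
    congr 1
    linarith
  rw [h1, smul_add, smul_add, ← add_assoc, ← add_assoc, h r hr]

/-- The cap function `(⟪u, ·⟫ - c)⁺`. -/
def capMap (u : USphere n) (c : ℝ) : C(USphere n, ℝ) :=
  (supportMap (pointBody (u : Eucl n)) - c • 1) ⊔ 0

theorem capMap_apply (u : USphere n) (c : ℝ) (v : USphere n) :
    capMap u c v = max (inner ℝ (u : Eucl n) v - c) 0 := by
  simp [capMap, supportFun_pointBody]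

theorem capMap_mem_diffSpace (u : USphere n) (c : ℝ) : capMap u c ∈ diffSpace n :=
  sup_mem_diffSpace (sub_mem (supportMap_mem_diffSpace _)
    ((diffSpace n).smul_mem _ one_mem_diffSpace)) (zero_mem _)

theorem exists_cap_subset {U : Set (USphere n)} (hU : IsOpen U) {u : USphere n} (hu : u ∈ U) :
    ∃ c < 1, ∀ v : USphere n, c ≤ inner ℝ (u : Eucl n) v → v ∈ U := by
  obtain ⟨ε, hε, h⟩ := Metric.isOpen_iff.1 hU u hu
  refine ⟨1 - ε ^ 2 / 4, by nlinarith, fun v hv => h ?_⟩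
  rw [Metric.mem_ball, Subtype.dist_eq, dist_eq_norm]
  have h1 : ‖(v : Eucl n) - u‖ ^ 2 = 2 - 2 * inner ℝ (u : Eucl n) v := by
    rw [norm_sub_sq_real, real_inner_comm]
    simp
    ring
  refine lt_of_pow_lt_pow_left₀ 2 hε.le ?_
  nlinarith

/-- Support functions cannot be multiplied by a partition of unity, so they are truncated: the
minimum of `h_{L₀}` with a growing sum of caps starts at zero and ends at `h_{L₀}`. Each new cap
changes it only inside a set where one of the bodies is linear, and every stage remains a difference
of support functions. -/
theorem Transversal.volInvariantAlong {m : ℕ} {L : Fin m → Bodies n} (hL : Transversal L)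
    {L₀ : Bodies n} (h0 : 0 ≤ supportMap L₀) : VolInvariantAlong L (supportMap L₀) := by
  classical
  choose i U hUo huU hflat using hL
  choose c hc hcU using fun u => exists_cap_subset (hUo u) (huU u)
  have hbpos : ∀ u, 0 < capMap u (c u) u := fun u => by
    rw [capMap_apply, lt_max_iff]
    left
    have : inner ℝ (u : Eucl n) u = (1 : ℝ) := by simp
    rw [this]
    linarith [hc u]
  obtain ⟨T, -, hT⟩ := isCompact_univ.elim_nhds_subcover
    (fun u => {v | capMap u (c u) u / 2 < capMap u (c u) v}) fun u _ =>
      (isOpen_lt continuous_const (capMap u (c u)).continuous).mem_nhds (half_lt_self (hbpos u))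
  obtain ⟨R, hR0, hR⟩ : ∃ R : ℝ, 0 ≤ R ∧ ∀ v, supportMap L₀ v ≤ R :=
    ⟨‖supportMap L₀‖, norm_nonneg _, fun v =>
      (le_abs_self _).trans ((supportMap L₀).norm_coe_le_norm v)⟩
  -- The factor makes the cap exceed `R` wherever it is above half its peak, that is, on the
  -- covering set attached to `u`.
  let b : USphere n → C(USphere n, ℝ) := fun u => (2 * R / capMap u (c u) u) • capMap u (c u)
  have hb0 : ∀ u v, 0 ≤ b u v := fun u v => by
    have := hbpos u
    simp only [b, ContinuousMap.smul_apply, smul_eq_mul]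
    refine mul_nonneg (by positivity) ?_
    rw [capMap_apply]
    exact le_max_right _ _
  have key : ∀ S : Finset (USphere n), VolInvariantAlong L (supportMap L₀ ⊓ ∑ u ∈ S, b u) := by
    intro S
    induction S using Finset.induction_on with
    | empty =>
      rw [Finset.sum_empty, inf_eq_right.2 h0]
      exact ⟨0, 0, by simp, fun r _ K => rfl⟩
    | insert u S hu ih =>
      refine ih.of_eq_off (C := {v | c u ≤ inner ℝ (u : Eucl n) v}) (U := U u) ?_ ?_
        (hUo u) (hcU u) (hflat u) ?_
      · refine inf_mem_diffSpace (supportMap_mem_diffSpace _) (Submodule.sum_mem _ fun v _ => ?_)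
        exact (diffSpace n).smul_mem _ (capMap_mem_diffSpace _ _)
      · exact isClosed_le continuous_const (by fun_prop)
      · intro v hv
        have : b u v = 0 := by
          simp only [b, ContinuousMap.smul_apply, smul_eq_mul, capMap_apply u (c u) v]
          rw [max_eq_right (by
            simp only [mem_ofPred_eq, not_le] at hv
            linarith), mul_zero]
        simp [Finset.sum_insert hu, this]
  have hfin : supportMap L₀ ⊓ ∑ u ∈ T, b u = supportMap L₀ := by
    refine inf_eq_left.2 fun v => ?_
    obtain ⟨u, hu, hv⟩ := mem_iUnion₂.1 (hT (mem_univ v))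
    have h1 : R ≤ b u v := by
      have := hbpos u
      simp only [b, ContinuousMap.smul_apply, smul_eq_mul]
      rw [div_mul_eq_mul_div, le_div_iff₀ this]
      simp only [mem_ofPred_eq] at hv
      nlinarith
    change supportMap L₀ v ≤ (∑ u ∈ T, b u) v
    rw [ContinuousMap.sum_apply]
    exact ((hR v).trans h1).trans
      (Finset.single_le_sum (f := fun u => b u v) (fun w _ => hb0 w v) hu)
  exact hfin ▸ key T

/-- Invariance along `h_{L₀}` is known only in the presence of an auxiliary body `B`. Since it holds
at every scale `r`, adding `L₀` in many small pieces needs only the small multiple `rB`, which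
disappears in the limit. -/
theorem Transversal.mixedDiff_vol_add {m : ℕ} {L : Fin m → Bodies n} (hL : Transversal L)
    (L₀ K : Bodies n) : mixedDiff vol L (K + L₀) = mixedDiff vol L K := by
  have htr : ∀ (M : Bodies n) (x : Eucl n),
      mixedDiff vol L (M + pointBody x) = mixedDiff vol L M := fun M x => by
    rw [← mixedDiff_comp_add]
    simp only [vol_add_pointBody]
  wlog h0 : 0 ≤ supportMap L₀ generalizing L₀
  · obtain ⟨x, hx⟩ := L₀.nonempty
    rw [← htr _ (-x), add_assoc]
    refine this _ fun u => ?_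
    change 0 ≤ supportFun (L₀ + pointBody (-x)) u
    rw [supportFun_add, supportFun_pointBody, inner_neg_left]
    linarith [inner_le_supportFun hx (u : Eucl n)]
  obtain ⟨A, B, hAB, h⟩ := hL.volInvariantAlong h0
  obtain rfl : A = L₀ + B := supportMap_injective (by rw [supportMap_add, hAB]; abel)
  have step : ∀ N : ℕ, mixedDiff vol L (K + L₀ + (1 / (N + 1 : ℝ)) • B) =
      mixedDiff vol L (K + (1 / (N + 1 : ℝ)) • B) := by
    intro N
    set r : ℝ := 1 / (N + 1 : ℝ) with hr
    have hr0 : 0 ≤ r := by positivity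
    -- The same copy of `r • B` serves as a catalyst for every step, so it does not accumulate.
    have : ∀ k : ℕ, mixedDiff vol L (K + (k * r : ℝ) • L₀ + r • B) =
        mixedDiff vol L (K + r • B) := by
      intro k
      induction k with
      | zero => simp [zero_smul_body]
      | succ k ih =>
        have e : ((k + 1 : ℕ) * r : ℝ) • L₀ = (k * r : ℝ) • L₀ + r • L₀ := by
          rw [← add_smul_body (by positivity) hr0]
          congr 1
          push_cast
          ring
        rw [e, ← ih, ← h r hr0 (K + (k * r : ℝ) • L₀), smul_add]
        congr 1
        abel
    have h1 := this (N + 1)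
    have h2 : ((N + 1 : ℕ) * r : ℝ) = 1 := by
      rw [hr]; push_cast; field_simp
    rwa [h2, one_smul] at h1
  have hlim : Tendsto (fun N : ℕ => (1 / (N + 1 : ℝ)) • B) atTop (𝓝 0) := by
    have h1 := (continuousOn_smul_body B 0 (mem_Ici.2 le_rfl))
    rw [ContinuousWithinAt, zero_smul_body] at h1
    refine h1.comp (tendsto_nhdsWithin_iff.2 ⟨tendsto_one_div_add_atTop_nhds_zero_nat, ?_⟩)
    exact Eventually.of_forall fun N => mem_Ici.2 (by positivity)
  have hc : Continuous (mixedDiff vol L) := continuous_mixedDiff_right continuous_vol L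
  have l1 : ∀ M : Bodies n, Tendsto (fun N : ℕ => mixedDiff vol L (M + (1 / (N + 1 : ℝ)) • B))
      atTop (𝓝 (mixedDiff vol L M)) := fun M => by
    have := (hc.tendsto (M + 0)).comp (tendsto_const_nhds.add hlim)
    rwa [add_zero] at this
  refine tendsto_nhds_unique (l1 (K + L₀)) ?_
  simp only [step]
  exact l1 K

/-- The volume is a polynomial of degree at most `n` for Minkowski addition. -/
theorem mixedDiff_vol_add (L : Fin n → Bodies n) (L₀ K : Bodies n) :
    mixedDiff vol L (K + L₀) = mixedDiff vol L K :=
  congrFun ((continuous_mixedDiff_left continuous_vol (K + L₀)).ext_on dense_transversal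
    (continuous_mixedDiff_left continuous_vol K)
    fun _ hL => Transversal.mixedDiff_vol_add hL L₀ K) L

end MixedVolume

/-! ### Continuous functions with vanishing higher differences -/

section Differences

variable {𝕜 : Type*} [RCLike 𝕜]

open Polynomial

theorem natDegree_lt_of_degree_lt_natCast {p : 𝕜[X]} {d : ℕ} (hd : 0 < d) (hp : p.degree < d) :
    p.natDegree < d := by
  by_cases h0 : p = 0
  · simpa [h0] using hd
  · exact (natDegree_lt_iff_degree_lt h0).2 hp

theorem sum_choose_eval_eq_zero {d : ℕ} {p : 𝕜[X]} (hp : p.degree < d) (s : 𝕜) :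
    ∑ k ∈ Finset.range (d + 1), ((-1 : ℤ) ^ k * d.choose k) • p.eval (s + k) = 0 := by
  rcases Nat.eq_zero_or_pos d with rfl | hd
  · have : p = 0 := by simpa using hp
    simp [this]
  have hn : p.natDegree < d := natDegree_lt_of_degree_lt_natCast hd hp
  have h := congrFun (Polynomial.fwdDiff_iter_eq_zero_of_degree_lt hn) s
  rw [fwdDiff_iter_eq_sum_shift] at h
  have h2 := congrArg (fun z => ((-1 : ℤ) ^ d) • z) h
  simp only [Pi.zero_apply, smul_zero, Finset.smul_sum, smul_smul] at h2
  rw [← h2]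
  refine Finset.sum_congr rfl fun k hk => ?_
  have hk' : k ≤ d := Nat.lt_succ_iff.1 (Finset.mem_range.1 hk)
  have e : (-1 : ℤ) ^ d * (-1) ^ (d - k) = (-1) ^ k := by
    obtain ⟨l, rfl⟩ := Nat.exists_eq_add_of_le hk'
    rw [Nat.add_sub_cancel_left, pow_add, mul_assoc, ← pow_add, ← two_mul]
    simp
  rw [← mul_assoc, e]
  simp

/-- The top coefficient of the difference relation is `±1`, so `d` consecutive values determine the
next one, for the sequence and the polynomial alike. -/
theorem eq_eval_of_sum_choose_eq_zero {d : ℕ} {a : ℕ → 𝕜} {p : 𝕜[X]} (hp : p.degree < d)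
    (ha : ∀ s : ℕ, ∑ k ∈ Finset.range (d + 1), ((-1 : ℤ) ^ k * d.choose k) • a (s + k) = 0)
    (hap : ∀ j < d, a j = p.eval (j : 𝕜)) (j : ℕ) : a j = p.eval (j : 𝕜) := by
  induction j using Nat.strong_induction_on with
  | _ j ih =>
    by_cases hj : j < d
    · exact hap j hj
    obtain ⟨s, rfl⟩ := Nat.exists_eq_add_of_le' (not_lt.1 hj)
    have h1 := ha s
    have h2 := sum_choose_eval_eq_zero hp (s : 𝕜)
    rw [Finset.sum_range_succ] at h1 h2
    have h3 : ∑ k ∈ Finset.range d, ((-1 : ℤ) ^ k * d.choose k) • a (s + k) =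
        ∑ k ∈ Finset.range d, ((-1 : ℤ) ^ k * d.choose k) • p.eval ((s : 𝕜) + k) := by
      refine Finset.sum_congr rfl fun k hk => ?_
      rw [ih (s + k) (by have := Finset.mem_range.1 hk; omega)]
      push_cast
      rfl
    rw [h3, ← h2] at h1
    have h4 := add_left_cancel h1
    have hu : ((-1 : ℤ) ^ d * d.choose d) ≠ 0 := by simp
    have h5 := smul_right_injective 𝕜 hu h4
    rw [h5]
    push_cast
    rfl

theorem exists_polynomial_interpolating (d : ℕ) (a : ℕ → 𝕜) :
    (Lagrange.interpolate (Finset.range d) (fun j : ℕ => (j : 𝕜)) a).degree < d ∧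
      ∀ j < d, a j = (Lagrange.interpolate (Finset.range d) (fun j : ℕ => (j : 𝕜)) a).eval
        (j : 𝕜) := by
  have hinj : Set.InjOn (fun j : ℕ => (j : 𝕜)) (Finset.range d : Set ℕ) :=
    fun i _ j _ h => Nat.cast_injective h
  refine ⟨?_, fun j hj => ?_⟩
  · simpa using Lagrange.degree_interpolate_lt a hinj
  · exact (Lagrange.eval_interpolate_at_node a hinj (Finset.mem_range.2 hj)).symm

/-- The coefficients expressing the `k`-th coefficient of a polynomial of degree less than `d`
through its values at `0, …, d - 1`. -/
def nodeCoeff (𝕜 : Type*) [RCLike 𝕜] (d k j : ℕ) : 𝕜 :=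
  (Lagrange.basis (Finset.range d) (fun i : ℕ => (i : 𝕜)) j).coeff k

/-- Vanishing differences force polynomial values on every grid of mesh `1 / (N + 1)`; the grids are
compatible, and continuity fills in the rest. Expressing the coefficients as universal combinations
of the values at integers lets them inherit continuity, locality and invariance from `g`. -/
theorem eq_sum_of_sum_choose_eq_zero {d : ℕ} {g : ℝ → 𝕜} (hg : ContinuousOn g (Ici 0))
    (h : ∀ s t : ℝ, 0 ≤ s → 0 ≤ t →
      ∑ k ∈ Finset.range (d + 1), ((-1 : ℤ) ^ k * d.choose k) • g (s + k * t) = 0)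
    {t : ℝ} (ht : 0 ≤ t) :
    g t = ∑ k ∈ Finset.range d, (∑ j ∈ Finset.range d, nodeCoeff 𝕜 d k j * g j) * (t : 𝕜) ^ k := by
  rcases Nat.eq_zero_or_pos d with rfl | hd
  · simpa using h t 0 ht le_rfl
  set p := Lagrange.interpolate (Finset.range d) (fun j : ℕ => (j : 𝕜)) (fun j : ℕ => g j) with hp
  obtain ⟨hpd, hpe⟩ := exists_polynomial_interpolating d (fun j : ℕ => g j)
  rw [← hp] at hpd hpe
  have hnat : ∀ j : ℕ, g j = p.eval (j : 𝕜) :=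
    eq_eval_of_sum_choose_eq_zero hpd (fun s => by
      simpa using h s 1 s.cast_nonneg zero_le_one) hpe
  have hrat : ∀ (N : ℕ) (j : ℕ), g (j / (N + 1)) = p.eval ((j : 𝕜) / (N + 1)) := by
    intro N j
    obtain ⟨hqd, hqe⟩ := exists_polynomial_interpolating d (fun j : ℕ => g (j / (N + 1)))
    set q := Lagrange.interpolate (Finset.range d) (fun j : ℕ => (j : 𝕜))
      (fun j : ℕ => g (j / (N + 1)))
    have hq := eq_eval_of_sum_choose_eq_zero hqd (fun s => by
      have := h (s / (N + 1)) (1 / (N + 1)) (by positivity) (by positivity)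
      refine Eq.trans (Finset.sum_congr rfl fun k _ => ?_) this
      congr 2
      push_cast
      field_simp) hqe
    have hN : (N + 1 : 𝕜) ≠ 0 := by exact_mod_cast (Nat.succ_ne_zero N)
    have hNr : (N + 1 : ℝ) ≠ 0 := by positivity
    -- The interpolant of the fine grid agrees with the rescaled integer interpolant at the
    -- infinitely many grid points that are integers.
    have hqp : q = p.comp (C ((N + 1 : 𝕜)⁻¹) * X) := by
      refine Polynomial.eq_of_infinite_eval_eq _ _ (Set.Infinite.mono (s := range fun i : ℕ =>
        ((i * (N + 1) : ℕ) : 𝕜)) ?_ (Set.infinite_range_of_injective fun a b hab => ?_))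
      · rintro _ ⟨i, rfl⟩
        have h1 := hq (i * (N + 1))
        have h2 := hnat i
        simp only [mem_ofPred_eq, eval_comp, eval_mul, eval_C, eval_X]
        rw [← h1]
        push_cast
        rw [mul_div_cancel_right₀ _ hNr, h2]
        congr 1
        field_simp
      · exact Nat.eq_of_mul_eq_mul_right (Nat.succ_pos N) (Nat.cast_injective hab)
    rw [hq j, hqp]
    simp only [eval_comp, eval_mul, eval_C, eval_X]
    congr 1
    field_simp
  have hreal : g t = p.eval (t : 𝕜) := by
    have hlim : Tendsto (fun N : ℕ => ((⌊t * (N + 1)⌋₊ : ℝ) / (N + 1))) atTop (𝓝 t) := by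
      have := (tendsto_nat_floor_mul_div_atTop (R := ℝ) ht).comp
        (tendsto_atTop_add_const_right _ (1 : ℝ) (tendsto_natCast_atTop_atTop (R := ℝ)))
      exact this
    have l1 : Tendsto (fun N : ℕ => g ((⌊t * (N + 1)⌋₊ : ℝ) / (N + 1))) atTop (𝓝 (g t)) :=
      (hg t ht).tendsto.comp (tendsto_nhdsWithin_iff.2 ⟨hlim, Eventually.of_forall fun N =>
        mem_Ici.2 (by positivity)⟩)
    have hpc : Continuous fun x : ℝ => p.eval (x : 𝕜) := p.continuous.comp RCLike.continuous_ofReal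
    refine tendsto_nhds_unique l1 ?_
    refine Tendsto.congr (fun N => ?_) ((hpc.tendsto t).comp hlim)
    rw [hrat, Function.comp_apply]
    push_cast
    rfl
  rw [hreal, Polynomial.eval_eq_sum_range' (n := d)]
  · refine Finset.sum_congr rfl fun k _ => ?_
    congr 1
    rw [hp, Lagrange.interpolate_apply, finsetSum_coeff]
    refine Finset.sum_congr rfl fun j _ => ?_
    rw [coeff_C_mul, nodeCoeff, mul_comm]
  · exact natDegree_lt_of_degree_lt_natCast hd hpd

theorem eq_zero_of_forall_sum_pow_eq_zero {d : ℕ} {a : ℕ → 𝕜}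
    (h : ∀ t : ℝ, 0 < t → ∑ k ∈ Finset.range d, a k * (t : 𝕜) ^ k = 0) {k : ℕ} (hk : k < d) :
    a k = 0 := by
  have hp : (∑ k ∈ Finset.range d, C (a k) * X ^ k : 𝕜[X]) = 0 := by
    refine Polynomial.eq_of_infinite_eval_eq _ _ (Set.Infinite.mono (s := range fun i : ℕ =>
        ((i + 1 : ℕ) : 𝕜)) ?_ (Set.infinite_range_of_injective fun a b hab => ?_))
    · rintro _ ⟨i, rfl⟩
      have := h (i + 1) (by positivity)
      simpa [eval_finsetSum] using this
    · exact Nat.succ_injective (Nat.cast_injective hab)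
  have := congrArg (fun p => coeff p k) hp
  simpa [finsetSum_coeff, coeff_C_mul, coeff_X_pow, hk] using this

end Differences

/-! ### Area functionals -/

section AreaFunctional

variable {n : ℕ}

/-- Weak* continuous, locally determined, translation invariant maps into the dual space of
`C(S^{n-1})`. -/
structure IsAreaFunctional (F : Bodies n → (C(USphere n, ℂ) →L[ℂ] ℂ)) : Prop where
  continuous (φ : C(USphere n, ℂ)) : Continuous fun K => F K φ
  congr_of_eqOn {K L : Bodies n} {U : Set (USphere n)} (hU : IsOpen U)
    (h : ∀ u ∈ U, supportFun K u = supportFun L u) {φ : C(USphere n, ℂ)}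
    (hφ : ∀ u ∉ U, φ u = 0) : F K φ = F L φ
  translate (K : Bodies n) (x : Eucl n) : F (K + pointBody x) = F K

/-- The functions `f` with `T (f g) = 0` for all `g` form a closed ideal, which consists of all
functions vanishing on its zero set. Local vanishing near each point with `φ u ≠ 0` shows that `φ`
vanishes on that zero set, with no support condition on `φ`. -/
theorem functional_apply_eq_zero_of_locally (T : C(USphere n, ℂ) →L[ℂ] ℂ) {φ : C(USphere n, ℂ)}
    (h : ∀ u, φ u ≠ 0 → ∃ U : Set (USphere n), IsOpen U ∧ u ∈ U ∧
      ∀ χ : C(USphere n, ℂ), (∀ v ∉ U, χ v = 0) → T χ = 0) : T φ = 0 := by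
  let I : Ideal C(USphere n, ℂ) :=
    { carrier := {f | ∀ g, T (f * g) = 0}
      add_mem' := fun hf hf' g => by rw [add_mul, map_add, hf g, hf' g, add_zero]
      zero_mem' := fun g => by rw [zero_mul, map_zero]
      smul_mem' := fun c f hf g => by
        rw [smul_eq_mul, mul_right_comm, mul_comm, mul_comm c]
        exact hf _ }
  have hI : IsClosed (I : Set C(USphere n, ℂ)) := by
    have : (I : Set C(USphere n, ℂ)) = ⋂ g, {f | T (f * g) = 0} := by
      ext f
      simp [I]
    rw [this]
    exact isClosed_iInter fun g => isClosed_eq (by fun_prop) continuous_const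
  have hφ : φ ∈ I := by
    rw [← ContinuousMap.idealOfSet_ofIdeal_isClosed hI, ContinuousMap.mem_idealOfSet]
    intro u hu
    by_contra h0
    obtain ⟨U, hU, huU, hT⟩ := h u h0
    obtain ⟨f, hf0, hf1, -⟩ := exists_continuous_zero_one_of_isClosed hU.isClosed_compl
      (isClosed_singleton (x := u)) (by simpa using huU)
    refine hu (ContinuousMap.mem_setOfIdeal.2 ⟨⟨fun v => (f v : ℂ), by fun_prop⟩,
      fun g => hT _ fun v hv => ?_, ?_⟩)
    · simp [hf0 hv]
    · simp [hf1 (mem_singleton u)]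
  simpa using hφ 1

theorem functional_eq_zero_of_locally (T : C(USphere n, ℂ) →L[ℂ] ℂ)
    (h : ∀ u, ∃ U : Set (USphere n), IsOpen U ∧ u ∈ U ∧
      ∀ φ : C(USphere n, ℂ), (∀ v ∉ U, φ v = 0) → T φ = 0) : T = 0 :=
  ContinuousLinearMap.ext fun _ => functional_apply_eq_zero_of_locally T fun u _ => h u

theorem mixedDiff_apply {m : ℕ} (F : Bodies n → (C(USphere n, ℂ) →L[ℂ] ℂ)) (L : Fin m → Bodies n)
    (K : Bodies n) (φ : C(USphere n, ℂ)) :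
    mixedDiff F L K φ = mixedDiff (fun M => F M φ) L K :=
  map_mixedDiff (G := C(USphere n, ℂ) →L[ℂ] ℂ)
    ((ContinuousLinearMap.apply ℂ ℂ φ : (C(USphere n, ℂ) →L[ℂ] ℂ) →L[ℂ] ℂ) :
      (C(USphere n, ℂ) →L[ℂ] ℂ) →+ ℂ) F L K

theorem nsmul_body (k : ℕ) (K : Bodies n) : k • K = (k : ℝ) • K := by
  induction k with
  | zero => simp [zero_smul_body]
  | succ k ih =>
    rw [succ_nsmul, ih, Nat.cast_succ, add_smul_body k.cast_nonneg zero_le_one, one_smul]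

theorem smul_add_nsmul_smul {s t : ℝ} (hs : 0 ≤ s) (ht : 0 ≤ t) (k : ℕ) (K : Bodies n) :
    s • K + k • t • K = (s + k * t) • K := by
  rw [nsmul_body, smul_smul, ← add_smul_body hs (by positivity)]

namespace IsAreaFunctional

variable {F : Bodies n → (C(USphere n, ℂ) →L[ℂ] ℂ)}

theorem apply_add_of_isFlatOn (hF : IsAreaFunctional F) {L : Bodies n} {U : Set (USphere n)}
    (hU : IsOpen U) (hL : IsFlatOn L U) {φ : C(USphere n, ℂ)} (hφ : ∀ u ∉ U, φ u = 0)
    (M : Bodies n) : F (M + L) φ = F M φ := by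
  obtain ⟨x, hx⟩ := hL
  rw [← hF.translate M x]
  refine hF.congr_of_eqOn hU (fun u hu => ?_) hφ
  rw [supportFun_add, supportFun_add, hx u hu, supportFun_pointBody]

theorem mixedDiff_apply_eq_zero_of_isFlatOn (hF : IsAreaFunctional F) {m : ℕ}
    {L : Fin m → Bodies n} {i : Fin m} {U : Set (USphere n)} (hU : IsOpen U)
    (hL : IsFlatOn (L i) U) {φ : C(USphere n, ℂ)} (hφ : ∀ u ∉ U, φ u = 0) (K : Bodies n) :
    mixedDiff F L K φ = 0 := by
  rw [mixedDiff_apply]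
  exact mixedDiff_eq_zero_of_invariant i (fun M => hF.apply_add_of_isFlatOn hU hL hφ M) K

theorem continuous_mixedDiff_apply (hF : IsAreaFunctional F) {m : ℕ} (K : Bodies n)
    (φ : C(USphere n, ℂ)) : Continuous fun L : Fin m → Bodies n => mixedDiff F L K φ := by
  simp only [mixedDiff_apply]
  exact continuous_mixedDiff_left (hF.continuous φ) K

/-- For transversal tuples the functional vanishes near every direction because some entry acts
there as a translation. Weak* continuity and density give all tuples. -/
theorem mixedDiff_eq_zero (hF : IsAreaFunctional F) (L : Fin n → Bodies n) (K : Bodies n) :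
    mixedDiff F L K = 0 := by
  ext φ
  refine congrFun ((hF.continuous_mixedDiff_apply K φ).ext_on dense_transversal
    (continuous_const (y := (0 : ℂ))) fun L hL => ?_) L
  have : mixedDiff F L K = 0 := functional_eq_zero_of_locally _ fun u => by
    obtain ⟨i, U, hU, huU, hf⟩ := hL u
    exact ⟨U, hU, huU, fun φ hφ => hF.mixedDiff_apply_eq_zero_of_isFlatOn hU hf hφ K⟩
  simp only [this, zero_apply]

theorem apply_smul_eq_sum (hF : IsAreaFunctional F) (K : Bodies n) (φ : C(USphere n, ℂ)) {t : ℝ}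
    (ht : 0 ≤ t) : F (t • K) φ = ∑ k ∈ Finset.range n,
      (∑ j ∈ Finset.range n, nodeCoeff ℂ n k j * F ((j : ℝ) • K) φ) * (t : ℂ) ^ k := by
  refine eq_sum_of_sum_choose_eq_zero (g := fun t => F (t • K) φ)
    ((hF.continuous φ).comp_continuousOn (continuousOn_smul_body K)) (fun s t hs ht => ?_) ht
  have h := mixedDiff_apply F (fun _ : Fin n => t • K) (s • K) φ
  rw [hF.mixedDiff_eq_zero, zero_apply, mixedDiff_const] at h
  simpa only [smul_add_nsmul_smul hs ht] using h.symm

end IsAreaFunctional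

end AreaFunctional

/-! ### The derivative of the volume -/

section MixedVolumeDeriv

variable {n : ℕ}

theorem vol_add_smul_eq_sum (K L : Bodies n) {t : ℝ} (ht : 0 ≤ t) :
    vol (K + t • L) = ∑ k ∈ Finset.range (n + 1),
      (∑ j ∈ Finset.range (n + 1), nodeCoeff ℝ (n + 1) k j * vol (K + (j : ℝ) • L)) * t ^ k := by
  have key := eq_sum_of_sum_choose_eq_zero (𝕜 := ℝ) (d := n + 1) (g := fun t => vol (K + t • L))
    (continuous_vol.comp_continuousOn (continuousOn_const.add (continuousOn_smul_body L)))
    (fun s t hs ht => ?_) ht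
  · simpa using key
  · have h := mixedDiff_vol_add (fun _ : Fin n => t • L) (t • L) (K + s • L)
    have h' := mixedDiff_cons vol (fun _ : Fin n => t • L) (t • L) (K + s • L)
    rw [h, sub_self] at h'
    have e : (Fin.cons (t • L) fun _ : Fin n => t • L : Fin (n + 1) → Bodies n) =
        fun _ => t • L := by
      ext1 i
      exact Fin.cases rfl (fun _ => rfl) i
    rw [e, mixedDiff_const] at h'
    simpa only [add_assoc, smul_add_nsmul_smul hs ht] using h'

/-- The derivative of `t ↦ vol (K + t L)` at `0`. -/
def volDeriv (K L : Bodies n) : ℝ :=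
  ∑ j ∈ Finset.range (n + 1), nodeCoeff ℝ (n + 1) 1 j * vol (K + (j : ℝ) • L)

theorem continuous_volDeriv_left (L : Bodies n) : Continuous fun K => volDeriv K L := by
  unfold volDeriv
  exact continuous_finsetSum _ fun j _ =>
    continuous_const.mul (continuous_vol.comp (continuous_id.add continuous_const))

/-- The difference quotient of the volume, continuously extended to `t = 0`. -/
theorem exists_vol_add_smul_eq (hn : 1 ≤ n) (L : Bodies n) : ∃ r : Bodies n → ℝ → ℝ,
    (∀ K, ∀ t : ℝ, 0 ≤ t → vol (K + t • L) = vol K + t * volDeriv K L + t ^ 2 * r K t) ∧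
    Continuous fun p : Bodies n × ℝ => r p.1 p.2 := by
  obtain ⟨m, rfl⟩ := Nat.exists_eq_add_of_le' hn
  let a : ℕ → Bodies (m + 1) → ℝ := fun k K =>
    ∑ j ∈ Finset.range (m + 1 + 1), nodeCoeff ℝ (m + 1 + 1) k j * vol (K + (j : ℝ) • L)
  have ha : ∀ k, Continuous (a k) := fun k => continuous_finsetSum _ fun j _ =>
    continuous_const.mul (continuous_vol.comp (continuous_id.add continuous_const))
  refine ⟨fun K t => ∑ k ∈ Finset.range m, a (k + 2) K * t ^ k, fun K t ht => ?_, ?_⟩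
  · have h0 := vol_add_smul_eq_sum K L le_rfl
    have h1 := vol_add_smul_eq_sum K L ht
    -- The polynomial has `n + 1 = m + 2` coefficients; removing the constant and linear terms
    -- leaves `m` for the remainder.
    rw [Finset.sum_range_succ', Finset.sum_range_succ'] at h0 h1
    simp only [zero_smul_body, add_zero, pow_succ, mul_zero, pow_zero, Finset.sum_const_zero,
      zero_add, mul_one] at h0
    rw [h1, h0, Finset.mul_sum]
    have : ∀ k : ℕ, a (k + 2) K * t ^ (k + 1 + 1) = t ^ 2 * (a (k + 2) K * t ^ k) := fun k => by
      ring
    simp only [← this, volDeriv, a, zero_add, pow_one, pow_zero, mul_one]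
    ring
  · exact continuous_finsetSum _ fun k _ =>
      ((ha (k + 2)).comp continuous_fst).mul (continuous_snd.pow k)

/-- The base body moves with `t`, which the joint continuity of the remainder permits. This is what
makes the derivative additive in its second argument. -/
theorem tendsto_vol_add_smul (hn : 1 ≤ n) (K M L : Bodies n) :
    Tendsto (fun t : ℝ => (vol (K + t • M + t • L) - vol (K + t • M)) / t) (𝓝[>] 0)
      (𝓝 (volDeriv K L)) := by
  obtain ⟨r, hr, hrc⟩ := exists_vol_add_smul_eq hn L
  have hM : Tendsto (fun t : ℝ => K + t • M) (𝓝[>] 0) (𝓝 K) := by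
    have h1 := (continuousOn_smul_body M 0 (mem_Ici.2 le_rfl))
    rw [ContinuousWithinAt, zero_smul_body] at h1
    have := (tendsto_const_nhds (x := K)).add (h1.mono_left (nhdsWithin_mono 0 Ioi_subset_Ici_self))
    rwa [add_zero] at this
  have ht : Tendsto (fun t : ℝ => t) (𝓝[>] 0) (𝓝 0) := nhdsWithin_le_nhds
  have h1 : Tendsto (fun t : ℝ => volDeriv (K + t • M) L + t * r (K + t • M) t) (𝓝[>] 0)
      (𝓝 (volDeriv K L + 0 * r K 0)) :=
    (((continuous_volDeriv_left L).tendsto K).comp hM).add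
      (ht.mul ((hrc.tendsto (K, 0)).comp (hM.prodMk_nhds ht)))
  rw [zero_mul, add_zero] at h1
  refine h1.congr' ?_
  filter_upwards [self_mem_nhdsWithin] with t ht
  have ht : 0 < t := ht
  rw [hr _ t ht.le]
  field_simp
  ring

theorem tendsto_vol_add_smul_zero (hn : 1 ≤ n) (K L : Bodies n) :
    Tendsto (fun t : ℝ => (vol (K + t • L) - vol K) / t) (𝓝[>] 0) (𝓝 (volDeriv K L)) := by
  have h0 : ∀ t : ℝ, t • (0 : Bodies n) = 0 := fun t =>
    ConvexBody.ext (by simp)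
  simpa only [h0, add_zero] using tendsto_vol_add_smul hn K 0 L

theorem hasDerivWithinAt_vol (hn : 1 ≤ n) (K L : Bodies n) :
    HasDerivWithinAt (fun t : ℝ => vol (K + t • L)) (volDeriv K L) (Ici 0) 0 := by
  rw [hasDerivWithinAt_iff_tendsto_slope]
  have : (Ici (0 : ℝ)) \ {0} = Ioi 0 := by
    ext t; simp [lt_iff_le_and_ne, eq_comm]
  rw [this]
  refine (tendsto_vol_add_smul_zero hn K L).congr fun t => ?_
  simp [slope_def_field, zero_smul_body]

theorem volDeriv_add_right (hn : 1 ≤ n) (K L M : Bodies n) :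
    volDeriv K (L + M) = volDeriv K L + volDeriv K M := by
  refine tendsto_nhds_unique (tendsto_vol_add_smul_zero hn K (L + M)) ?_
  refine ((tendsto_vol_add_smul_zero hn K L).add (tendsto_vol_add_smul hn K L M)).congr fun t => ?_
  rw [smul_add, ← add_assoc, ← add_div]
  congr 1
  ring

theorem volDeriv_mono_right (hn : 1 ≤ n) (K : Bodies n) {L M : Bodies n}
    (h : supportMap L ≤ supportMap M) : volDeriv K L ≤ volDeriv K M := by
  refine le_of_tendsto_of_tendsto (tendsto_vol_add_smul_zero hn K L)
    (tendsto_vol_add_smul_zero hn K M) ?_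
  filter_upwards [self_mem_nhdsWithin] with t ht
  have ht : 0 < t := ht
  refine div_le_div_of_nonneg_right (sub_le_sub_right (vol_mono (coe_subset_iff.2 ?_)) _) ht.le
  rw [supportMap_add, supportMap_add, supportMap_smul ht.le, supportMap_smul ht.le]
  intro u
  exact add_le_add le_rfl (mul_le_mul_of_nonneg_left (h u) ht.le)

theorem volDeriv_smul_right (hn : 1 ≤ n) (K L : Bodies n) {c : ℝ} (hc : 0 ≤ c) :
    volDeriv K (c • L) = c * volDeriv K L := by
  rcases hc.eq_or_lt with rfl | hc
  · have := volDeriv_add_right hn K 0 0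
    rw [zero_smul_body]
    simp at this
    simp [this]
  · refine tendsto_nhds_unique (tendsto_vol_add_smul_zero hn K (c • L)) ?_
    have hlim : Tendsto (fun t : ℝ => t * c) (𝓝[>] 0) (𝓝[>] 0) := by
      refine tendsto_nhdsWithin_iff.2 ⟨?_, ?_⟩
      · have : Continuous fun t : ℝ => t * c := by fun_prop
        simpa using (this.tendsto 0).mono_left (nhdsWithin_le_nhds (s := Ioi 0))
      · filter_upwards [self_mem_nhdsWithin] with t ht
        exact mul_pos ht hc
    refine (((tendsto_vol_add_smul_zero hn K L).comp hlim).const_mul c).congr' ?_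
    filter_upwards [self_mem_nhdsWithin] with t ht
    have ht : 0 < t := ht
    simp only [Function.comp_apply, smul_smul]
    field_simp

theorem volDeriv_add_pointBody_left (K L : Bodies n) (x : Eucl n) :
    volDeriv (K + pointBody x) L = volDeriv K L := by
  have h : ∀ j : ℕ, vol (K + pointBody x + (j : ℝ) • L) = vol (K + (j : ℝ) • L) := fun j => by
    rw [add_right_comm, vol_add_pointBody]
  simp only [volDeriv, h]

/-- Scaling both bodies gives the factor `c ^ n`, scaling the second one gives `c`; cancelling
leaves `c ^ (n - 1)`. The case `c = 0` follows by continuity, which also settles the convention `0 ^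
0 = 1` for `n = 1`. -/
theorem volDeriv_smul_left (hn : 1 ≤ n) {c : ℝ} (hc : 0 ≤ c) (K L : Bodies n) :
    volDeriv (c • K) L = c ^ (n - 1) * volDeriv K L := by
  have hpos : ∀ c : ℝ, 0 < c → volDeriv (c • K) L = c ^ (n - 1) * volDeriv K L := by
    intro c hc
    have h1 := volDeriv_smul_right hn (c • K) L hc.le
    have h2 : volDeriv (c • K) (c • L) = c ^ n * volDeriv K L := by
      simp only [volDeriv, Finset.mul_sum]
      refine Finset.sum_congr rfl fun j _ => ?_
      have e : c • K + (j : ℝ) • c • L = c • (K + (j : ℝ) • L) := by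
        rw [smul_add, smul_smul, smul_smul, mul_comm]
      rw [e, vol_smul hc.le]
      ring
    obtain ⟨m, rfl⟩ := Nat.exists_eq_add_of_le' hn
    rw [h2, pow_succ] at h1
    refine mul_left_cancel₀ hc.ne' ?_
    rw [← h1, Nat.add_sub_cancel]
    ring
  rcases hc.eq_or_lt with rfl | hc
  · have h1 : Tendsto (fun t : ℝ => volDeriv (t • K) L) (𝓝[>] 0) (𝓝 (volDeriv ((0 : ℝ) • K) L)) :=
      ((continuous_volDeriv_left L).tendsto _).comp
        ((continuousOn_smul_body K 0 (mem_Ici.2 le_rfl)).mono_left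
          (nhdsWithin_mono 0 Ioi_subset_Ici_self))
    have h2 : Tendsto (fun t : ℝ => t ^ (n - 1) * volDeriv K L) (𝓝[>] 0)
        (𝓝 (0 ^ (n - 1) * volDeriv K L)) := by
      have : Continuous fun t : ℝ => t ^ (n - 1) * volDeriv K L := by fun_prop
      exact (this.tendsto 0).mono_left nhdsWithin_le_nhds
    refine tendsto_nhds_unique h1 (h2.congr' ?_)
    filter_upwards [self_mem_nhdsWithin] with t ht using (hpos t ht).symm
  · exact hpos c hc

/-- Locality of the derivative of the volume. -/
theorem volDeriv_sub_eq_of_supportFun_eq (hn : 1 ≤ n) {C U : Set (USphere n)} (hC : IsClosed C)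
    (hU : IsOpen U) (hCU : C ⊆ U) {A B : Bodies n}
    (hAB : ∀ u ∉ C, supportFun A u = supportFun B u)
    {K L : Bodies n} (hKL : ∀ u ∈ U, supportFun K u = supportFun L u) :
    volDeriv K A - volDeriv K B = volDeriv L A - volDeriv L B := by
  refine tendsto_nhds_unique
    ((tendsto_vol_add_smul_zero hn K A).sub (tendsto_vol_add_smul_zero hn K B)) ?_
  refine ((tendsto_vol_add_smul_zero hn L A).sub (tendsto_vol_add_smul_zero hn L B)).congr' ?_
  filter_upwards [self_mem_nhdsWithin] with t ht
  have ht : 0 < t := ht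
  have := vol_sub_vol_eq_of_supportFun_eq hC hU hCU (A := t • A) (B := t • B)
    (fun u hu => by rw [supportFun_smul _ ht.le, supportFun_smul _ ht.le, hAB u hu]) hKL
  rw [← sub_div, ← sub_div]
  congr 1
  linarith

end MixedVolumeDeriv

/-! ### Existence and uniqueness of the surface area measure -/

section SurfaceArea

variable {n : ℕ}

theorem volDeriv_sub_eq_of_supportMap_sub_eq (hn : 1 ≤ n) (K : Bodies n) {A B A' B' : Bodies n}
    (h : supportMap A - supportMap B = supportMap A' - supportMap B') :
    volDeriv K A - volDeriv K B = volDeriv K A' - volDeriv K B' := by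
  have e : A + B' = A' + B := supportMap_injective (by
    rw [supportMap_add, supportMap_add]
    linear_combination (exp := 1) h)
  have := congrArg (volDeriv K) e
  rw [volDeriv_add_right hn, volDeriv_add_right hn] at this
  linarith

/-- The derivative of the volume as a linear functional of the difference of support functions. -/
def volDerivLinear (hn : 1 ≤ n) (K : Bodies n) : diffSpace n →ₗ[ℝ] ℝ where
  toFun f := volDeriv K f.2.choose - volDeriv K f.2.choose_spec.choose
  map_add' f g := by
    have hf := f.2.choose_spec.choose_spec
    have hg := g.2.choose_spec.choose_spec
    have hfg := (f + g).2.choose_spec.choose_spec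
    set A := f.2.choose
    set B := f.2.choose_spec.choose
    set A' := g.2.choose
    set B' := g.2.choose_spec.choose
    have := volDeriv_sub_eq_of_supportMap_sub_eq hn K (A' := A + A') (B' := B + B')
      (hfg.symm.trans (by
        rw [Submodule.coe_add, hf, hg, supportMap_add, supportMap_add]
        abel))
    rw [this, volDeriv_add_right hn, volDeriv_add_right hn]
    ring
  map_smul' c f := by
    have hf := f.2.choose_spec.choose_spec
    have hfg := (c • f).2.choose_spec.choose_spec
    set A := f.2.choose
    set B := f.2.choose_spec.choose
    rcases le_total 0 c with hc | hc
    · rw [volDeriv_sub_eq_of_supportMap_sub_eq hn K (A' := c • A) (B' := c • B)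
        (hfg.symm.trans (by
          rw [Submodule.coe_smul, hf, supportMap_smul hc, supportMap_smul hc, smul_sub])),
        volDeriv_smul_right hn K _ hc, volDeriv_smul_right hn K _ hc]
      simp only [RingHom.id_apply, smul_eq_mul]
      ring
    · have hc' : 0 ≤ -c := neg_nonneg.2 hc
      rw [volDeriv_sub_eq_of_supportMap_sub_eq hn K (A' := (-c) • B) (B' := (-c) • A)
        (hfg.symm.trans (by
          rw [Submodule.coe_smul, hf, supportMap_smul hc', supportMap_smul hc', smul_sub, neg_smul,
            neg_smul]
          abel)),
        volDeriv_smul_right hn K _ hc', volDeriv_smul_right hn K _ hc']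
      simp only [RingHom.id_apply, smul_eq_mul]
      ring

theorem volDerivLinear_apply (hn : 1 ≤ n) (K : Bodies n) (f : diffSpace n) {A B : Bodies n}
    (h : (f : C(USphere n, ℝ)) = supportMap A - supportMap B) :
    volDerivLinear hn K f = volDeriv K A - volDeriv K B :=
  volDeriv_sub_eq_of_supportMap_sub_eq hn K (f.2.choose_spec.choose_spec.symm.trans h)

/-- If `f = h_A - h_B` is at most `r`, then `A ⊆ B + rB₁` for the unit ball `B₁`, and monotonicity
of the derivative applies. -/
theorem volDerivLinear_le (hn : 1 ≤ n) (K : Bodies n) (f : diffSpace n) :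
    volDerivLinear hn K f ≤ volDeriv K (ballBody n) * ‖(f : C(USphere n, ℝ))‖ := by
  set r := ‖(f : C(USphere n, ℝ))‖ with hr
  have hr0 : 0 ≤ r := norm_nonneg _
  obtain ⟨A, B, h⟩ := f.2
  rw [volDerivLinear_apply hn K f h]
  have h1 : supportMap A ≤ supportMap (B + r • ballBody n) := by
    rw [supportMap_add, supportMap_smul hr0, supportMap_ballBody]
    intro u
    have h2 : (f : C(USphere n, ℝ)) u ≤ r :=
      (le_abs_self _).trans ((f : C(USphere n, ℝ)).norm_coe_le_norm u)
    rw [h] at h2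
    change supportMap A u ≤ (supportMap B + r • (1 : C(USphere n, ℝ))) u
    simp only [ContinuousMap.sub_apply] at h2
    simp only [ContinuousMap.add_apply, ContinuousMap.smul_apply, ContinuousMap.one_apply,
      smul_eq_mul, mul_one]
    linarith
  have := volDeriv_mono_right hn K h1
  rw [volDeriv_add_right hn, volDeriv_smul_right hn _ _ hr0] at this
  linarith

theorem volDeriv_nonneg (hn : 1 ≤ n) (K : Bodies n) {L : Bodies n} (hL : 0 ≤ supportMap L) :
    0 ≤ volDeriv K L := by
  have h0 := volDeriv_smul_right hn K 0 le_rfl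
  rw [zero_smul_body, zero_mul] at h0
  rw [← h0]
  exact volDeriv_mono_right hn K (by simpa using hL)

/-- The derivative is bounded on differences of support functions by its value at the unit ball,
whose support function is `1`. A norm-preserving Hahn–Banach extension is then automatically
positive, and Riesz–Markov–Kakutani yields the measure. -/
theorem exists_isSurfaceAreaMeasure (hn : 1 ≤ n) (K : Bodies n) :
    ∃ μ : FiniteMeasure (USphere n), IsSurfaceAreaMeasure K μ := by
  set W := volDeriv K (ballBody n) with hW
  have hW0 : 0 ≤ W := volDeriv_nonneg hn K (by
    rw [supportMap_ballBody]; exact zero_le_one)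
  let Λ₀ : diffSpace n →L[ℝ] ℝ := (volDerivLinear hn K).mkContinuous W fun f => by
    rw [Real.norm_eq_abs, abs_le]
    have h1 := volDerivLinear_le hn K f
    have h2 := volDerivLinear_le hn K (-f)
    rw [map_neg, Submodule.coe_neg, norm_neg] at h2
    change _ ≤ W * ‖(f : C(USphere n, ℝ))‖ at h1
    change -(W * ‖(f : C(USphere n, ℝ))‖) ≤ _ ∧ _ ≤ W * ‖(f : C(USphere n, ℝ))‖
    constructor <;> linarith
  obtain ⟨g, hg, hgn⟩ := exists_extension_norm_eq (diffSpace n) Λ₀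
  have hgW : ‖g‖ ≤ W := hgn ▸ LinearMap.mkContinuous_norm_le _ hW0 _
  have hgL : ∀ L, g (supportMap L) = volDeriv K L := fun L => by
    have h1 := hg ⟨supportMap L, supportMap_mem_diffSpace L⟩
    have h2 := volDerivLinear_apply hn K ⟨supportMap L, supportMap_mem_diffSpace L⟩
      (A := L) (B := 0) (by simp)
    have h0 := volDeriv_smul_right hn K 0 le_rfl
    rw [zero_smul_body, zero_mul] at h0
    rw [h0, sub_zero] at h2
    exact h1.trans h2
  -- Positivity follows from `‖g‖ ≤ g 1`: for `f ≥ 0` the function `‖f‖ - f` has norm at most `‖f‖`,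
  -- whence `g 1 * ‖f‖ - g f ≤ g 1 * ‖f‖`.
  have hpos : ∀ f : C(USphere n, ℝ), 0 ≤ f → 0 ≤ g f := fun f hf => by
    have h1 : ‖‖f‖ • (1 : C(USphere n, ℝ)) - f‖ ≤ ‖f‖ := by
      rw [ContinuousMap.norm_le _ (norm_nonneg _)]
      intro u
      have h2 : f u ≤ ‖f‖ := (le_abs_self _).trans (f.norm_coe_le_norm u)
      have h3 : 0 ≤ f u := hf u
      simp only [ContinuousMap.sub_apply, ContinuousMap.smul_apply, ContinuousMap.one_apply,
        smul_eq_mul, mul_one, Real.norm_eq_abs]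
      rw [abs_of_nonneg (by linarith)]
      linarith
    have h4 : g (‖f‖ • (1 : C(USphere n, ℝ)) - f) ≤ W * ‖f‖ :=
      (le_abs_self _).trans ((g.le_opNorm _).trans
        (mul_le_mul hgW h1 (norm_nonneg _) hW0))
    rw [map_sub, map_smul, ← supportMap_ballBody, hgL, smul_eq_mul, ← hW] at h4
    linarith
  let Λ : C_c(USphere n, ℝ) →ₚ[ℝ] ℝ := PositiveLinearMap.mk₀
    { toFun := fun f => g f.toContinuousMap
      map_add' := fun a b => g.map_add a.toContinuousMap b.toContinuousMap
      map_smul' := fun c a => g.map_smul c a.toContinuousMap } fun f hf => hpos _ hf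
  refine ⟨⟨RealRMK.rieszMeasure Λ, inferInstance⟩, fun L => ?_⟩
  have h1 := RealRMK.integral_rieszMeasure Λ
    (CompactlySupportedContinuousMap.continuousMapEquiv (supportMap L))
  have h2 : ∫ u, supportFun L u ∂(RealRMK.rieszMeasure Λ) = volDeriv K L := by
    rw [← hgL L]
    exact h1
  change HasDerivWithinAt (fun t : ℝ => vol (K + t • L)) _ _ _
  rw [FiniteMeasure.toMeasure_mk, h2]
  exact hasDerivWithinAt_vol hn K L

theorem integral_supportFun_eq_volDeriv (hn : 1 ≤ n) {K : Bodies n}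
    {μ : FiniteMeasure (USphere n)} (hμ : IsSurfaceAreaMeasure K μ) (L : Bodies n) :
    ∫ u, supportFun L u ∂(μ : Measure (USphere n)) = volDeriv K L :=
  (uniqueDiffOn_Ici (0 : ℝ) 0 (mem_Ici.2 le_rfl)).eq_deriv _ (hμ L) (hasDerivWithinAt_vol hn K L)

/-- Integration against a finite measure as a continuous functional. -/
def integralCLM (μ : FiniteMeasure (USphere n)) : C(USphere n, ℝ) →L[ℝ] ℝ :=
  LinearMap.mkContinuous
    { toFun := fun f => ∫ u, f u ∂(μ : Measure (USphere n))
      map_add' := fun f g => integral_add (f.continuous.integrable_of_hasCompactSupport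
        (HasCompactSupport.of_compactSpace _)) (g.continuous.integrable_of_hasCompactSupport
        (HasCompactSupport.of_compactSpace _))
      map_smul' := fun c f => integral_const_mul c _ }
    ((μ : Measure (USphere n)).real univ) fun f => by
      rw [mul_comm]
      exact norm_integral_le_of_norm_le_const (Eventually.of_forall f.norm_coe_le_norm)

theorem integralCLM_apply (μ : FiniteMeasure (USphere n)) (f : C(USphere n, ℝ)) :
    integralCLM μ f = ∫ u, f u ∂(μ : Measure (USphere n)) := rfl

theorem integralCLM_injective : Function.Injective (integralCLM (n := n)) := fun μ ν h => by
  refine FiniteMeasure.toMeasure_injective (ext_of_forall_integral_eq_of_IsFiniteMeasure fun f => ?_)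
  exact congrArg (fun T : C(USphere n, ℝ) →L[ℝ] ℝ => T f.toContinuousMap) h

theorem clm_ext_supportMap {S T : C(USphere n, ℝ) →L[ℝ] ℝ}
    (h : ∀ L, S (supportMap L) = T (supportMap L)) : S = T := by
  refine DFunLike.coe_injective (S.continuous.ext_on dense_diffSpace T.continuous ?_)
  rintro _ ⟨A, B, rfl⟩
  rw [map_sub, map_sub, h, h]

theorem existsUnique_isSurfaceAreaMeasure (hn : 1 ≤ n) (K : Bodies n) :
    ∃! μ : FiniteMeasure (USphere n), IsSurfaceAreaMeasure K μ := by
  obtain ⟨μ, hμ⟩ := exists_isSurfaceAreaMeasure hn K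
  refine ⟨μ, hμ, fun ν hν => integralCLM_injective (clm_ext_supportMap fun L => ?_)⟩
  exact (integral_supportFun_eq_volDeriv hn hν L).trans
    (integral_supportFun_eq_volDeriv hn hμ L).symm

theorem isSurfaceAreaMeasure_surfaceArea (hn : 1 ≤ n) (K : Bodies n) :
    IsSurfaceAreaMeasure K (surfaceArea K) := by
  have h := exists_isSurfaceAreaMeasure hn K
  rw [surfaceArea, dif_pos h]
  exact h.choose_spec

/-! ### Properties of the surface area measure -/

theorem integralCLM_supportMap (hn : 1 ≤ n) (K L : Bodies n) :
    integralCLM (surfaceArea K) (supportMap L) = volDeriv K L :=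
  integral_supportFun_eq_volDeriv hn (isSurfaceAreaMeasure_surfaceArea hn K) L

theorem abs_integralCLM_le (hn : 1 ≤ n) (K : Bodies n) (f : C(USphere n, ℝ)) :
    |integralCLM (surfaceArea K) f| ≤ volDeriv K (ballBody n) * ‖f‖ := by
  have h1 := integralCLM_supportMap hn K (ballBody n)
  rw [integralCLM_apply, supportMap_ballBody] at h1
  simp only [ContinuousMap.one_apply, integral_const, smul_eq_mul, mul_one] at h1
  rw [integralCLM_apply, ← h1, mul_comm]
  exact norm_integral_le_of_norm_le_const (Eventually.of_forall f.norm_coe_le_norm)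

/-- Continuity is clear on differences of support functions, and the total mass is locally bounded
in `K`, so uniform approximation of `f` carries it over. -/
theorem continuous_integralCLM (hn : 1 ≤ n) (f : C(USphere n, ℝ)) :
    Continuous fun K : Bodies n => integralCLM (surfaceArea K) f := by
  refine continuous_of_locally_uniform_approx_of_continuousAt fun K₀ u hu => ?_
  obtain ⟨ε, hε, hεu⟩ := Metric.mem_uniformity_dist.1 hu
  have hW0 : 0 ≤ volDeriv K₀ (ballBody n) := volDeriv_nonneg hn K₀ (by
    rw [supportMap_ballBody]; exact zero_le_one)
  set M := volDeriv K₀ (ballBody n) + 1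
  have hM : 0 < M := by positivity
  obtain ⟨d, hd, hfd⟩ := Metric.dense_iff.1 dense_diffSpace f (ε / M) (by positivity)
  obtain ⟨A, B, rfl⟩ := hfd
  refine ⟨{K | volDeriv K (ballBody n) < M},
    (isOpen_lt (continuous_volDeriv_left _) continuous_const).mem_nhds
      (show volDeriv K₀ (ballBody n) < M from lt_add_one _),
    fun K => integralCLM (surfaceArea K) (supportMap A - supportMap B), ?_, fun K hK => hεu ?_⟩
  · simp only [map_sub, integralCLM_supportMap hn]
    exact ((continuous_volDeriv_left A).sub (continuous_volDeriv_left B)).continuousAt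
  · rw [Real.dist_eq, ← map_sub]
    refine (abs_integralCLM_le hn K _).trans_lt ?_
    rw [Metric.mem_ball, dist_comm, dist_eq_norm] at hd
    have hK : volDeriv K (ballBody n) < M := hK
    have hK0 : 0 ≤ volDeriv K (ballBody n) := volDeriv_nonneg hn K (by
      rw [supportMap_ballBody]; exact zero_le_one)
    calc volDeriv K (ballBody n) * ‖f - (supportMap A - supportMap B)‖
        ≤ M * ‖f - (supportMap A - supportMap B)‖ := by gcongr
      _ < M * (ε / M) := by gcongr
      _ = ε := by field_simp

/-- Locality of the volume derivative concerns differences of support functions that vanish off a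
closed subset of `U`, so `f` has to be approximated by such functions. -/
theorem integralCLM_eq_of_nonneg (hn : 1 ≤ n) {K L : Bodies n} {U : Set (USphere n)}
    (hU : IsOpen U) (hKL : ∀ u ∈ U, supportFun K u = supportFun L u) {f : C(USphere n, ℝ)}
    (hf0 : 0 ≤ f) (hf : ∀ u ∉ U, f u = 0) :
    integralCLM (surfaceArea K) f = integralCLM (surfaceArea L) f := by
  set W := volDeriv K (ballBody n) + volDeriv L (ballBody n) with hW
  have hpos : ∀ M : Bodies n, 0 ≤ volDeriv M (ballBody n) := fun M => volDeriv_nonneg hn M (by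
    rw [supportMap_ballBody]; exact zero_le_one)
  have hW0 : 0 ≤ W := add_nonneg (hpos K) (hpos L)
  have key : ∀ ε : ℝ, 0 < ε →
      |integralCLM (surfaceArea K) f - integralCLM (surfaceArea L) f| ≤ 3 * ε * W := by
    intro ε hε
    obtain ⟨d, hd, hfd⟩ := Metric.dense_iff.1 dense_diffSpace f ε hε
    have hfd' : ∀ u, |d u - f u| ≤ ε := fun u =>
      (ContinuousMap.dist_apply_le_dist (f := d) (g := f) u).trans (Metric.mem_ball.1 hd).le
    -- Where `f < ε`, the approximant `d` is below `2ε`, so the truncation vanishes off the closed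
    -- set `{ε ≤ f} ⊆ U`. The cost in sup norm is at most `3ε`.
    let f' := (d - (2 * ε) • (1 : C(USphere n, ℝ))) ⊔ 0
    have hf' : ∀ u, f' u = max (d u - 2 * ε) 0 := fun u => by simp [f']
    have hmem : f' ∈ diffSpace n := sup_mem_diffSpace (sub_mem hfd
      ((diffSpace n).smul_mem _ one_mem_diffSpace)) (zero_mem _)
    obtain ⟨A, B, hAB⟩ := hmem
    have hdist : ‖f - f'‖ ≤ 3 * ε := by
      rw [ContinuousMap.norm_le _ (by positivity)]
      intro u
      have h1 := abs_le.1 (hfd' u)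
      have h2 : 0 ≤ f u := hf0 u
      rw [ContinuousMap.sub_apply, hf', Real.norm_eq_abs, abs_le]
      rcases max_cases (d u - 2 * ε) 0 with ⟨e, h⟩ | ⟨e, h⟩ <;> rw [e] <;> constructor <;> linarith
    have hloc : integralCLM (surfaceArea K) f' = integralCLM (surfaceArea L) f' := by
      rw [hAB, map_sub, map_sub, integralCLM_supportMap hn, integralCLM_supportMap hn,
        integralCLM_supportMap hn, integralCLM_supportMap hn]
      refine volDeriv_sub_eq_of_supportFun_eq hn (C := {u | ε ≤ f u}) (U := U)
        (isClosed_le continuous_const f.continuous) hU (fun u hu => ?_) (fun u hu => ?_) hKL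
      · by_contra h
        have hu : ε ≤ f u := hu
        rw [hf u h] at hu
        linarith
      · have hu : f u < ε := not_le.1 hu
        have h1 := abs_le.1 (hfd' u)
        have h2 : f' u = 0 := by rw [hf', max_eq_right (by linarith)]
        rw [hAB, ContinuousMap.sub_apply, sub_eq_zero] at h2
        exact h2
    have e : integralCLM (surfaceArea K) f - integralCLM (surfaceArea L) f =
        integralCLM (surfaceArea K) (f - f') - integralCLM (surfaceArea L) (f - f') := by
      rw [map_sub, map_sub, hloc]
      ring
    rw [e]
    refine (abs_sub _ _).trans ((add_le_add (abs_integralCLM_le hn K _)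
      (abs_integralCLM_le hn L _)).trans ?_)
    rw [← add_mul, ← hW, mul_comm]
    gcongr
  have h0 : |integralCLM (surfaceArea K) f - integralCLM (surfaceArea L) f| ≤ 0 := by
    refine le_of_forall_pos_le_add fun δ hδ => ?_
    have h := key (δ / (3 * (W + 1))) (by positivity)
    refine h.trans ?_
    rw [zero_add]
    have : 3 * (δ / (3 * (W + 1))) * W = δ * (W / (W + 1)) := by field_simp
    rw [this]
    have : W / (W + 1) ≤ 1 := (div_le_one (by linarith)).2 (by linarith)
    nlinarith
  exact sub_eq_zero.1 (abs_eq_zero.1 (le_antisymm h0 (abs_nonneg _)))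

theorem integralCLM_eq_of_eqOn (hn : 1 ≤ n) {K L : Bodies n} {U : Set (USphere n)}
    (hU : IsOpen U) (hKL : ∀ u ∈ U, supportFun K u = supportFun L u) {f : C(USphere n, ℝ)}
    (hf : ∀ u ∉ U, f u = 0) :
    integralCLM (surfaceArea K) f = integralCLM (surfaceArea L) f := by
  have e : f = (f ⊔ 0) - (-f ⊔ 0) := by
    ext u
    simp only [ContinuousMap.sub_apply, ContinuousMap.sup_apply, ContinuousMap.neg_apply,
      ContinuousMap.zero_apply]
    rcases le_total 0 (f u) with h | h
    · rw [max_eq_left h, max_eq_right (by linarith), sub_zero]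
    · rw [max_eq_right h, max_eq_left (by linarith)]
      ring
  rw [e, map_sub, map_sub,
    integralCLM_eq_of_nonneg hn hU hKL (f := f ⊔ 0) le_sup_right fun u hu => by simp [hf u hu],
    integralCLM_eq_of_nonneg hn hU hKL (f := -f ⊔ 0) le_sup_right fun u hu => by simp [hf u hu]]

theorem integralCLM_add_pointBody (hn : 1 ≤ n) (K : Bodies n) (x : Eucl n) :
    integralCLM (surfaceArea (K + pointBody x)) = integralCLM (surfaceArea K) :=
  clm_ext_supportMap fun L => by
    rw [integralCLM_supportMap hn, integralCLM_supportMap hn, volDeriv_add_pointBody_left]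

theorem integralCLM_smul (hn : 1 ≤ n) {t : ℝ} (ht : 0 ≤ t) (K : Bodies n) :
    integralCLM (surfaceArea (t • K)) = t ^ (n - 1) • integralCLM (surfaceArea K) :=
  clm_ext_supportMap fun L => by
    rw [smul_apply, integralCLM_supportMap hn, integralCLM_supportMap hn,
      volDeriv_smul_left hn ht, smul_eq_mul]

/-! ### The surface area measure as a complex functional -/

/-- The real part of a continuous function. -/
def reMap (φ : C(USphere n, ℂ)) : C(USphere n, ℝ) := ⟨fun u => (φ u).re, by fun_prop⟩

/-- The imaginary part of a continuous function. -/
def imMap (φ : C(USphere n, ℂ)) : C(USphere n, ℝ) := ⟨fun u => (φ u).im, by fun_prop⟩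

theorem integrable_continuous (μ : FiniteMeasure (USphere n)) {E : Type*} [NormedAddCommGroup E]
    (φ : C(USphere n, E)) : Integrable φ (μ : Measure (USphere n)) :=
  φ.continuous.integrable_of_hasCompactSupport (HasCompactSupport.of_compactSpace _)

/-- The functional `φ ↦ ∫ φ ψ dS_{n-1}(K)`. -/
def densityFunctional (ψ : C(USphere n, ℂ)) (K : Bodies n) : C(USphere n, ℂ) →L[ℂ] ℂ :=
  LinearMap.mkContinuous
    { toFun := fun φ => ∫ u, φ u * ψ u ∂(surfaceArea K : Measure (USphere n))
      map_add' := fun f g => by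
        simp only [ContinuousMap.add_apply, add_mul]
        exact integral_add (integrable_continuous _ (f * ψ)) (integrable_continuous _ (g * ψ))
      map_smul' := fun c f => by
        simp only [ContinuousMap.smul_apply, smul_eq_mul, mul_assoc, RingHom.id_apply]
        exact integral_const_mul c _ }
    (‖ψ‖ * (surfaceArea K : Measure (USphere n)).real univ) fun f => by
      refine (norm_integral_le_of_norm_le_const (C := ‖f‖ * ‖ψ‖)
        (Eventually.of_forall fun u => ?_)).trans (le_of_eq (by ring))
      rw [norm_mul]
      exact mul_le_mul (f.norm_coe_le_norm u) (ψ.norm_coe_le_norm u) (norm_nonneg _) (norm_nonneg _)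

theorem densityFunctional_apply (ψ : C(USphere n, ℂ)) (K : Bodies n) (φ : C(USphere n, ℂ)) :
    densityFunctional ψ K φ = ∫ u, φ u * ψ u ∂(surfaceArea K : Measure (USphere n)) := rfl

theorem densityFunctional_apply_eq (ψ : C(USphere n, ℂ)) (K : Bodies n) (φ : C(USphere n, ℂ)) :
    densityFunctional ψ K φ = (integralCLM (surfaceArea K) (reMap (φ * ψ)) : ℂ) +
      (integralCLM (surfaceArea K) (imMap (φ * ψ)) : ℂ) * Complex.I :=
  (integral_re_add_im (integrable_continuous (surfaceArea K) (φ * ψ))).symm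

theorem isAreaFunctional_densityFunctional (hn : 1 ≤ n) (ψ : C(USphere n, ℂ)) :
    IsAreaFunctional (densityFunctional ψ) where
  continuous φ := by
    simp only [densityFunctional_apply_eq]
    have h1 := continuous_integralCLM hn (reMap (φ * ψ))
    have h2 := continuous_integralCLM hn (imMap (φ * ψ))
    fun_prop
  congr_of_eqOn hU h φ hφ := by
    rw [densityFunctional_apply_eq, densityFunctional_apply_eq,
      integralCLM_eq_of_eqOn hn hU h (f := reMap (φ * ψ)) fun u hu => by simp [reMap, hφ u hu],
      integralCLM_eq_of_eqOn hn hU h (f := imMap (φ * ψ)) fun u hu => by simp [imMap, hφ u hu]]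
  translate K x := by
    ext φ
    rw [densityFunctional_apply_eq, densityFunctional_apply_eq, integralCLM_add_pointBody hn]

theorem densityFunctional_smul (hn : 1 ≤ n) (ψ : C(USphere n, ℂ)) {t : ℝ} (ht : 0 ≤ t)
    (K : Bodies n) : densityFunctional ψ (t • K) = ((t : ℂ) ^ (n - 1)) • densityFunctional ψ K := by
  ext φ
  rw [smul_apply, densityFunctional_apply_eq, densityFunctional_apply_eq, integralCLM_smul hn ht]
  simp only [smul_apply, smul_eq_mul]
  push_cast
  ring

end SurfaceArea

/-! ### Complex measures as functionals -/

section Pairing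

variable {n : ℕ}

theorem pairing_const_smul (μ : SphereMeasure n) (c : ℂ) (φ : C(USphere n, ℂ)) :
    pairing μ (c • φ) = c * pairing μ φ := by
  rw [pairing, pairing, VectorMeasure.integral_eq_setToFun, VectorMeasure.integral_eq_setToFun]
  exact setToFun_smul (dominatedFinMeasAdditive_cbmApplyMeasure μ (ContinuousLinearMap.mul ℝ ℂ))
    (fun c s x => by
      change c * x * μ s = c * (x * μ s)
      ring) c φ

/-- Integration against a complex measure as a continuous functional. -/
def pairingCLM : SphereMeasure n →ₗ[ℂ] (C(USphere n, ℂ) →L[ℂ] ℂ) where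
  toFun μ := LinearMap.mkContinuous
    { toFun := pairing μ
      map_add' := fun φ χ => VectorMeasure.integral_add (integrable_continuousMap μ φ)
        (integrable_continuousMap μ χ)
      map_smul' := fun c φ => pairing_const_smul μ c φ }
    (‖ContinuousLinearMap.mul ℝ ℂ‖ * μ.variation.real univ) fun φ =>
      (VectorMeasure.norm_integral_le_of_norm_le_const
        (Eventually.of_forall φ.norm_coe_le_norm)).trans (le_of_eq (by ring))
  map_add' μ ν := by
    ext φ
    exact pairing_add μ ν φ
  map_smul' c μ := by
    ext φ
    exact pairing_smul c μ φ

@[simp]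
theorem pairingCLM_apply (μ : SphereMeasure n) (φ : C(USphere n, ℂ)) :
    pairingCLM μ φ = pairing μ φ := rfl

theorem integral_indicator_one (σ : SphereMeasure n) {s : Set (USphere n)}
    (hs : MeasurableSet s) :
    VectorMeasure.integral σ (s.indicator fun _ => (1 : ℂ)) (ContinuousLinearMap.mul ℝ ℂ) = σ s := by
  rw [VectorMeasure.integral_indicator hs]
  have : IsFiniteMeasure (σ.restrict s).variation := by
    rw [VectorMeasure.variation_restrict hs]
    infer_instance
  rw [VectorMeasure.integral_const, VectorMeasure.restrict_apply _ hs MeasurableSet.univ]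
  simp

/-- The indicator of `s` is approximated in `L¹` of the variation by continuous functions supported
in `U`, on which the pairing vanishes. -/
theorem apply_eq_zero_of_isClosed {σ : SphereMeasure n} {U : Set (USphere n)} (hU : IsOpen U)
    (h : ∀ φ : C(USphere n, ℂ), (∀ u ∉ U, φ u = 0) → pairing σ φ = 0) {s : Set (USphere n)}
    (hs : IsClosed s) (hsU : s ⊆ U) : σ s = 0 := by
  rw [← enorm_eq_zero]
  refine le_antisymm (ENNReal.le_of_forall_pos_le_add fun ε hε _ => ?_) zero_le
  obtain ⟨f, hfc, hf1, -, hfU, -⟩ := exists_continuous_eLpNorm_sub_le_of_closed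
    (μ := σ.variation) ENNReal.one_ne_top hs hU hsU (measure_ne_top _ _) (1 : ℂ)
    (ε := (ε : ℝ≥0∞)) (by exact_mod_cast hε.ne')
  let φ : C(USphere n, ℂ) := ⟨f, hfc⟩
  have h1 : pairing σ φ = 0 := h φ fun u hu => by
    by_contra h0
    exact hu (hfU h0)
  have hint : σ.Integrable (s.indicator fun _ => (1 : ℂ)) :=
    (integrable_const (1 : ℂ)).indicator hs.measurableSet
  have h2 := VectorMeasure.edist_integral_le_lintegral_edist (B := ContinuousLinearMap.mul ℝ ℂ)
    (integrable_continuousMap σ φ) hint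
  rw [integral_indicator_one σ hs.measurableSet] at h2
  change edist (pairing σ φ) _ ≤ _ at h2
  rw [h1, edist_comm, edist_zero_right] at h2
  refine h2.trans ?_
  rw [zero_add]
  rw [eLpNorm_one_eq_lintegral_enorm] at hf1
  have h3 : ‖ContinuousLinearMap.mul ℝ ℂ‖ₑ ≤ 1 := by
    have := ContinuousLinearMap.opNorm_mul_le ℝ ℂ
    rw [← ofReal_norm]
    exact ENNReal.ofReal_le_one.2 this
  calc _ ≤ 1 * ∫⁻ a, edist (φ a) (s.indicator (fun _ => (1 : ℂ)) a) ∂σ.variation := by gcongr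
    _ ≤ ε := by
      rw [one_mul]
      simp only [edist_eq_enorm_sub]
      exact hf1

theorem apply_eq_zero_of_subset {σ : SphereMeasure n} {U : Set (USphere n)} (hU : IsOpen U)
    (h : ∀ φ : C(USphere n, ℂ), (∀ u ∉ U, φ u = 0) → pairing σ φ = 0) {A : Set (USphere n)}
    (hA : MeasurableSet A) (hAU : A ⊆ U) : σ A = 0 := by
  rw [← enorm_eq_zero]
  refine le_antisymm (ENNReal.le_of_forall_pos_le_add fun ε hε _ => ?_) zero_le
  obtain ⟨s, hsA, -, hs, hlt⟩ := hA.exists_isCompact_isClosed_sdiff_lt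
    (measure_ne_top σ.variation A) (ε := (ε : ℝ≥0∞)) (by exact_mod_cast hε.ne')
  have h1 : σ A = σ s + σ (A \ s) :=
    (VectorMeasure.of_add_of_sdiff hs.measurableSet hA hsA).symm
  rw [h1, apply_eq_zero_of_isClosed hU h hs (hsA.trans hAU), zero_add, zero_add]
  exact (VectorMeasure.enorm_measure_le_variation σ _).trans hlt.le

/-- This translates locality of measures into locality of functionals, so that the problem can be
treated in the dual of the continuous functions. -/
theorem restrict_eq_iff_pairing_eq {μ ν : SphereMeasure n} {U : Set (USphere n)} (hU : IsOpen U) :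
    μ.restrict U = ν.restrict U ↔
      ∀ φ : C(USphere n, ℂ), (∀ u ∉ U, φ u = 0) → pairing μ φ = pairing ν φ := by
  have hsub : ∀ φ : C(USphere n, ℂ), pairing (μ - ν) φ = pairing μ φ - pairing ν φ := fun φ => by
    simp only [← pairingCLM_apply, map_sub, sub_apply]
  constructor
  · intro h φ hφ
    rw [← sub_eq_zero, ← hsub]
    have hv : (μ - ν).variation U = 0 := by
      rw [VectorMeasure.variation_apply_eq_zero hU.measurableSet]
      intro t htU ht
      have h1 := VectorMeasure.restrict_apply μ hU.measurableSet ht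
      have h2 := VectorMeasure.restrict_apply ν hU.measurableSet ht
      rw [inter_eq_left.2 htU] at h1 h2
      rw [sub_apply, ← h1, ← h2, h, sub_self]
    refine VectorMeasure.integral_eq_zero_of_ae ?_
    filter_upwards [measure_eq_zero_iff_ae_notMem.1 hv] with u hu using hφ u hu
  · intro h
    ext A hA
    rw [VectorMeasure.restrict_apply _ hU.measurableSet hA,
      VectorMeasure.restrict_apply _ hU.measurableSet hA, ← sub_eq_zero, ← sub_apply]
    refine apply_eq_zero_of_subset hU (fun φ hφ => ?_) (hA.inter hU.measurableSet)
      inter_subset_right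
    rw [hsub, h φ hφ, sub_self]

theorem pairingCLM_injective : Function.Injective (pairingCLM (n := n)) := fun μ ν h => by
  have := (restrict_eq_iff_pairing_eq (μ := μ) (ν := ν) isOpen_univ).2 fun φ _ =>
    congrArg (fun T : C(USphere n, ℂ) →L[ℂ] ℂ => T φ) h
  rwa [VectorMeasure.restrict_univ, VectorMeasure.restrict_univ] at this

theorem mem_Area_iff {Ψ : Bodies n → SphereMeasure n} :
    Ψ ∈ Area n ↔ IsAreaFunctional fun K => pairingCLM (Ψ K) := by
  constructor
  · rintro ⟨h1, h2, h3⟩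
    refine ⟨h1, fun hU h φ hφ => ?_, fun K x => by rw [h3]⟩
    exact (restrict_eq_iff_pairing_eq hU).1 (h2 _ _ _ hU h) φ hφ
  · intro h
    refine ⟨h.continuous, fun K L U hU hKL => ?_, fun K x => pairingCLM_injective (h.translate K x)⟩
    exact (restrict_eq_iff_pairing_eq hU).2 fun φ hφ => h.congr_of_eqOn hU hKL hφ

theorem mem_AreaHom_iff {Ψ : Bodies n → SphereMeasure n} {k : ℕ} :
    Ψ ∈ AreaHom n k ↔ IsAreaFunctional (fun K => pairingCLM (Ψ K)) ∧
      ∀ (t : ℝ) (K : Bodies n), 0 ≤ t →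
        pairingCLM (Ψ (t • K)) = ((t : ℂ) ^ k) • pairingCLM (Ψ K) := by
  refine and_congr mem_Area_iff (forall_congr' fun t => forall_congr' fun K =>
    imp_congr_right fun _ => ?_)
  rw [← map_smul, pairingCLM_injective.eq_iff]

theorem hasSurfaceDensity_iff {Ψ : Bodies n → SphereMeasure n} {ψ : C(USphere n, ℂ)} :
    HasSurfaceDensity Ψ ψ ↔ ∀ K, pairingCLM (Ψ K) = densityFunctional ψ K :=
  forall_congr' fun _ => ⟨fun h => ContinuousLinearMap.ext h, fun h φ =>
    congrArg (fun T : C(USphere n, ℂ) →L[ℂ] ℂ => T φ) h⟩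

end Pairing

/-! ### The homogeneous decomposition -/

section Decomposition

variable {n : ℕ}

theorem comp_smul_mem_Area {Ψ : Bodies n → SphereMeasure n} (hΨ : Ψ ∈ Area n) {t : ℝ}
    (ht : 0 ≤ t) : (fun K => Ψ (t • K)) ∈ Area n := by
  obtain ⟨h1, h2, h3⟩ := hΨ
  refine ⟨fun φ => (h1 φ).comp (continuous_const_smul_body ht), fun K L U hU h => ?_,
    fun K x => ?_⟩
  · refine h2 _ _ U hU fun u hu => ?_
    rw [supportFun_smul _ ht, supportFun_smul _ ht, h u hu]
  · simp only [smul_add_pointBody, h3]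

/-- The homogeneous component of degree `k`. -/
def homComponent (Ψ : Bodies n → SphereMeasure n) (k : ℕ) : Bodies n → SphereMeasure n :=
  ∑ j ∈ Finset.range n, nodeCoeff ℂ n k j • fun K => Ψ ((j : ℝ) • K)

theorem homComponent_mem_Area {Ψ : Bodies n → SphereMeasure n} (hΨ : Ψ ∈ Area n) (k : ℕ) :
    homComponent Ψ k ∈ Area n :=
  Submodule.sum_mem _ fun j _ => (Area n).smul_mem _ (comp_smul_mem_Area hΨ j.cast_nonneg)

theorem pairingCLM_homComponent (Ψ : Bodies n → SphereMeasure n) (k : ℕ) (K : Bodies n)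
    (φ : C(USphere n, ℂ)) : pairingCLM (homComponent Ψ k K) φ =
      ∑ j ∈ Finset.range n, nodeCoeff ℂ n k j * pairingCLM (Ψ ((j : ℝ) • K)) φ := by
  simp only [homComponent, Finset.sum_apply, Pi.smul_apply, map_sum, map_smul]
  rw [sum_apply]
  rfl

theorem pairingCLM_smul_eq_sum {Ψ : Bodies n → SphereMeasure n} (hΨ : Ψ ∈ Area n) (K : Bodies n)
    (φ : C(USphere n, ℂ)) {t : ℝ} (ht : 0 ≤ t) : pairingCLM (Ψ (t • K)) φ =
      ∑ k ∈ Finset.range n, pairingCLM (homComponent Ψ k K) φ * (t : ℂ) ^ k := by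
  simp only [pairingCLM_homComponent]
  exact (mem_Area_iff.1 hΨ).apply_smul_eq_sum K φ ht

/-- Expanding `Ψ (s t K)` in powers of `s` once at `tK` and once at `K`, and comparing coefficients,
gives homogeneity. -/
theorem homComponent_mem_AreaHom {Ψ : Bodies n → SphereMeasure n} (hΨ : Ψ ∈ Area n) {k : ℕ}
    (hk : k < n) : homComponent Ψ k ∈ AreaHom n k := by
  refine ⟨homComponent_mem_Area hΨ k, fun t K ht => pairingCLM_injective ?_⟩
  ext φ
  rw [map_smul, smul_apply, smul_eq_mul, ← sub_eq_zero, mul_comm]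
  refine eq_zero_of_forall_sum_pow_eq_zero (d := n) (a := fun k =>
    pairingCLM (homComponent Ψ k (t • K)) φ - pairingCLM (homComponent Ψ k K) φ * (t : ℂ) ^ k)
    (fun s hs => ?_) hk
  have h1 := pairingCLM_smul_eq_sum hΨ (t • K) φ hs.le
  have h2 := pairingCLM_smul_eq_sum hΨ K φ (mul_nonneg hs.le ht)
  rw [smul_smul, h2] at h1
  simp only [sub_mul, Finset.sum_sub_distrib]
  rw [sub_eq_zero]
  refine h1.symm.trans (Finset.sum_congr rfl fun k _ => ?_)
  change _ * ((s * t : ℝ) : ℂ) ^ k = _ * (s : ℂ) ^ k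
  push_cast
  ring

theorem eq_sum_homComponent {Ψ : Bodies n → SphereMeasure n} (hΨ : Ψ ∈ Area n) :
    Ψ = ∑ k : Fin n, homComponent Ψ k := by
  ext1 K
  refine pairingCLM_injective ?_
  ext φ
  have h := pairingCLM_smul_eq_sum hΨ K φ zero_le_one
  rw [one_smul] at h
  rw [h, Finset.sum_apply, map_sum, sum_apply, Finset.sum_range]
  simp

theorem isInternal_AreaHom (n : ℕ) :
    DirectSum.IsInternal (fun k : Fin n => (AreaHom n k).submoduleOf (Area n)) := by
  classical
  constructor
  · intro x y hxy
    simp only [DirectSum.coeAddMonoidHom_eq_dfinsuppSum] at hxy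
    rw [DFinsupp.sum_eq_sum_fintype _ (by simp), DFinsupp.sum_eq_sum_fintype _ (by simp)] at hxy
    simp only [DFinsupp.equivFunOnFintype_apply] at hxy
    have key : ∀ z : DirectSum (Fin n) fun k => (AreaHom n k).submoduleOf (Area n), ∀ K φ (t : ℝ),
        0 < t → pairingCLM (((∑ k, (z k : Area n) : Area n) : Bodies n → SphereMeasure n)
          (t • K)) φ = ∑ k : Fin n,
            pairingCLM (((z k : Area n) : Bodies n → SphereMeasure n) K) φ * (t : ℂ) ^ (k : ℕ) := by
      intro z K φ t ht
      rw [AddSubmonoidClass.coe_finsetSum, Finset.sum_apply, map_sum, sum_apply]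
      refine Finset.sum_congr rfl fun k _ => ?_
      have hz : ((z k : Area n) : Bodies n → SphereMeasure n) ∈ AreaHom n k := (z k).2
      rw [hz.2 t K ht.le, map_smul, smul_apply, smul_eq_mul, mul_comm]
    refine DFinsupp.ext fun k => Subtype.ext (Subtype.ext (funext fun K => pairingCLM_injective ?_))
    ext φ
    let a : ℕ → ℂ := fun i => if h : i < n then
      pairingCLM (((x ⟨i, h⟩ : Area n) : Bodies n → SphereMeasure n) K) φ -
        pairingCLM (((y ⟨i, h⟩ : Area n) : Bodies n → SphereMeasure n) K) φ else 0
    have h3 := eq_zero_of_forall_sum_pow_eq_zero (d := n) (a := a) (fun t ht => by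
      have h := key x K φ t ht
      rw [hxy, key y K φ t ht, eq_comm, ← sub_eq_zero, ← Finset.sum_sub_distrib] at h
      rw [← h, Finset.sum_range]
      simp [a, sub_mul]) k.2
    simpa [a, sub_eq_zero] using h3
  · intro Ψ
    refine ⟨∑ k : Fin n, DirectSum.of (fun k : Fin n => (AreaHom n k).submoduleOf (Area n)) k
      ⟨⟨homComponent Ψ k, homComponent_mem_Area Ψ.2 k⟩, homComponent_mem_AreaHom Ψ.2 k.2⟩, ?_⟩
    rw [map_sum]
    simp only [DirectSum.coeAddMonoidHom_of]
    refine Subtype.ext ?_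
    rw [AddSubmonoidClass.coe_finsetSum]
    exact (eq_sum_homComponent Ψ.2).symm

/-- Evaluation at the origin on homogeneous maps of degree `0`. -/
def evalZero (n : ℕ) : AreaHom n 0 →ₗ[ℂ] SphereMeasure n where
  toFun Ψ := (Ψ : Bodies n → SphereMeasure n) 0
  map_add' _ _ := rfl
  map_smul' _ _ := rfl

/-- Homogeneity of degree zero at `t = 0`, with `0 ^ 0 = 1`, makes every such map constant;
conversely constants are area maps. -/
theorem evalZero_bijective (n : ℕ) : Function.Bijective (evalZero n) := by
  constructor
  · intro Ψ Θ h
    refine Subtype.ext (funext fun K => ?_)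
    have h1 := Ψ.2.2 0 K le_rfl
    have h2 := Θ.2.2 0 K le_rfl
    rw [zero_smul_body, pow_zero, one_smul] at h1 h2
    rw [← h1, ← h2]
    exact h
  · intro μ
    refine ⟨⟨fun _ => μ, ⟨fun φ => continuous_const, fun _ _ _ _ _ => rfl, fun _ _ => rfl⟩,
      fun t K _ => by simp⟩, rfl⟩

end Decomposition

/-! ### Mixed differences of maximal order -/

section TopOrder

namespace IsAreaFunctional

theorem sub {n : ℕ} {F G : Bodies n → (C(USphere n, ℂ) →L[ℂ] ℂ)} (hF : IsAreaFunctional F)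
    (hG : IsAreaFunctional G) : IsAreaFunctional fun K => F K - G K where
  continuous φ := (hF.continuous φ).sub (hG.continuous φ)
  congr_of_eqOn hU h φ hφ := by
    rw [sub_apply, sub_apply, hF.congr_of_eqOn hU h hφ, hG.congr_of_eqOn hU h hφ]
  translate K x := by rw [hF.translate, hG.translate]

theorem mixedDiff_apply_congr {n m : ℕ} {F : Bodies n → (C(USphere n, ℂ) →L[ℂ] ℂ)}
    (hF : IsAreaFunctional F) {L L' : Fin m → Bodies n} {U : Set (USphere n)} (hU : IsOpen U)
    (h : ∀ i, ∀ u ∈ U, supportFun (L i) u = supportFun (L' i) u) {φ : C(USphere n, ℂ)}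
    (hφ : ∀ u ∉ U, φ u = 0) (K : Bodies n) : mixedDiff F L K φ = mixedDiff F L' K φ := by
  rw [mixedDiff_apply, mixedDiff_apply]
  refine Finset.sum_congr rfl fun s _ => congrArg _ (hF.congr_of_eqOn hU (fun u hu => ?_) hφ)
  rw [supportFun_add, supportFun_add, supportFun_sum, supportFun_sum]
  exact congrArg _ (Finset.sum_congr rfl fun i _ => h i u hu)

theorem mixedDiff_add_pointBody {n m : ℕ} {F : Bodies n → (C(USphere n, ℂ) →L[ℂ] ℂ)}
    (hF : IsAreaFunctional F) (L : Fin m → Bodies n) (x : Fin m → Eucl n) (K : Bodies n) :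
    mixedDiff F (fun i => L i + pointBody (x i)) K = mixedDiff F L K := by
  have h : ∀ (s : Finset (Fin m)) (M : Bodies n), F (M + ∑ i ∈ s, pointBody (x i)) = F M := by
    intro s
    induction s using Finset.induction_on with
    | empty => simp
    | insert i s hi ih =>
      intro M
      rw [Finset.sum_insert hi, ← add_assoc, ih, hF.translate]
  refine Finset.sum_congr rfl fun s _ => ?_
  rw [Finset.sum_add_distrib, ← add_assoc, h]

variable {m : ℕ} {F : Bodies (m + 1) → (C(USphere (m + 1), ℂ) →L[ℂ] ℂ)}

/-- The change of base point is a mixed difference of order `m + 1`, which equals the dimension and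
hence vanishes. -/
theorem mixedDiff_eq_mixedDiff_zero (hF : IsAreaFunctional F) (L : Fin m → Bodies (m + 1))
    (K : Bodies (m + 1)) : mixedDiff F L K = mixedDiff F L 0 := by
  have h := mixedDiff_cons F L K 0
  rw [hF.mixedDiff_eq_zero, zero_add] at h
  exact (sub_eq_zero.1 h.symm).symm

theorem mixedDiff_update_add (hF : IsAreaFunctional F) (L : Fin m → Bodies (m + 1)) (i : Fin m)
    (A B : Bodies (m + 1)) : mixedDiff F (Function.update L i (A + B)) 0 =
      mixedDiff F (Function.update L i A) 0 + mixedDiff F (Function.update L i B) 0 := by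
  rw [LocalArea.mixedDiff_update_add, hF.mixedDiff_eq_mixedDiff_zero _ (0 + A)]

theorem mixedDiff_update_smul (hF : IsAreaFunctional F) (L : Fin m → Bodies (m + 1)) (i : Fin m)
    (A : Bodies (m + 1)) {t : ℝ} (ht : 0 ≤ t) : mixedDiff F (Function.update L i (t • A)) 0 =
      (t : ℂ) • mixedDiff F (Function.update L i A) 0 := by
  ext φ
  set g : ℝ → ℂ := fun t => mixedDiff F (Function.update L i (t • A)) 0 φ with hg
  have hadd : ∀ s t : ℝ, 0 ≤ s → 0 ≤ t → g (s + t) = g s + g t := fun s t hs ht => by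
    simp only [hg]
    rw [add_smul_body hs ht, hF.mixedDiff_update_add, add_apply]
  have hc : ContinuousOn g (Ici 0) := by
    refine (hF.continuous_mixedDiff_apply 0 φ).comp_continuousOn ?_
    exact (continuous_const.update i continuous_id).comp_continuousOn (continuousOn_smul_body A)
  have h0 : g 0 = 0 := by simpa using hadd 0 0 le_rfl le_rfl
  -- Additivity kills second differences, so `g` is affine by continuity; `g 0 = 0` then makes it
  -- linear.
  have key := fun t ht => eq_sum_of_sum_choose_eq_zero (d := 2) hc (fun s t hs ht => by
    have h2 := hadd (s + t) t (by positivity) ht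
    have h1 := hadd s t hs ht
    have e : s + 2 * t = s + t + t := by ring
    simp only [Finset.sum_range_succ, Finset.sum_range_zero]
    norm_num
    rw [e, h2, h1]
    ring) (t := t) ht
  have k0 := key 0 le_rfl
  have k1 := key 1 zero_le_one
  have kt := key t ht
  rw [Finset.sum_range_succ, Finset.sum_range_one] at k0 k1 kt
  simp only [h0, pow_zero, mul_one, pow_one, RCLike.ofReal_zero, mul_zero, add_zero,
    RCLike.ofReal_one] at k0 k1 kt
  rw [← k0, zero_add] at k1 kt
  rw [← k1] at kt
  rw [smul_apply, smul_eq_mul]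
  have e1 : mixedDiff F (Function.update L i A) 0 φ = g 1 := by simp only [hg, one_smul]
  rw [e1, mul_comm]
  exact kt

/-- With the segment `f` as an entry the mixed difference lives on `f^⊥`, while `A` and `B` are only
known to agree on one open side of it. Tilting the segment slightly pushes the relevant part of
`f^⊥` into that side. -/
theorem mixedDiff_update_eq_of_supportFun_eq (hF : IsAreaFunctional F)
    {L : Fin m → Bodies (m + 1)} {i j : Fin m} (hij : i ≠ j) {f x : Eucl (m + 1)}
    (hL : L j = segBody f + pointBody x) {A B : Bodies (m + 1)}
    (h : ∀ v : USphere (m + 1), inner ℝ f (v : Eucl (m + 1)) < 0 →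
      supportFun A v = supportFun B v) :
    mixedDiff F (Function.update L i A) 0 = mixedDiff F (Function.update L i B) 0 := by
  rw [← sub_eq_zero]
  refine functional_eq_zero_of_locally _ fun u => ?_
  -- Test functions supported in the open hemisphere around `u` suffice, and `u` also serves as the
  -- tilting direction.
  refine ⟨{v | 0 < inner ℝ (u : Eucl (m + 1)) v}, isOpen_lt (by fun_prop) (by fun_prop),
    by simp, fun φ hφ => ?_⟩
  let P : ℝ → Fin m → Bodies (m + 1) := fun δ =>
    Function.update L j (segBody (f + δ • (u : Eucl (m + 1))) + pointBody x)
  have hP : Continuous P :=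
    continuous_const.update j ((continuous_segBody.comp (by fun_prop)).add continuous_const)
  have hcont : ∀ C, Continuous fun δ => mixedDiff F (Function.update (P δ) i C) 0 φ := fun C =>
    (hF.continuous_mixedDiff_apply 0 φ).comp (hP.update i continuous_const)
  have hpos : ∀ δ > 0, mixedDiff F (Function.update (P δ) i A) 0 φ =
      mixedDiff F (Function.update (P δ) i B) 0 φ := by
    intro δ hδ
    have hPj : ∀ C, Function.update (P δ) i C j =
        segBody (f + δ • (u : Eucl (m + 1))) + pointBody x := fun C => by
      rw [Function.update_of_ne hij.symm]
      exact Function.update_self ..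
    suffices h0 : (mixedDiff F (Function.update (P δ) i A) 0 -
      mixedDiff F (Function.update (P δ) i B) 0) φ = 0 from sub_eq_zero.1 h0
    refine functional_apply_eq_zero_of_locally _ fun v hv => ?_
    have huv : 0 < inner ℝ (u : Eucl (m + 1)) v := by
      by_contra h0
      exact hv (hφ v h0)
    rcases lt_trichotomy (inner ℝ (f + δ • (u : Eucl (m + 1))) (v : Eucl (m + 1))) 0 with h1 | h1 | h1
    · have hU : IsOpen {v : USphere (m + 1) |
          inner ℝ (f + δ • (u : Eucl (m + 1))) (v : Eucl (m + 1)) < 0} :=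
        isOpen_lt (by fun_prop) (by fun_prop)
      have hflat : ∀ C, IsFlatOn (Function.update (P δ) i C j) {v : USphere (m + 1) |
          inner ℝ (f + δ • (u : Eucl (m + 1))) (v : Eucl (m + 1)) < 0} := fun C =>
        ⟨x, fun w hw => by
          rw [hPj, supportFun_add, supportFun_segBody, supportFun_pointBody, max_eq_left hw.le,
            zero_add]⟩
      refine ⟨_, hU, h1, fun χ hχ => ?_⟩
      rw [sub_apply, hF.mixedDiff_apply_eq_zero_of_isFlatOn hU (hflat A) hχ,
        hF.mixedDiff_apply_eq_zero_of_isFlatOn hU (hflat B) hχ, sub_self]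
    -- On the tilted hyperplane `⟪f, v⟫ = -δ ⟪u, v⟫ < 0`, so `A` and `B` agree near `v`. On either
    -- side of it the tilted segment is flat.
    · have hU : IsOpen {v : USphere (m + 1) | inner ℝ f (v : Eucl (m + 1)) < 0} :=
        isOpen_lt (by fun_prop) (by fun_prop)
      refine ⟨_, hU, ?_, fun χ hχ => ?_⟩
      · rw [inner_add_left, real_inner_smul_left] at h1
        have := mul_pos hδ huv
        change inner ℝ f (v : Eucl (m + 1)) < 0
        linarith
      · rw [sub_apply, sub_eq_zero]
        refine hF.mixedDiff_apply_congr hU (fun k w hw => ?_) hχ 0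
        rcases eq_or_ne k i with rfl | hk
        · rw [Function.update_self, Function.update_self, h w hw]
        · rw [Function.update_of_ne hk, Function.update_of_ne hk]
    · have hU : IsOpen {v : USphere (m + 1) |
          0 < inner ℝ (f + δ • (u : Eucl (m + 1))) (v : Eucl (m + 1))} :=
        isOpen_lt (by fun_prop) (by fun_prop)
      have hflat : ∀ C, IsFlatOn (Function.update (P δ) i C j) {v : USphere (m + 1) |
          0 < inner ℝ (f + δ • (u : Eucl (m + 1))) (v : Eucl (m + 1))} := fun C =>
        ⟨f + δ • (u : Eucl (m + 1)) + x, fun w hw => by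
          rw [hPj, supportFun_add, supportFun_segBody, supportFun_pointBody,
            max_eq_right (le_of_lt hw), inner_add_left _ x]⟩
      refine ⟨_, hU, h1, fun χ hχ => ?_⟩
      rw [sub_apply, hF.mixedDiff_apply_eq_zero_of_isFlatOn hU (hflat A) hχ,
        hF.mixedDiff_apply_eq_zero_of_isFlatOn hU (hflat B) hχ, sub_self]
  have h0 : (0 : ℝ) ∈ {δ | mixedDiff F (Function.update (P δ) i A) 0 φ =
      mixedDiff F (Function.update (P δ) i B) 0 φ} := by
    refine closure_minimal (s := Ioi 0) hpos (isClosed_eq (hcont A) (hcont B)) ?_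
    rw [closure_Ioi]
    exact self_mem_Ici
  have hP0 : P 0 = L := by
    simp only [P, zero_smul, add_zero, ← hL, Function.update_eq_self]
  rw [mem_ofPred_eq, hP0] at h0
  rw [sub_apply, h0, sub_self]

end IsAreaFunctional

end TopOrder

/-! ### Mixed differences along segments -/

section Segments

variable {m : ℕ} {F : Bodies (m + 1) → (C(USphere (m + 1), ℂ) →L[ℂ] ℂ)}

/-- The mixed difference along segments. -/
def segDiff (F : Bodies (m + 1) → (C(USphere (m + 1), ℂ) →L[ℂ] ℂ)) (e : Fin m → Eucl (m + 1)) :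
    C(USphere (m + 1), ℂ) →L[ℂ] ℂ :=
  mixedDiff F (fun i => segBody (e i)) 0

namespace IsAreaFunctional

theorem continuous_segDiff_apply (hF : IsAreaFunctional F) (φ : C(USphere (m + 1), ℂ)) :
    Continuous fun e => segDiff F e φ :=
  (hF.continuous_mixedDiff_apply 0 φ).comp
    (continuous_pi fun i => continuous_segBody.comp (continuous_apply i))

theorem update_segBody (e : Fin m → Eucl (m + 1)) (i : Fin m) (x : Eucl (m + 1)) :
    (fun k => segBody (Function.update e i x k)) =
      Function.update (fun k => segBody (e k)) i (segBody x) :=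
  funext fun k => Function.apply_update (fun _ => segBody) e i x k

/-- The absolute value appears because reversing a segment only translates it. -/
theorem segDiff_update_smul (hF : IsAreaFunctional F) (e : Fin m → Eucl (m + 1)) (i : Fin m)
    (t : ℝ) (x : Eucl (m + 1)) : segDiff F (Function.update e i (t • x)) =
      ((|t| : ℝ) : ℂ) • segDiff F (Function.update e i x) := by
  have hpos : ∀ t : ℝ, 0 ≤ t → segDiff F (Function.update e i (t • x)) =
      (t : ℂ) • segDiff F (Function.update e i x) := fun t ht => by
    rw [segDiff, segDiff, update_segBody, update_segBody, segBody_smul ht,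
      hF.mixedDiff_update_smul _ _ _ ht]
  rcases le_total 0 t with ht | ht
  · rw [abs_of_nonneg ht, hpos t ht]
  · have h := hpos (-t) (neg_nonneg.2 ht)
    have h0 : mixedDiff F (Function.update (fun k => segBody (e k)) i (pointBody (-(t • x)))) 0 =
        0 := mixedDiff_eq_zero_of_invariant i (fun M => by
      rw [Function.update_self, hF.translate]) 0
    rw [abs_of_nonpos ht, ← h, neg_smul, segDiff, segDiff, update_segBody, update_segBody,
      segBody_neg, hF.mixedDiff_update_add, h0, add_zero]

/-- The triangle with vertices `0`, `e i`, `e i + s • e j` has the support function of its side `[0,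
e i]` where `e j` is negative and of `[0, e i + s • e j]` where it is positive. Since the `j`-th
entry is the segment `e j`, the triangle may be exchanged for either side. -/
theorem segDiff_update_add_smul_of_pos (hF : IsAreaFunctional F) (e : Fin m → Eucl (m + 1))
    {i j : Fin m} (hij : i ≠ j) {s : ℝ} (hs : 0 < s) :
    segDiff F (Function.update e i (e i + s • e j)) = segDiff F e := by
  let T := polytope ![0, e i, e i + s • e j]
  have hT : ∀ v, supportFun T v = max (max 0 (inner ℝ (e i) v)) (inner ℝ (e i) v + s * inner ℝ (e j) v) :=
    fun v => by
      have e2 : inner ℝ (e i + s • e j) v = inner ℝ (e i) v + s * inner ℝ (e j) v := by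
        rw [inner_add_left, real_inner_smul_left]
      refine le_antisymm (supportFun_polytope_le fun k => ?_) (max_le (max_le ?_ ?_) ?_)
      · fin_cases k
        · simp
        · simp
        · simp [← e2]
      · simpa using inner_le_supportFun_polytope ![0, e i, e i + s • e j] 0 v
      · simpa using inner_le_supportFun_polytope ![0, e i, e i + s • e j] 1 v
      · rw [← e2]
        simpa using inner_le_supportFun_polytope ![0, e i, e i + s • e j] 2 v
  have h1 : mixedDiff F (Function.update (fun k => segBody (e k)) i T) 0 =
      mixedDiff F (Function.update (fun k => segBody (e k)) i (segBody (e i))) 0 := by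
    refine hF.mixedDiff_update_eq_of_supportFun_eq hij (f := e j) (x := 0) ?_ fun v hv => ?_
    · rw [pointBody_zero, add_zero]
    · rw [hT, supportFun_segBody, max_eq_left]
      have := mul_neg_of_pos_of_neg hs hv
      exact le_max_of_le_right (by linarith)
  have h2 : mixedDiff F (Function.update (fun k => segBody (e k)) i T) 0 =
      mixedDiff F (Function.update (fun k => segBody (e k)) i (segBody (e i + s • e j))) 0 := by
    refine hF.mixedDiff_update_eq_of_supportFun_eq hij (f := -e j) (x := e j) ?_ fun v hv => ?_
    · simpa using segBody_neg (-e j)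
    · rw [inner_neg_left, neg_lt_zero] at hv
      have := mul_pos hs hv
      rw [hT, supportFun_segBody, inner_add_left, real_inner_smul_left, max_assoc,
        max_eq_right (a := inner ℝ (e i) (v : Eucl (m + 1)))]
      linarith
  rw [segDiff, segDiff, update_segBody, ← h2, h1, Function.update_eq_self]

theorem segDiff_update_add_smul (hF : IsAreaFunctional F) (e : Fin m → Eucl (m + 1))
    {i j : Fin m} (hij : i ≠ j) (s : ℝ) :
    segDiff F (Function.update e i (e i + s • e j)) = segDiff F e := by
  rcases lt_trichotomy s 0 with hs | rfl | hs
  · have h := hF.segDiff_update_add_smul_of_pos (Function.update e i (e i + s • e j)) hij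
      (neg_pos.2 hs)
    rw [Function.update_self, Function.update_of_ne hij.symm, Function.update_idem, neg_smul,
      add_neg_cancel_right, Function.update_eq_self] at h
    exact h.symm
  · rw [zero_smul, add_zero, Function.update_eq_self]
  · exact hF.segDiff_update_add_smul_of_pos e hij hs

theorem segDiff_smul (hF : IsAreaFunctional F) (e : Fin m → Eucl (m + 1)) (d : Fin m → ℝ) :
    segDiff F (fun i => d i • e i) = ((|∏ i, d i| : ℝ) : ℂ) • segDiff F e := by
  have h : ∀ s : Finset (Fin m), segDiff F (fun i => if i ∈ s then d i • e i else e i) =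
      ((|∏ i ∈ s, d i| : ℝ) : ℂ) • segDiff F e := by
    intro s
    induction s using Finset.induction_on with
    | empty => simp
    | insert i s hi ih =>
      have e1 : (fun k => if k ∈ insert i s then d k • e k else e k) =
          Function.update (fun k => if k ∈ s then d k • e k else e k) i (d i • e i) := by
        ext1 k
        rcases eq_or_ne k i with rfl | hk
        · simp
        · simp [hk]
      have e2 : Function.update (fun k => if k ∈ s then d k • e k else e k) i (e i) =
          fun k => if k ∈ s then d k • e k else e k := by
        rw [Function.update_eq_self_iff, if_neg hi]
      rw [e1, hF.segDiff_update_smul, e2, ih, smul_smul, Finset.prod_insert hi, abs_mul,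
        Complex.ofReal_mul]
  simpa using h Finset.univ

/-- Invertible matrices are products of diagonal matrices and transvections: the former scale by the
absolute determinant, the latter are the shears already treated. -/
theorem segDiff_matrix (hF : IsAreaFunctional F) {A : Matrix (Fin m) (Fin m) ℝ} (hA : A.det ≠ 0)
    (e : Fin m → Eucl (m + 1)) :
    segDiff F (fun i => ∑ j, A i j • e j) = ((|A.det| : ℝ) : ℂ) • segDiff F e := by
  revert e
  refine Matrix.diagonal_transvection_induction_of_det_ne_zero (fun A => ∀ e,
    segDiff F (fun i => ∑ j, A i j • e j) = ((|A.det| : ℝ) : ℂ) • segDiff F e) A hA ?_ ?_ ?_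
  · intro d _ e
    rw [Matrix.det_diagonal, ← hF.segDiff_smul]
    congr 1
    ext1 i
    simp [Matrix.diagonal_apply]
  · rintro ⟨i, j, hij, c⟩ e
    rw [Matrix.TransvectionStruct.det]
    simp only [abs_one, Complex.ofReal_one, one_smul, Matrix.TransvectionStruct.toMatrix]
    rw [← hF.segDiff_update_add_smul e hij c]
    congr 1
    ext1 k
    simp only [Matrix.transvection, Matrix.add_apply, add_smul, Finset.sum_add_distrib,
      Matrix.one_apply, ite_smul, one_smul, zero_smul, Finset.sum_ite_eq, Finset.mem_univ, if_true,
      Matrix.single_apply]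
    rcases eq_or_ne k i with rfl | hk
    · simp
    · simp [hk, hk.symm]
  · intro A B _ _ hA hB e
    have h := hA fun i => ∑ j, B i j • e j
    rw [hB, smul_smul] at h
    rw [Matrix.det_mul, abs_mul, Complex.ofReal_mul, ← h]
    congr 1
    ext1 i
    simp only [Matrix.mul_apply, Finset.sum_smul, Finset.smul_sum, smul_smul]
    exact Finset.sum_comm

end IsAreaFunctional

end Segments

/-! ### Frames of hyperplanes -/

section Frame

variable {m : ℕ}

/-- `e` is a basis of the hyperplane orthogonal to `u`. -/
structure IsFrame (u : USphere (m + 1)) (e : Fin m → Eucl (m + 1)) : Prop where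
  linearIndependent : LinearIndependent ℝ e
  inner_eq_zero (i : Fin m) : inner ℝ (e i) (u : Eucl (m + 1)) = 0

theorem inner_self_sphere {n : ℕ} (u : USphere n) : inner ℝ (u : Eucl n) (u : Eucl n) = 1 := by
  simp

theorem finrank_orthogonal_sphere (u : USphere (m + 1)) :
    Module.finrank ℝ (Submodule.span ℝ {(u : Eucl (m + 1))})ᗮ = m :=
  haveI : Fact (Module.finrank ℝ (Eucl (m + 1)) = m + 1) := ⟨by simp⟩
  Submodule.finrank_orthogonal_span_singleton (ne_zero_sphere u)

theorem exists_isFrame (u : USphere (m + 1)) : ∃ e, IsFrame u e := by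
  let b := Module.finBasisOfFinrankEq ℝ _ (finrank_orthogonal_sphere u)
  refine ⟨fun i => (b i : Eucl (m + 1)), ?_, fun i => ?_⟩
  · exact b.linearIndependent.map' (Submodule.subtype _) (Submodule.ker_subtype _)
  · exact Submodule.mem_orthogonal_singleton_iff_inner_left.1 (b i).2

theorem exists_isFrame_of_linearIndependent {e : Fin m → Eucl (m + 1)}
    (he : LinearIndependent ℝ e) : ∃ u, IsFrame u e := by
  have hne : (Submodule.span ℝ (range e))ᗮ ≠ ⊥ := by
    intro h
    rw [Submodule.orthogonal_eq_bot_iff] at h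
    have h1 := finrank_span_eq_card he
    rw [h, finrank_top] at h1
    simp at h1
  obtain ⟨x, hx, hx0⟩ := Submodule.exists_mem_ne_zero_of_ne_bot hne
  have hn : ‖x‖ ≠ 0 := norm_ne_zero_iff.2 hx0
  refine ⟨⟨‖x‖⁻¹ • x, by simp [norm_smul, hn]⟩, he, fun i => ?_⟩
  rw [inner_smul_right, (Submodule.mem_orthogonal _ _).1 hx _ (Submodule.subset_span ⟨i, rfl⟩),
    mul_zero]

namespace IsFrame

variable {u : USphere (m + 1)} {e e' : Fin m → Eucl (m + 1)}

theorem neg (he : IsFrame u e) : IsFrame (-u) e :=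
  ⟨he.linearIndependent, fun i => by rw [coe_neg_sphere, inner_neg_right, he.inner_eq_zero, neg_zero]⟩

theorem linearIndependent_cons (he : IsFrame u e) :
    LinearIndependent ℝ (Fin.cons (u : Eucl (m + 1)) e : Fin (m + 1) → Eucl (m + 1)) := by
  refine linearIndependent_finCons.2 ⟨he.linearIndependent, fun h => ?_⟩
  have h0 : ∀ w ∈ Submodule.span ℝ (range e), inner ℝ w (u : Eucl (m + 1)) = 0 := fun w hw => by
    induction hw using Submodule.span_induction with
    | mem w hw => obtain ⟨i, rfl⟩ := hw; exact he.inner_eq_zero i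
    | zero => exact inner_zero_left _
    | add a b _ _ ha hb => rw [inner_add_left, ha, hb, add_zero]
    | smul c a _ ha => rw [inner_smul_left, ha, mul_zero]
  have := h0 _ h
  rw [inner_self_sphere] at this
  exact one_ne_zero this

theorem eq_or_eq_neg (he : IsFrame u e) {v : USphere (m + 1)}
    (hv : ∀ i, inner ℝ (e i) (v : Eucl (m + 1)) = 0) : v = u ∨ v = -u := by
  set c := inner ℝ (u : Eucl (m + 1)) (v : Eucl (m + 1)) with hc
  have h : (v : Eucl (m + 1)) - c • (u : Eucl (m + 1)) = 0 := by
    refine eq_zero_of_linearIndependent_of_inner_eq_zero he.linearIndependent_cons fun i => ?_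
    rw [inner_sub_right, inner_smul_right]
    refine Fin.cases ?_ (fun i => ?_) i
    · rw [Fin.cons_zero, inner_self_sphere, ← hc, mul_one, sub_self]
    · rw [Fin.cons_succ, he.inner_eq_zero, hv, mul_zero, sub_zero]
  rw [sub_eq_zero] at h
  have h1 : |c| = 1 := by
    have := congrArg norm h
    rw [norm_smul] at this
    simpa using this.symm
  rcases (abs_eq zero_le_one).1 h1 with h2 | h2
  · exact Or.inl (Subtype.ext (by rw [h, h2, one_smul]))
  · exact Or.inr (Subtype.ext (by rw [h, h2, neg_smul, one_smul, coe_neg_sphere]))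

theorem exists_basis (he : IsFrame u e) :
    ∃ b : Module.Basis (Fin m) ℝ (Submodule.span ℝ {(u : Eucl (m + 1))})ᗮ,
      ∀ i, (b i : Eucl (m + 1)) = e i := by
  let f : Fin m → (Submodule.span ℝ {(u : Eucl (m + 1))})ᗮ := fun i =>
    ⟨e i, Submodule.mem_orthogonal_singleton_iff_inner_left.2 (he.inner_eq_zero i)⟩
  have hf : LinearIndependent ℝ f := LinearIndependent.of_comp (Submodule.subtype _)
    he.linearIndependent
  refine ⟨Module.Basis.mk hf (hf.span_eq_top_of_card_eq_finrank' ?_).ge, fun i => ?_⟩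
  · rw [Fintype.card_fin, finrank_orthogonal_sphere]
  · rw [Module.Basis.mk_apply]

theorem exists_matrix (he : IsFrame u e) (he' : IsFrame u e') :
    ∃ A : Matrix (Fin m) (Fin m) ℝ, A.det ≠ 0 ∧ e' = fun i => ∑ j, A i j • e j := by
  obtain ⟨b, hb⟩ := he.exists_basis
  obtain ⟨b', hb'⟩ := he'.exists_basis
  refine ⟨(b.toMatrix b').transpose, ?_, funext fun i => ?_⟩
  · rw [Matrix.det_transpose]
    have := b.invertibleToMatrix b'
    exact ((b.toMatrix b').isUnit_det_of_invertible).ne_zero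
  · have h := congrArg (Submodule.subtype _) (b.sum_toMatrix_smul_self b' i)
    rw [map_sum] at h
    simpa [hb, hb'] using h.symm

theorem exists_segDiff_eq_smul (he : IsFrame u e) (he' : IsFrame u e') :
    ∃ c : ℂ, c ≠ 0 ∧ ∀ F : Bodies (m + 1) → (C(USphere (m + 1), ℂ) →L[ℂ] ℂ),
      IsAreaFunctional F → segDiff F e' = c • segDiff F e := by
  obtain ⟨A, hA, rfl⟩ := he.exists_matrix he'
  exact ⟨((|A.det| : ℝ) : ℂ), by simpa using hA, fun F hF => hF.segDiff_matrix hA e⟩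

end IsFrame

/-- The positive part of the inner product with `u`. -/
def hemi (u : USphere (m + 1)) : C(USphere (m + 1), ℂ) :=
  ⟨fun v => ((max 0 (inner ℝ (u : Eucl (m + 1)) v) : ℝ) : ℂ), by fun_prop⟩

theorem hemi_apply (u v : USphere (m + 1)) :
    hemi u v = ((max 0 (inner ℝ (u : Eucl (m + 1)) v) : ℝ) : ℂ) := rfl

theorem hemi_self (u : USphere (m + 1)) : hemi u u = 1 := by
  rw [hemi_apply, inner_self_sphere]
  simp

theorem hemi_neg_of_nonneg {u v : USphere (m + 1)} (h : 0 ≤ inner ℝ (u : Eucl (m + 1)) v) :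
    hemi u (-v) = 0 := by
  rw [hemi_apply, coe_neg_sphere, inner_neg_right, max_eq_left (neg_nonpos.2 h)]
  simp

theorem hemi_neg_self (u : USphere (m + 1)) : hemi (-u) u = 0 := by
  simpa using hemi_neg_of_nonneg (u := -u) (v := -u) (by rw [inner_self_sphere]; exact zero_le_one)

theorem hemi_self_neg (u : USphere (m + 1)) : hemi u (-u) = 0 :=
  hemi_neg_of_nonneg (by rw [inner_self_sphere]; exact zero_le_one)

variable {F : Bodies (m + 1) → (C(USphere (m + 1), ℂ) →L[ℂ] ℂ)} {u : USphere (m + 1)}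
  {e : Fin m → Eucl (m + 1)}

/-- Any direction other than `±u` has nonzero product with some `e i`, so the segment `e i` is flat
near it. Thus the functional is concentrated at `±u`. -/
theorem IsAreaFunctional.segDiff_apply_eq_zero (hF : IsAreaFunctional F) (he : IsFrame u e)
    {φ : C(USphere (m + 1), ℂ)} (h : φ u = 0) (h' : φ (-u) = 0) : segDiff F e φ = 0 := by
  refine functional_apply_eq_zero_of_locally _ fun v hv => ?_
  have : ∃ i, inner ℝ (e i) (v : Eucl (m + 1)) ≠ 0 := by
    by_contra! hcon
    rcases he.eq_or_eq_neg hcon with rfl | rfl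
    · exact hv h
    · exact hv h'
  obtain ⟨i, hi⟩ := this
  rcases lt_or_gt_of_ne hi with hi | hi
  · have hU : IsOpen {w : USphere (m + 1) | inner ℝ (e i) (w : Eucl (m + 1)) < 0} :=
      isOpen_lt (by fun_prop) (by fun_prop)
    refine ⟨_, hU, hi, fun χ hχ => hF.mixedDiff_apply_eq_zero_of_isFlatOn (i := i) hU
      ⟨0, fun w hw => ?_⟩ hχ 0⟩
    rw [supportFun_segBody, max_eq_left (le_of_lt hw), inner_zero_left]
  · have hU : IsOpen {w : USphere (m + 1) | 0 < inner ℝ (e i) (w : Eucl (m + 1))} :=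
      isOpen_lt (by fun_prop) (by fun_prop)
    refine ⟨_, hU, hi, fun χ hχ => hF.mixedDiff_apply_eq_zero_of_isFlatOn (i := i) hU
      ⟨e i, fun w hw => ?_⟩ hχ 0⟩
    rw [supportFun_segBody, max_eq_right (le_of_lt hw)]

theorem IsAreaFunctional.segDiff_apply (hF : IsAreaFunctional F) (he : IsFrame u e)
    (φ : C(USphere (m + 1), ℂ)) : segDiff F e φ =
      φ u * segDiff F e (hemi u) + φ (-u) * segDiff F e (hemi (-u)) := by
  -- The functions `hemi u` and `hemi (-u)` are dual to evaluation at `u` and `-u`, so the corrected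
  -- function vanishes at both poles.
  have h := hF.segDiff_apply_eq_zero he (φ := φ - φ u • hemi u - φ (-u) • hemi (-u))
    (by simp [hemi_self, hemi_neg_self]) (by simp [hemi_self, hemi_self_neg])
  rw [map_sub, map_sub, map_smul, map_smul, smul_eq_mul, smul_eq_mul] at h
  linear_combination h

end Frame

/-! ### The surface area measure of parallelepipeds -/

section Parallelepiped

theorem coe_segBody {n : ℕ} (x : Eucl n) : (segBody x : Set (Eucl n)) = segment ℝ 0 x := by
  rw [← convexHull_pair]
  change convexHull ℝ (range ![0, x]) = _
  rw [Matrix.range_cons, Matrix.range_cons, Matrix.range_empty, union_empty, singleton_union]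

theorem segBody_zero {n : ℕ} : segBody (0 : Eucl n) = 0 :=
  SetLike.coe_injective (by rw [coe_segBody, segment_same]; rfl)

theorem coe_sum_body {n : ℕ} {ι : Type*} (s : Finset ι) (K : ι → Bodies n) :
    ((∑ i ∈ s, K i : Bodies n) : Set (Eucl n)) = ∑ i ∈ s, (K i : Set (Eucl n)) := by
  classical
  induction s using Finset.induction_on with
  | empty => rfl
  | insert i s hi ih => rw [Finset.sum_insert hi, Finset.sum_insert hi, ConvexBody.coe_add, ih]

theorem vol_sum_segBody {n : ℕ} (v : Fin n → Eucl n) :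
    vol (∑ i, segBody (v i)) = |(EuclideanSpace.basisFun (Fin n) ℝ).toBasis.det v| := by
  have h : ((∑ i, segBody (v i) : Bodies n) : Set (Eucl n)) = parallelepiped v := by
    rw [parallelepiped_eq_sum_segment, coe_sum_body]
    simp only [coe_segBody]
  rw [vol, h, measureReal_def, ← (EuclideanSpace.basisFun (Fin n) ℝ).addHaar_eq_volume,
    Measure.addHaar_parallelepiped, ENNReal.toReal_ofReal (abs_nonneg _)]

variable {m : ℕ} {u : USphere (m + 1)} {e : Fin m → Eucl (m + 1)}

/-- A sum of `m + 1` segments is a parallelepiped, whose volume is the absolute determinant and is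
linear in the length of one edge. Segments missing from `s` are entered as zero vectors to keep the
number of edges fixed. -/
theorem volDeriv_sum_segBody (x : Eucl (m + 1)) (e : Fin m → Eucl (m + 1)) (s : Finset (Fin m)) :
    volDeriv (∑ i ∈ s, segBody (e i)) (segBody x) =
      |(EuclideanSpace.basisFun (Fin (m + 1)) ℝ).toBasis.det
        (Fin.cons x fun i => if i ∈ s then e i else 0)| := by
  set d := |(EuclideanSpace.basisFun (Fin (m + 1)) ℝ).toBasis.det
        (Fin.cons x fun i => if i ∈ s then e i else 0)| with hd
  have h : ∀ t ∈ Ici (0 : ℝ), vol (∑ i ∈ s, segBody (e i) + t • segBody x) = t * d := by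
    intro t ht
    have e1 : ∑ i ∈ s, segBody (e i) + t • segBody x = ∑ i, segBody
        ((Fin.cons (t • x) fun i => if i ∈ s then e i else 0 : Fin (m + 1) → Eucl (m + 1)) i) := by
      rw [Fin.sum_univ_succ, Fin.cons_zero, segBody_smul ht,
        add_comm (∑ i ∈ s, segBody (e i))]
      simp only [Fin.cons_succ, apply_ite segBody, segBody_zero, Finset.sum_ite_mem,
        Finset.univ_inter]
    rw [e1, vol_sum_segBody]
    have := MultilinearMap.cons_smul
      (EuclideanSpace.basisFun (Fin (m + 1)) ℝ).toBasis.det.toMultilinearMap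
      (fun i => if i ∈ s then e i else 0) t x
    rw [AlternatingMap.coe_multilinearMap] at this
    rw [this, smul_eq_mul, abs_mul, abs_of_nonneg ht]
  have h1 : HasDerivWithinAt (fun t : ℝ => vol (∑ i ∈ s, segBody (e i) + t • segBody x)) d
      (Ici 0) 0 := by
    have := ((hasDerivAt_id (0 : ℝ)).mul_const d).hasDerivWithinAt (s := Ici 0)
    rw [one_mul] at this
    exact this.congr h (h 0 self_mem_Ici)
  exact UniqueDiffWithinAt.eq_deriv _ (uniqueDiffOn_Ici (0 : ℝ) 0 self_mem_Ici)
    (hasDerivWithinAt_vol (by omega) _ _) h1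

theorem densityFunctional_one_hemi (K : Bodies (m + 1)) (u : USphere (m + 1)) :
    densityFunctional 1 K (hemi u) = (volDeriv K (segBody (u : Eucl (m + 1))) : ℂ) := by
  rw [← integralCLM_supportMap (by omega), integralCLM_apply, densityFunctional_apply,
    ← integral_complex_ofReal]
  simp only [ContinuousMap.one_apply, mul_one, hemi_apply, supportMap_apply, supportFun_segBody]

/-- The function `hemi u` is the support function of the segment `[0, u]`, so each term is a
determinant. Proper subsets produce a zero column, and the full set gives the nonzero determinant of
`u` together with its frame. -/
theorem segDiff_densityFunctional_one_ne_zero (he : IsFrame u e) :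
    segDiff (densityFunctional 1) e (hemi u) ≠ 0 := by
  rw [segDiff, mixedDiff_apply]
  simp only [densityFunctional_one_hemi]
  rw [mixedDiff, Finset.sum_eq_single Finset.univ]
  · rw [zero_add, volDeriv_sum_segBody]
    simp only [Finset.mem_univ, if_true, zsmul_eq_mul]
    refine mul_ne_zero (by simp) (Complex.ofReal_ne_zero.2 (abs_ne_zero.2 ?_))
    refine (((EuclideanSpace.basisFun (Fin (m + 1)) ℝ).toBasis.is_basis_iff_det).1
      ⟨he.linearIndependent_cons, ?_⟩).ne_zero
    exact he.linearIndependent_cons.span_eq_top_of_card_eq_finrank' (by simp)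
  · intro s _ hs
    obtain ⟨i, hi⟩ : ∃ i, i ∉ s := by
      by_contra! h
      exact hs (Finset.eq_univ_of_forall h)
    rw [zero_add, volDeriv_sum_segBody, AlternatingMap.map_coord_zero _ i.succ (by simp [hi])]
    simp
  · simp

end Parallelepiped

/-! ### Homogeneous functionals of maximal degree -/

section TopDegree

variable {m : ℕ} {F : Bodies (m + 1) → (C(USphere (m + 1), ℂ) →L[ℂ] ℂ)}

/-- On the dense set of segment-like tuples the mixed difference is, near each direction, either
zero by flatness or a segment difference up to translations. -/
theorem IsAreaFunctional.mixedDiff_eq_zero_of_segDiff_eq_zero (hF : IsAreaFunctional F)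
    (h : ∀ e, LinearIndependent ℝ e → segDiff F e = 0) (L : Fin m → Bodies (m + 1))
    (K : Bodies (m + 1)) : mixedDiff F L K = 0 := by
  rw [hF.mixedDiff_eq_mixedDiff_zero]
  ext φ
  refine congrFun ((hF.continuous_mixedDiff_apply 0 φ).ext_on dense_segmentLike
    (continuous_const (y := (0 : ℂ))) fun L hL => ?_) L
  have : mixedDiff F L 0 = 0 := functional_eq_zero_of_locally _ fun u => by
    obtain ⟨U, hU, huU, ⟨i, hi⟩ | ⟨e, x, he, hex⟩⟩ := hL u
    · exact ⟨U, hU, huU, fun φ hφ => hF.mixedDiff_apply_eq_zero_of_isFlatOn hU hi hφ 0⟩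
    · refine ⟨U, hU, huU, fun φ hφ => ?_⟩
      rw [hF.mixedDiff_apply_congr hU hex hφ 0, hF.mixedDiff_add_pointBody]
      exact congrArg (fun T : C(USphere (m + 1), ℂ) →L[ℂ] ℂ => T φ) (h e he)
  simp only [this, zero_apply]

/-- Vanishing mixed differences of order `m` make `t ↦ F (tK)` a polynomial of degree less than `m`,
while homogeneity makes it a multiple of `t ^ m`. -/
theorem IsAreaFunctional.eq_zero_of_segDiff_eq_zero (hF : IsAreaFunctional F)
    (hhom : ∀ (t : ℝ) (K : Bodies (m + 1)), 0 ≤ t → F (t • K) = ((t : ℂ) ^ m) • F K)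
    (h : ∀ e, LinearIndependent ℝ e → segDiff F e = 0) (K : Bodies (m + 1)) : F K = 0 := by
  ext φ
  have key := fun t ht => eq_sum_of_sum_choose_eq_zero (d := m) (g := fun t => F (t • K) φ)
    ((hF.continuous φ).comp_continuousOn (continuousOn_smul_body K)) (fun s t hs ht => by
      have h1 := mixedDiff_apply F (fun _ : Fin m => t • K) (s • K) φ
      rw [hF.mixedDiff_eq_zero_of_segDiff_eq_zero h, zero_apply, mixedDiff_const] at h1
      simpa only [smul_add_nsmul_smul hs ht] using h1.symm) (t := t) ht
  -- These are the coefficients of the polynomial expression for `F (tK) φ` minus `t ^ m * F K φ`.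
  let a : ℕ → ℂ := fun k => if k = m then -F K φ else
    ∑ j ∈ Finset.range m, nodeCoeff ℂ m k j * F ((j : ℝ) • K) φ
  have ha := eq_zero_of_forall_sum_pow_eq_zero (d := m + 1) (a := a) (fun t ht => by
    have h1 := key t ht.le
    simp only [hhom t K ht.le, smul_apply, smul_eq_mul] at h1
    rw [Finset.sum_range_succ]
    have h2 : ∑ k ∈ Finset.range m, a k * ((t : ℝ) : ℂ) ^ k = (t : ℂ) ^ m * F K φ := by
      refine Eq.trans (Finset.sum_congr rfl fun k hk => ?_) h1.symm
      simp only [a, if_neg (Finset.mem_range.1 hk).ne]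
      rfl
    refine (congrArg (· + a m * ((t : ℝ) : ℂ) ^ m) h2).trans ?_
    simp only [a, if_true]
    ring) (Nat.lt_succ_self m)
  simpa [a] using ha

/-- The ratio of the mixed differences of `F` and of the surface area measure along a frame. -/
def densityAt (F : Bodies (m + 1) → (C(USphere (m + 1), ℂ) →L[ℂ] ℂ)) (u : USphere (m + 1)) : ℂ :=
  segDiff F (exists_isFrame u).choose (hemi u) /
    segDiff (densityFunctional 1) (exists_isFrame u).choose (hemi u)

/-- Passing to another frame of `u^⊥` multiplies numerator and denominator of `densityAt` by the
same determinant, so the chosen frame is immaterial. -/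
theorem IsAreaFunctional.segDiff_hemi (hF : IsAreaFunctional F) {u : USphere (m + 1)}
    {e : Fin m → Eucl (m + 1)} (he : IsFrame u e) : segDiff F e (hemi u) =
      densityAt F u * segDiff (densityFunctional 1) e (hemi u) := by
  have h0 := (exists_isFrame u).choose_spec
  obtain ⟨c, -, h⟩ := h0.exists_segDiff_eq_smul he
  rw [h F hF, h _ (isAreaFunctional_densityFunctional (by omega) 1), smul_apply, smul_apply,
    densityAt, smul_eq_mul, smul_eq_mul]
  have := segDiff_densityFunctional_one_ne_zero h0
  field_simp

/-- The frame selected in `densityAt` need not depend continuously on `u`. Near `u₀` it is replaced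
by the projections of a fixed frame to `u^⊥`, and the test function is frozen at `hemi u₀`. -/
theorem IsAreaFunctional.continuous_densityAt (hF : IsAreaFunctional F) :
    Continuous (densityAt F) := by
  have hS := isAreaFunctional_densityFunctional (n := m + 1) (by omega) 1
  rw [continuous_iff_continuousAt]
  intro u₀
  obtain ⟨b, hb⟩ := exists_isFrame u₀
  let e : USphere (m + 1) → Fin m → Eucl (m + 1) := fun u i =>
    b i - inner ℝ (b i) (u : Eucl (m + 1)) • (u : Eucl (m + 1))
  have hec : Continuous e := by fun_prop
  have he0 : e u₀ = b := funext fun i => by simp only [e, hb.inner_eq_zero, zero_smul, sub_zero]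
  have hframe : ∀ᶠ u in 𝓝 u₀, IsFrame u (e u) := by
    have h1 : {f : Fin m → Eucl (m + 1) | LinearIndependent ℝ f} ∈ 𝓝 (e u₀) :=
      isOpen_setOfPred_linearIndependent.mem_nhds (by
        rw [he0]
        exact hb.linearIndependent)
    filter_upwards [hec.continuousAt h1] with u hu
    refine ⟨hu, fun i => ?_⟩
    simp only [e]
    rw [inner_sub_left, real_inner_smul_left, inner_self_sphere, mul_one, sub_self]
  have hpos : ∀ᶠ u : USphere (m + 1) in 𝓝 u₀, 0 < inner ℝ (u₀ : Eucl (m + 1)) u :=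
    (isOpen_lt (f := fun _ : USphere (m + 1) => (0 : ℝ))
      (g := fun u : USphere (m + 1) => inner ℝ (u₀ : Eucl (m + 1)) u) (by fun_prop)
      (by fun_prop)).mem_nhds (by
        change 0 < inner ℝ (u₀ : Eucl (m + 1)) u₀
        rw [inner_self_sphere]
        exact one_pos)
  have heq : ∀ᶠ u in 𝓝 u₀, segDiff F (e u) (hemi u₀) /
      segDiff (densityFunctional 1) (e u) (hemi u₀) = densityAt F u := by
    filter_upwards [hframe, hpos] with u hu hu0
    have h1 : hemi u₀ u ≠ 0 := by
      rw [hemi_apply, Complex.ofReal_ne_zero, max_eq_right hu0.le]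
      exact hu0.ne'
    -- For `u` in the hemisphere of `u₀` the frozen test function vanishes at `-u`, and its value at
    -- `u` cancels from the quotient.
    rw [hF.segDiff_apply hu, hS.segDiff_apply hu, hemi_neg_of_nonneg hu0.le, zero_mul, zero_mul,
      add_zero, add_zero, hF.segDiff_hemi hu]
    have h2 := segDiff_densityFunctional_one_ne_zero hu
    field_simp
  refine ContinuousAt.congr ?_ heq
  refine ((hF.continuous_segDiff_apply _).comp hec).continuousAt.div
    ((hS.continuous_segDiff_apply _).comp hec).continuousAt ?_
  rw [he0]
  exact segDiff_densityFunctional_one_ne_zero hb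

theorem segDiff_densityFunctional (ψ : C(USphere (m + 1), ℂ)) (e : Fin m → Eucl (m + 1))
    (φ : C(USphere (m + 1), ℂ)) :
    segDiff (densityFunctional ψ) e φ = segDiff (densityFunctional 1) e (φ * ψ) := by
  simp only [segDiff, mixedDiff_apply, densityFunctional_apply, ContinuousMap.mul_apply,
    ContinuousMap.one_apply, mul_one]

/-- Both sides have the same segment differences: these are concentrated at `±u`, and a frame of `u`
is also one of `-u`, so the two masses match separately. -/
theorem IsAreaFunctional.eq_densityFunctional (hF : IsAreaFunctional F)
    (hhom : ∀ (t : ℝ) (K : Bodies (m + 1)), 0 ≤ t → F (t • K) = ((t : ℂ) ^ m) • F K)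
    (K : Bodies (m + 1)) :
    F K = densityFunctional ⟨densityAt F, hF.continuous_densityAt⟩ K := by
  set ψ : C(USphere (m + 1), ℂ) := ⟨densityAt F, hF.continuous_densityAt⟩
  have hS := isAreaFunctional_densityFunctional (n := m + 1) (by omega) 1
  refine sub_eq_zero.1 ((hF.sub (isAreaFunctional_densityFunctional (by omega) ψ)
    ).eq_zero_of_segDiff_eq_zero (fun t K ht => ?_) (fun e he => ?_) K)
  · rw [hhom t K ht, densityFunctional_smul (by omega) ψ ht, Nat.add_sub_cancel]
    exact (smul_sub ((t : ℂ) ^ m) (F K) (densityFunctional ψ K)).symm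
  · obtain ⟨u, hu⟩ := exists_isFrame_of_linearIndependent he
    have h1 : segDiff (fun K => F K - densityFunctional ψ K) e =
      segDiff F e - segDiff (densityFunctional ψ) e := mixedDiff_sub _ _ _ _
    rw [h1]
    ext φ
    rw [sub_apply, segDiff_densityFunctional, hF.segDiff_apply hu, hS.segDiff_apply hu,
      hF.segDiff_hemi hu, hF.segDiff_hemi hu.neg]
    simp only [ContinuousMap.mul_apply, ψ, ContinuousMap.coe_mk, zero_apply]
    ring

/-- Testing with `hemi u` along a frame of `u` reads off the density at `u`, up to a nonzero factor.
-/
theorem densityFunctional_injective {ψ₁ ψ₂ : C(USphere (m + 1), ℂ)}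
    (h : densityFunctional ψ₁ = densityFunctional ψ₂) : ψ₁ = ψ₂ := by
  have hS := isAreaFunctional_densityFunctional (n := m + 1) (by omega) 1
  ext u
  obtain ⟨e, he⟩ := exists_isFrame u
  have h1 : segDiff (densityFunctional ψ₁) e (hemi u) = segDiff (densityFunctional ψ₂) e (hemi u) := by
    rw [h]
  rw [segDiff_densityFunctional ψ₁, segDiff_densityFunctional ψ₂,
    hS.segDiff_apply he (hemi u * ψ₁), hS.segDiff_apply he (hemi u * ψ₂)] at h1
  simp only [ContinuousMap.mul_apply, hemi_self, hemi_self_neg, one_mul, zero_mul, add_zero] at h1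
  exact mul_right_cancel₀ (segDiff_densityFunctional_one_ne_zero he) h1

theorem mem_AreaHom_pred_iff {n : ℕ} (hn : 1 ≤ n) {Ψ : Bodies n → SphereMeasure n} :
    Ψ ∈ AreaHom n (n - 1) ↔ ∃ ψ : C(USphere n, ℂ), HasSurfaceDensity Ψ ψ := by
  obtain ⟨m, rfl⟩ := Nat.exists_eq_add_of_le' hn
  rw [mem_AreaHom_iff]
  constructor
  · rintro ⟨hΨ, hhom⟩
    exact ⟨_, hasSurfaceDensity_iff.2 (hΨ.eq_densityFunctional fun t K ht => hhom t K ht)⟩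
  · rintro ⟨ψ, hψ⟩
    rw [hasSurfaceDensity_iff] at hψ
    refine ⟨?_, fun t K ht => ?_⟩
    · rw [show (fun K => pairingCLM (Ψ K)) = densityFunctional ψ from funext hψ]
      exact isAreaFunctional_densityFunctional hn ψ
    · rw [hψ, hψ, densityFunctional_smul hn ψ ht]

theorem hasSurfaceDensity_unique {n : ℕ} (hn : 1 ≤ n) {Ψ : Bodies n → SphereMeasure n}
    {ψ₁ ψ₂ : C(USphere n, ℂ)} (h₁ : HasSurfaceDensity Ψ ψ₁) (h₂ : HasSurfaceDensity Ψ ψ₂) :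
    ψ₁ = ψ₂ := by
  obtain ⟨m, rfl⟩ := Nat.exists_eq_add_of_le' hn
  rw [hasSurfaceDensity_iff] at h₁ h₂
  exact densityFunctional_injective (funext fun K => (h₁ K).symm.trans (h₂ K))

end TopDegree

end LocalArea

end

theorem theoremA (n : ℕ) (hn : 1 ≤ n) :
    -- every convex body has exactly one surface area measure
    (∀ K : Bodies n, ∃! μ : FiniteMeasure (USphere n), IsSurfaceAreaMeasure K μ) ∧
    -- `Area(ℝⁿ)` is the direct sum of the subspaces `Area_k(ℝⁿ)`, `k = 0, …, n - 1`
    DirectSum.IsInternal (fun k : Fin n => (AreaHom n k).submoduleOf (Area n)) ∧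
    -- `Ψ ↦ Ψ({0})` is an isomorphism `Area_0(ℝⁿ) ≅ 𝓜(S^{n-1})`
    (∃ e : AreaHom n 0 ≃ₗ[ℂ] SphereMeasure n,
      ∀ Ψ : AreaHom n 0, e Ψ = (Ψ : Bodies n → SphereMeasure n) 0) ∧
    -- `Area_{n-1}(ℝⁿ)` consists exactly of the maps `ψ • S_{n-1}`
    (∀ Ψ : Bodies n → SphereMeasure n,
      Ψ ∈ AreaHom n (n - 1) ↔ ∃ ψ : C(USphere n, ℂ), HasSurfaceDensity Ψ ψ) ∧
    -- and the density is unique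
    (∀ (Ψ : Bodies n → SphereMeasure n) (ψ₁ ψ₂ : C(USphere n, ℂ)),
      HasSurfaceDensity Ψ ψ₁ → HasSurfaceDensity Ψ ψ₂ → ψ₁ = ψ₂) :=
  ⟨LocalArea.existsUnique_isSurfaceAreaMeasure hn, LocalArea.isInternal_AreaHom n,
    ⟨LinearEquiv.ofBijective (LocalArea.evalZero n) (LocalArea.evalZero_bijective n),
      fun _ => rfl⟩,
    fun _ => LocalArea.mem_AreaHom_pred_iff hn,
    fun _ _ _ => LocalArea.hasSurfaceDensity_unique hn⟩
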